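/- Let $\mathbb F\in\{\mathbb R,\mathbb C\}$. **Conventions.** For a finite dimensional vector space $V$, $\mathcal N_V$ is the set of norms on $V$ with the topology of pointwise convergence, and $\omega(m,n)=\log\max\{\|\mathrm{Id}\|_{(V,m),(V,n)},\|\mathrm{Id}\|_{(V,n),(V,m)}\}$ (and $\omega=0$ if $V=0$). The group $GL(V)$ acts on $\mathcal N_V$ by $(\Delta\cdot m)(x)=m(\Delta^{-1}x)$ and on $\mathcal N_{V^*}$ by $(\Delta\cdot n)(f)=n(f\circ\Delta)$. Let $\mathcal B_V=\mathcal N_V/GL(V)$ and $\mathcal D_V=(\mathcal N_V\times\mathcal N_{V^*})/GL(V)$, with the quotient topologies, and let $\widetilde\omega_2$ be the quotient metric on $\mathcal D_V$ of $\omega_2((m,n),(p,q))=\omega(m,p)+\omega(n,q)$. For a normed space $E$, $\mathcal N_V(E)$ is the set of norms $m$ on $V$ such that $(V,m)$ embeds isometrically into $E$; $\mathcal B_V(E)$ and $\mathcal D_V(E)$ are the sets of classes of elements of $\mathcal N_V(E)$ and of $\mathcal N_V(E)\times\mathcal N_{V^*}(E)$. Write $\mathcal B_k,\mathcal D_k$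 for $V=\mathbb F^k$. All these carry the subspace topology, and a metric is *compatible* if it induces the topology of its space. For an injective linear $T:V\to E$ let $\nu(T)(x)=\|Tx\|_E$. For a finite dimensional normed space $X$ and $m,n\in\mathcal N_X(E)$ put $$\partial_{X,E}(m,n)=\inf\{\|T-U\|_{X,E}: \nu(T)=m,\ \nu(U)=n\}.$$ Let $\mathrm{Gr}(k,E)$ be the set of $k$-dimensional subspaces of $E$, with the gap metric $\Lambda_E(U,W)$, the Hausdorff distance between the unit balls of $U$ and $W$; let $\tau_{k,E}(W)\in\mathcal B_k(E)$ be the class of the norms $m$ on $\mathbb F^k$ such that $(\mathbb F^k,m)$ is isometric to $W$, and $$\gamma_{k,E}(b,c)=\inf\{\Lambda_E(U,W):\tau_{k,E}(U)=b,\ \tau_{k,E}(W)=c\}.$$ Let $\mathcal L^{k,w^*}(E^*,E)$ be the set of bounded operators $T:E^*\to E$ of the form $T=T_0\circ T_1^*$ with $T_0:\mathbb F^k\to E$ and $T_1:(\mathbb F^k)^*\to E$ linear and injective (here $T_1^*:E^*\to(\mathbb F^k)^{**}=\mathbb F^k$); put $\nu^2_{k,E}(T)=[(\nu(T_0),\nu(T_1))]\in\mathcal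 D_k(E)$ and $$\mathfrak d_{k,E}(D,D')=\inf\{\|T-U\|_{E^*,E}:\nu^2_{k,E}(T)=D,\ \nu^2_{k,E}(U)=D'\}.$$ For $\delta>0$, $\mathrm{Emb}_\delta(X,Y)$ is the set of linear $T:X\to Y$ with $(1+\delta)^{-1}\|x\|\le\|Tx\|\le(1+\delta)\|x\|$; $\mathrm{Emb}(X,Y)$ is the set of linear isometric embeddings, $\mathrm{Iso}(E)$ the group of surjective linear isometries of $E$, and $\mathrm{Age}(E)$ the class of finite dimensional subspaces of $E$. A class $\mathcal G$ of finite dimensional normed spaces is an *amalgamation class* if $\{0\}\in\mathcal G$ and for all $\varepsilon>0$ and $k\in\mathbb N$ there is $\delta>0$ such that for $X,Y,Z\in\mathcal G$ with $\dim X=k$, $\gamma\in\mathrm{Emb}_\delta(X,Y)$ and $\eta\in\mathrm{Emb}_\delta(X,Z)$ there are $W\in\mathcal G$, $i\in\mathrm{Emb}(Y,W)$ and $j\in\mathrm{Emb}(Z,W)$ with $\|i\circ\gamma-j\circ\eta\|\le\varepsilon$. Its *Fraïssé limit* is the separable Banach space $F$ such that every member of $\mathcal G$ embeds isometrically into $F$;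 the subspaces of those subspaces of $F$ that are isometric to members of $\mathcal G$ are $\Lambda_F$-dense in $\mathrm{Age}(F)$; and $F$ is *Fraïssé*: for all $\varepsilon>0$ and $k$ there is $\delta>0$ such that for every $k$-dimensional $X\in\mathrm{Age}(F)$ and $\gamma,\eta\in\mathrm{Emb}_\delta(X,F)$ there is $g\in\mathrm{Iso}(F)$ with $\|g\circ\eta-\gamma\|\le\varepsilon$. If a group $G$ acts by isometries on a metric space $(M,d)$, then $M/\!/G$ is the set of closures of orbits, with the quotient distance $\widetilde d(A,B)=\inf\{d(p,q):p\in A,\ q\in B\}$. The actions used below are $g\cdot T=g\circ T$ of $\mathrm{Iso}(E)$ on injective operators $X\to E$, $g\cdot W=g(W)$ of $\mathrm{Iso}(E)$ on $\mathrm{Gr}(k,E)$, and $(g,h)\cdot T=g\circ T\circ h^*$ of $\mathrm{Iso}(E)^2$ on $\mathcal L^{k,w^*}(E^*,E)$. **Theorem.** Let $E=(\mathbb F^\infty,\|\cdot\|_E)$ be the space of finitely supported sequences with some norm, suppose that $\mathrm{Age}(E)$ is an amalgamation class, and let $\widehat E$ be its Fraïssé limit. (a) For every finite dimensional normed space $X$: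 $\partial_{X,\widehat E}$ is a compatible metric on $\mathcal N_X(\widehat E)$, uniformly equivalent to $\omega$ on $\omega$-bounded subsets of $\mathcal N_X(\widehat E)$; $\partial_{X,E}=\partial_{X,\widehat E}$ on $\mathcal N_X(E)$; and $\mathcal N_X(E)$ is a dense subset of $\mathcal N_X(\widehat E)$. The map $T\mapsto\nu(T)$ induces a bijective isometry from the space of closures of $\mathrm{Iso}(\widehat E)$-orbits of injective operators $X\to\widehat E$ (with the operator norm distance) onto $(\mathcal N_X(\widehat E),\partial_{X,\widehat E})$. (b) For every $k\in\mathbb N$: $\gamma_{k,\widehat E}$ is a compatible metric on $\mathcal B_k(\widehat E)$; $\gamma_{k,\widehat E}=\gamma_{k,E}$ on $\mathcal B_k(E)$; and $\mathcal B_k(E)$ is a dense subset of $\mathcal B_k(\widehat E)$. The map $\tau_{k,\widehat E}$ induces a bijective isometry from $(\mathrm{Gr}(k,\widehat E),\Lambda_{\widehat E})/\!/\mathrm{Iso}(\widehat E)$ onto $(\mathcal B_k(\widehat E),\gamma_{k,\widehat E})$. (c) For every $k\in\mathbb N$: $\mathfrak d_{k,\widehat E}$ is a compatible metric on $\mathcal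 D_k(\widehat E)$, uniformly equivalent to $\widetilde\omega_2$ on $\widetilde\omega_2$-bounded subsets of $\mathcal D_k(\widehat E)$; $\mathfrak d_{k,E}=\mathfrak d_{k,\widehat E}$ on $\mathcal D_k(E)$; and $\mathcal D_k(E)$ is a dense subset of $\mathcal D_k(\widehat E)$. The map $\nu^2_{k,\widehat E}$ is well defined and induces a bijective isometry from $\mathcal L^{k,w^*}(\widehat E^*,\widehat E)/\!/\mathrm{Iso}(\widehat E)^2$ (with the operator norm distance) onto $(\mathcal D_k(\widehat E),\mathfrak d_{k,\widehat E})$. -/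

import Mathlib

open Set Topology

namespace OrbitMetrics

universe u

/-! ### Metrics given by real functions of two variables -/

/-- `δ`, restricted to the subset `S` of a topological space, is a metric on `S` that induces the
subspace topology of `S`. -/
def IsCompatibleMetricOn {P : Type*} [t : TopologicalSpace P] (S : Set P) (δ : P → P → ℝ) : Prop :=
  ∃ M : MetricSpace S, (∀ x y : S, M.dist x y = δ x y) ∧
    M.toUniformSpace.toTopologicalSpace = t.induced Subtype.val

/-- `A` has finite diameter for `δ`. -/
def IsBoundedFor {P : Type*} (δ : P → P → ℝ) (A : Set P) : Prop :=
  ∃ C : ℝ, ∀ x ∈ A, ∀ y ∈ A, δ x y ≤ C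

/-- The identity is uniformly continuous on `A` from `d₁` to `d₂` and from `d₂` to `d₁`. -/
def UniformlyEquivalentOn {P : Type*} (A : Set P) (d₁ d₂ : P → P → ℝ) : Prop :=
  ∀ ε > 0, ∃ δ > 0, ∀ x ∈ A, ∀ y ∈ A, (d₁ x y < δ → d₂ x y < ε) ∧ (d₂ x y < δ → d₁ x y < ε)

/-! ### Spaces of orbit closures

A family of transformations `act g` of an ambient set, a distance `d`, and an invariant set `S`. -/

section Orbits

variable {M : Type*} {G : Type*}

/-- The closure, in `S`, of the orbit of `p`. -/
def orbitClosure (S : Set M) (d : M → M → ℝ) (act : G → M → M) (p : M) : Set M :=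
  {q | q ∈ S ∧ ∀ ε > 0, ∃ g : G, d (act g p) q < ε}

/-- `S // G`: the set of closures of orbits of points of `S`. -/
def orbitSpace (S : Set M) (d : M → M → ℝ) (act : G → M → M) : Set (Set M) :=
  orbitClosure S d act '' S

/-- The quotient distance between two closures of orbits. -/
noncomputable def orbitDist (d : M → M → ℝ) (A B : Set M) : ℝ :=
  sInf {r | ∃ p ∈ A, ∃ q ∈ B, r = d p q}

/-- The relation `R` is a function on `S`, and it induces a bijection from `S // G` onto `Q` which
carries the quotient distance to `δ`. -/
def IdentifiesOrbitSpace {P : Type*} (S : Set M) (d : M → M → ℝ) (act : G → M → M)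
    (R : M → P → Prop) (Q : Set P) (δ : P → P → ℝ) : Prop :=
  ∃ Φ : Set M → P,
    BijOn Φ (orbitSpace S d act) Q ∧
    (∀ p ∈ S, ∀ a, R p a ↔ Φ (orbitClosure S d act p) = a) ∧
    ∀ A ∈ orbitSpace S d act, ∀ B ∈ orbitSpace S d act, δ (Φ A) (Φ B) = orbitDist d A B

end Orbits

section Norms

variable (𝕜 : Type u) [RCLike 𝕜]

/-! ### The space `𝒩_V` of norms on a vector space -/

/-- A norm on the vector space `V`. -/
structure NormOn (V : Type*) [AddCommGroup V] [Module 𝕜 V] extends Seminorm 𝕜 V where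
  eq_zero_of_eq_zero : ∀ x, toFun x = 0 → x = 0

variable {V : Type*} [AddCommGroup V] [Module 𝕜 V]

instance : CoeFun (NormOn 𝕜 V) (fun _ => V → ℝ) := ⟨fun m => m.toFun⟩

/-- The topology of pointwise convergence. -/
instance : TopologicalSpace (NormOn 𝕜 V) :=
  TopologicalSpace.induced (fun (m : NormOn 𝕜 V) (x : V) => m x) inferInstance

variable {𝕜}

/-- The norm of the identity from `(V, m)` to `(V, n)`. -/
noncomputable def idNorm (m n : NormOn 𝕜 V) : ℝ := sSup {r | ∃ x, m x ≤ 1 ∧ r = n x}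

/-- The intrinsic metric `ω` (for finite dimensional `V`). -/
noncomputable def omega (m n : NormOn 𝕜 V) : ℝ := Real.log (max (idNorm m n) (idNorm n m))

/-- `T` is an isometric embedding of `(V, m)` into `E`; equivalently `m = ν_{V,E}(T)`. -/
def IsEmb {E : Type*} [NormedAddCommGroup E] [NormedSpace 𝕜 E]
    (m : NormOn 𝕜 V) (T : V →ₗ[𝕜] E) : Prop := ∀ x, ‖T x‖ = m x

variable (𝕜 V) in
/-- `𝒩_V(E)`: the norms `m` on `V` such that `(V, m)` embeds isometrically into `E`. -/
def normsIn (E : Type*) [NormedAddCommGroup E] [NormedSpace 𝕜 E] : Set (NormOn 𝕜 V) :=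
  {m | ∃ T : V →ₗ[𝕜] E, IsEmb m T}

/-! ### Ages, amalgamation classes, Fraïssé limits

A class of finite dimensional normed spaces is given as an indexed family. -/

section Classes

variable {X Y : Type*} [NormedAddCommGroup X] [NormedSpace 𝕜 X]
  [NormedAddCommGroup Y] [NormedSpace 𝕜 Y]

/-- `T ∈ Emb_δ(X, Y)`. -/
def IsApproxEmb (δ : ℝ) (T : X →L[𝕜] Y) : Prop :=
  ∀ x, (1 + δ)⁻¹ * ‖x‖ ≤ ‖T x‖ ∧ ‖T x‖ ≤ (1 + δ) * ‖x‖

variable (𝕜) in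
/-- `Age(E)`, the finite dimensional subspaces of `E`; as a class of normed spaces it is the
family sending an index to the corresponding subspace. -/
abbrev Age (E : Type*) [NormedAddCommGroup E] [NormedSpace 𝕜 E] : Type _ :=
  {W : Submodule 𝕜 E // FiniteDimensional 𝕜 W}

variable (𝕜) in
/-- Amalgamation classes. -/
structure IsAmalgamationClass {ι : Type*} (C : ι → Type*) [∀ i, NormedAddCommGroup (C i)]
    [∀ i, NormedSpace 𝕜 (C i)] : Prop where
  zero_mem : ∃ i, Subsingleton (C i)
  amalgamation : ∀ ε > (0 : ℝ), ∀ k : ℕ, ∃ δ > (0 : ℝ), ∀ x y z : ι,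
    Module.finrank 𝕜 (C x) = k →
    ∀ (γ : C x →L[𝕜] C y) (η : C x →L[𝕜] C z), IsApproxEmb δ γ → IsApproxEmb δ η →
    ∃ (v : ι) (i : C y →ₗᵢ[𝕜] C v) (j : C z →ₗᵢ[𝕜] C v),
      ‖i.toContinuousLinearMap ∘L γ - j.toContinuousLinearMap ∘L η‖ ≤ ε

/-- The gap (opening) metric `Λ_E`: the Hausdorff distance between the unit balls. -/
noncomputable def gap {E : Type*} [NormedAddCommGroup E] [NormedSpace 𝕜 E]
    (U W : Submodule 𝕜 E) : ℝ :=
  Metric.hausdorffDist ((U : Set E) ∩ Metric.closedBall 0 1) ((W : Set E) ∩ Metric.closedBall 0 1)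

variable (𝕜) in
/-- Fraïssé Banach spaces: `Iso(F)` acts `ε`-transitively on `Emb_δ(X, F)`, with `δ` depending only
on `ε` and `dim X`. -/
def IsFraisse (F : Type*) [NormedAddCommGroup F] [NormedSpace 𝕜 F] : Prop :=
  ∀ ε > (0 : ℝ), ∀ k : ℕ, ∃ δ > (0 : ℝ), ∀ X : Age 𝕜 F, Module.finrank 𝕜 X.1 = k →
    ∀ γ η : X.1 →L[𝕜] F, IsApproxEmb δ γ → IsApproxEmb δ η →
      ∃ g : F ≃ₗᵢ[𝕜] F, ‖(g.toContinuousLinearEquiv : F →L[𝕜] F) ∘L η - γ‖ ≤ ε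

variable (𝕜) in
/-- `F` is the Fraïssé limit of the class `C`: a separable Fraïssé Banach space whose age contains
`C` up to isometry, and in whose age the subspaces of isometric copies of members of `C` are dense
for the gap metric. -/
structure IsFraisseLimit {ι : Type*} (C : ι → Type*) [∀ i, NormedAddCommGroup (C i)]
    [∀ i, NormedSpace 𝕜 (C i)] (F : Type*) [NormedAddCommGroup F] [NormedSpace 𝕜 F] : Prop where
  complete : CompleteSpace F
  separable : TopologicalSpace.SeparableSpace F
  fraisse : IsFraisse 𝕜 F
  contains : ∀ i, Nonempty (C i →ₗᵢ[𝕜] F)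
  dense : ∀ W : Age 𝕜 F, ∀ ε > (0 : ℝ), ∃ Z Z' : Submodule 𝕜 F,
    Z ≤ Z' ∧ (∃ i, Nonempty (C i ≃ₗᵢ[𝕜] Z')) ∧ gap W.1 Z < ε

end Classes

/-! ### Full rank operators: the extrinsic function `∂_{X,E}` -/

section FullRank

variable {X E : Type*} [NormedAddCommGroup X] [NormedSpace 𝕜 X]
  [NormedAddCommGroup E] [NormedSpace 𝕜 E]

/-- `ν_{X,E}(T) = m`, for bounded `T`. -/
def HasNu (T : X →L[𝕜] E) (m : NormOn 𝕜 X) : Prop := IsEmb m (T : X →ₗ[𝕜] E)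

variable (E) in
/-- The `E`-extrinsic function `∂_{X,E}`. -/
noncomputable def partialDist (m n : NormOn 𝕜 X) : ℝ :=
  sInf {r | ∃ T U : X →L[𝕜] E, HasNu T m ∧ HasNu U n ∧ r = ‖T - U‖}

variable (𝕜 X E) in
/-- `ℒ^{dim X}(X, E)`. -/
def fullRankOps : Set (X →L[𝕜] E) := {T | Function.Injective T}

/-- The action `g · T = g ∘ T` of `Iso(E)`. -/
noncomputable def isoActOps (g : E ≃ₗᵢ[𝕜] E) (T : X →L[𝕜] E) : X →L[𝕜] E :=
  (g.toContinuousLinearEquiv : E →L[𝕜] E) ∘L T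

end FullRank

/-! ### Grassmannians: `ℬ_V` and the Kadets function `γ_{k,E}` -/

section Grassmannians

variable (𝕜 V) in
/-- The orbit relation of `GL(V) ↷ 𝒩_V`, `(Δ · m)(x) = m(Δ⁻¹ x)`. -/
def normSetoid : Setoid (NormOn 𝕜 V) where
  r m n := ∃ Δ : V ≃ₗ[𝕜] V, ∀ x, n x = m (Δ.symm x)
  iseqv :=
    { refl := fun _ => ⟨LinearEquiv.refl 𝕜 V, fun _ => rfl⟩
      symm := by
        rintro m n ⟨Δ, h⟩
        exact ⟨Δ.symm, fun x => by rw [h]; simp⟩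
      trans := by
        rintro m n p ⟨Δ, h⟩ ⟨Γ, h'⟩
        exact ⟨Δ.trans Γ, fun x => by rw [h', h]; simp⟩ }

variable (𝕜 V) in
/-- `ℬ_V = 𝒩_V // GL(V)` with the quotient topology (the orbits are closed). -/
abbrev BMSpace : Type _ := Quotient (normSetoid 𝕜 V)

variable {E : Type*} [NormedAddCommGroup E] [NormedSpace 𝕜 E]

variable (𝕜 V E) in
/-- `ℬ_V(E)`: the classes of the norms in `𝒩_V(E)`. -/
def bmIn : Set (BMSpace 𝕜 V) := Quotient.mk (normSetoid 𝕜 V) '' normsIn 𝕜 V E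

variable (𝕜 E) in
/-- `Gr(k, E)`. -/
def grassmannian (k : ℕ) : Set (Submodule 𝕜 E) :=
  {W | FiniteDimensional 𝕜 W ∧ Module.finrank 𝕜 W = k}

/-- `τ_{k,E}(W) = b` : `W` is isometric to `(V, m)` where `b = [m]`. -/
def HasTau (W : Submodule 𝕜 E) (b : BMSpace 𝕜 V) : Prop :=
  ∃ (m : NormOn 𝕜 V) (T : V →ₗ[𝕜] E),
    IsEmb m T ∧ LinearMap.range T = W ∧ Quotient.mk (normSetoid 𝕜 V) m = b

variable (E) in
/-- The `E`-Kadets function `γ_{k,E}`, where `k = dim V`. -/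
noncomputable def kadetsDist (b c : BMSpace 𝕜 V) : ℝ :=
  sInf {r | ∃ U W : Submodule 𝕜 E, HasTau U b ∧ HasTau W c ∧ r = gap U W}

/-- The action `g · W = g(W)` of `Iso(E)`. -/
def isoActGr (g : E ≃ₗᵢ[𝕜] E) (W : Submodule 𝕜 E) : Submodule 𝕜 E :=
  W.map (g.toLinearEquiv : E →ₗ[𝕜] E)

end Grassmannians

/-! ### Operators of rank `k` from `E*` to `E`: `𝒟_V` and the function `𝔡_{k,E}` -/

section Square

variable (𝕜 V) in
/-- `𝒩_V × 𝒩_{V*}`. -/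
abbrev NormPair : Type _ := NormOn 𝕜 V × NormOn 𝕜 (Module.Dual 𝕜 V)

/-- The metric `ω₂` on `𝒩_V × 𝒩_{V*}`. -/
noncomputable def omega₂ (p q : NormPair 𝕜 V) : ℝ := omega p.1 q.1 + omega p.2 q.2

variable (𝕜 V) in
/-- The orbit relation of `GL(V) ↷ 𝒩_V × 𝒩_{V*}`, where `(Δ · m)(x) = m(Δ⁻¹ x)` on `𝒩_V` and
`(Δ · n)(f) = n(Δ* f)`, `Δ* f = f ∘ Δ`, on `𝒩_{V*}`. -/
def pairSetoid : Setoid (NormPair 𝕜 V) where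
  r p q := ∃ Δ : V ≃ₗ[𝕜] V, (∀ x, q.1 x = p.1 (Δ.symm x)) ∧
    ∀ f : Module.Dual 𝕜 V, q.2 f = p.2 (f ∘ₗ (Δ : V →ₗ[𝕜] V))
  iseqv :=
    { refl := fun _ => ⟨LinearEquiv.refl 𝕜 V, fun _ => rfl, fun _ => rfl⟩
      symm := by
        rintro p q ⟨Δ, h, h'⟩
        refine ⟨Δ.symm, fun x => by rw [h]; simp, fun f => ?_⟩
        rw [h']
        congr 1
        ext x
        simp
      trans := by
        rintro p q r ⟨Δ, h, h'⟩ ⟨Γ, k, k'⟩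
        exact ⟨Δ.trans Γ, fun x => by rw [k, h]; simp, fun f => by rw [k', h']; rfl⟩ }

variable (𝕜 V) in
/-- `𝒟_V = (𝒩_V × 𝒩_{V*}) // GL(V)` with the quotient topology (the orbits are closed). -/
abbrev PairSpace : Type _ := Quotient (pairSetoid 𝕜 V)

/-- The quotient metric of `ω₂` on `𝒟_V`. -/
noncomputable def omegaTilde₂ (D D' : PairSpace 𝕜 V) : ℝ :=
  sInf {r | ∃ p q : NormPair 𝕜 V, Quotient.mk (pairSetoid 𝕜 V) p = D ∧
    Quotient.mk (pairSetoid 𝕜 V) q = D' ∧ r = omega₂ p q}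

variable {E : Type*} [NormedAddCommGroup E] [NormedSpace 𝕜 E]

variable (𝕜 V E) in
/-- `𝒟_V(E)`: the classes of the pairs in `𝒩_V(E) × 𝒩_{V*}(E)`. -/
def pairsIn : Set (PairSpace 𝕜 V) :=
  Quotient.mk (pairSetoid 𝕜 V) '' (normsIn 𝕜 V E ×ˢ normsIn 𝕜 (Module.Dual 𝕜 V) E)

variable [FiniteDimensional 𝕜 V]

/-- `T = T₀ ∘ T₁*`, where `T₁* : E* → V** = V` is the dual operator `g ↦ g ∘ T₁`. -/
def IsDecomposition (T : StrongDual 𝕜 E →L[𝕜] E) (T₀ : V →ₗ[𝕜] E)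
    (T₁ : Module.Dual 𝕜 V →ₗ[𝕜] E) : Prop :=
  ∀ g : StrongDual 𝕜 E, T g = T₀ ((Module.evalEquiv 𝕜 V).symm ((g : E →ₗ[𝕜] 𝕜) ∘ₗ T₁))

variable (𝕜 V E) in
/-- `ℒ^{k,w*}(E*, E)`, `k = dim V`: the bounded operators with a full rank decomposition. -/
def weakStarOps : Set (StrongDual 𝕜 E →L[𝕜] E) :=
  {T | ∃ (T₀ : V →ₗ[𝕜] E) (T₁ : Module.Dual 𝕜 V →ₗ[𝕜] E),
    Function.Injective T₀ ∧ Function.Injective T₁ ∧ IsDecomposition T T₀ T₁}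

/-- `ν²_{k,E}(T) = D`: `T = T₀ ∘ T₁*` with `[(ν(T₀), ν(T₁))] = D`. -/
def HasNu₂ (T : StrongDual 𝕜 E →L[𝕜] E) (D : PairSpace 𝕜 V) : Prop :=
  ∃ (p : NormPair 𝕜 V) (T₀ : V →ₗ[𝕜] E) (T₁ : Module.Dual 𝕜 V →ₗ[𝕜] E),
    IsEmb p.1 T₀ ∧ IsEmb p.2 T₁ ∧ IsDecomposition T T₀ T₁ ∧
      Quotient.mk (pairSetoid 𝕜 V) p = D

variable (E) in
/-- The `E`-extrinsic function `𝔡_{k,E}`, where `k = dim V`. -/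
noncomputable def squareDist (D D' : PairSpace 𝕜 V) : ℝ :=
  sInf {r | ∃ T U : StrongDual 𝕜 E →L[𝕜] E, HasNu₂ T D ∧ HasNu₂ U D' ∧ r = ‖T - U‖}

/-- The action `(g, h) · T = g ∘ T ∘ h*` of `Iso(E)²`. -/
noncomputable def isoActSquare (gh : (E ≃ₗᵢ[𝕜] E) × (E ≃ₗᵢ[𝕜] E))
    (T : StrongDual 𝕜 E →L[𝕜] E) : StrongDual 𝕜 E →L[𝕜] E :=
  (gh.1.toContinuousLinearEquiv : E →L[𝕜] E) ∘L T ∘L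
    ContinuousLinearMap.precomp 𝕜 (gh.2.toContinuousLinearEquiv : E →L[𝕜] E)

end Square

end Norms

end OrbitMetrics

open OrbitMetrics

/-! All three statements have one shape: a relation `R` (`ν`, `τ` or `ν²`) sends objects of a space
with an isometric group action to norms or classes of norms, and the extrinsic function is the
distance between fibres of `R`. If the group acts almost transitively on every fibre, and distinct
fibres are at positive distance, then the fibres are exactly the closures of orbits. The triangle
inequality then holds, because two points of the same fibre can be brought together by an isometry.
`AlmostTransitive` records these hypotheses together with two conditions comparing the distance of
fibres with the topology of the target; its consequences are the compatible metric and the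
identification with the orbit space.

To verify them, norms are compared through `Near c`, a two-sided bound by the factor `c`. In finite
dimension these sets with `c > 1` give the neighbourhoods in the pointwise topology, and `ω` is the
logarithm of the best factor. From near norms to near objects, the Fraïssé property is used in the
form `IsFraisse.exists_iso`: embeddings inducing near norms are almost matched by an isometry.
Conversely, near objects have near representatives (`near_of_norm_sub_lt`, `exists_near_of_gap_lt`,
`exists_near_of_norm_square_sub_lt`), by perturbation arguments. Closedness of the `GL(V)`-orbits, a
compactness argument, separates the classes. Constants that stay uniform on bounded sets give the
uniform equivalences with `ω` and the quotient metric of `ω₂`.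

The comparison of `E` with its limit rests on `Transfers`: a pair of embeddings into one space is
reproduced in the other with the same induced norms and almost the same relative position. From `E`
to the limit this is exact. In the other direction, density provides an almost embedding of the
joint span into `E`, and two amalgamations correct it to exact embeddings. The error disappears in
the infimum. -/

namespace OrbitMetrics

/-! ### Norms on a vector space, the metric `ω` and the pointwise topology -/

section NormBasics

variable {𝕜 : Type*} [RCLike 𝕜] {V W : Type*} [AddCommGroup V] [Module 𝕜 V]
  [AddCommGroup W] [Module 𝕜 W]

namespace NormOn

theorem nonneg (m : NormOn 𝕜 V) (x : V) : 0 ≤ m x := apply_nonneg m.toSeminorm x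

theorem add_le (m : NormOn 𝕜 V) (x y : V) : m (x + y) ≤ m x + m y := map_add_le_add m.toSeminorm x y

theorem sub_rev (m : NormOn 𝕜 V) (x y : V) : m (x - y) = m (y - x) := map_sub_rev m.toSeminorm x y

theorem smul_eq (m : NormOn 𝕜 V) (a : 𝕜) (x : V) : m (a • x) = ‖a‖ * m x :=
  map_smul_eq_mul m.toSeminorm a x

theorem apply_zero (m : NormOn 𝕜 V) : m 0 = 0 := map_zero m.toSeminorm

theorem le_add_sub (m : NormOn 𝕜 V) (x y : V) : m x ≤ m y + m (x - y) := by
  simpa using m.add_le y (x - y)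

theorem sum_le (m : NormOn 𝕜 V) {ι : Type*} (s : Finset ι) (f : ι → V) :
    m (∑ i ∈ s, f i) ≤ ∑ i ∈ s, m (f i) := by
  classical
  induction s using Finset.induction_on with
  | empty => simp [m.apply_zero]
  | insert a s ha ih =>
    rw [Finset.sum_insert ha, Finset.sum_insert ha]
    linarith [m.add_le (f a) (∑ i ∈ s, f i)]

theorem ext_apply {m n : NormOn 𝕜 V} (h : ∀ x, m x = n x) : m = n := by
  obtain ⟨m, hm⟩ := m
  obtain ⟨n, hn⟩ := n
  have : m = n := Seminorm.ext h
  subst this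
  rfl

/-- The pull back of a norm under a linear equivalence. -/
def comp (m : NormOn 𝕜 W) (e : V ≃ₗ[𝕜] W) : NormOn 𝕜 V where
  toSeminorm := m.toSeminorm.comp (e : V →ₗ[𝕜] W)
  eq_zero_of_eq_zero x hx := by
    have := m.eq_zero_of_eq_zero (e x) hx
    simpa using this

@[simp]
theorem comp_apply (m : NormOn 𝕜 W) (e : V ≃ₗ[𝕜] W) (x : V) : (m.comp e) x = m (e x) := rfl

/-- The norm `x ↦ ‖T x‖` of an injective linear map. -/
def ofInjective {E : Type*} [NormedAddCommGroup E] [NormedSpace 𝕜 E] (T : V →ₗ[𝕜] E)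
    (hT : Function.Injective T) : NormOn 𝕜 V where
  toSeminorm := (normSeminorm 𝕜 E).comp T
  eq_zero_of_eq_zero x hx := by
    have : T x = 0 := norm_eq_zero.1 hx
    exact hT (by simpa using this)

/-- The vector space `V` with the norm `m`. -/
def Normed (_m : NormOn 𝕜 V) : Type _ := V

instance (m : NormOn 𝕜 V) : AddCommGroup m.Normed := inferInstanceAs (AddCommGroup V)
instance (m : NormOn 𝕜 V) : Module 𝕜 m.Normed := inferInstanceAs (Module 𝕜 V)
instance (m : NormOn 𝕜 V) : Norm m.Normed := ⟨fun x => m.toFun x⟩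

theorem normed_core (m : NormOn 𝕜 V) : NormedSpace.Core 𝕜 m.Normed where
  norm_nonneg x := m.nonneg x
  norm_smul a x := m.smul_eq a x
  norm_triangle x y := m.add_le x y
  norm_eq_zero_iff x := ⟨m.eq_zero_of_eq_zero x, fun h => by rw [h]; exact m.apply_zero⟩

noncomputable instance (m : NormOn 𝕜 V) : NormedAddCommGroup m.Normed :=
  { NormedAddCommGroup.ofCore m.normed_core with
    toAddCommGroup := inferInstanceAs (AddCommGroup V) }

noncomputable instance (m : NormOn 𝕜 V) : NormedSpace 𝕜 m.Normed where
  norm_smul_le a x := (m.smul_eq a x).le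

instance [FiniteDimensional 𝕜 V] (m : NormOn 𝕜 V) : FiniteDimensional 𝕜 m.Normed :=
  inferInstanceAs (FiniteDimensional 𝕜 V)

/-- The identity from `V` to the normed space `(V, m)`. -/
def toNormed (m : NormOn 𝕜 V) : V ≃ₗ[𝕜] m.Normed := LinearEquiv.refl 𝕜 V

theorem norm_toNormed (m : NormOn 𝕜 V) (x : V) : ‖m.toNormed x‖ = m x := rfl

end NormOn

/-- The standard norm of a normed space. -/
def NormOn.std (𝕜 X : Type*) [RCLike 𝕜] [NormedAddCommGroup X] [NormedSpace 𝕜 X] : NormOn 𝕜 X :=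
  NormOn.ofInjective LinearMap.id Function.injective_id

theorem IsEmb.injective {E : Type*} [NormedAddCommGroup E] [NormedSpace 𝕜 E] {m : NormOn 𝕜 V}
    {T : V →ₗ[𝕜] E} (h : IsEmb m T) : Function.Injective T := by
  rw [← LinearMap.ker_eq_bot, LinearMap.ker_eq_bot']
  intro x hx
  exact m.eq_zero_of_eq_zero x (by have := h x; rw [hx, norm_zero] at this; exact this.symm)

theorem exists_linearMap_le [FiniteDimensional 𝕜 V] (m : NormOn 𝕜 V) {E : Type*}
    [NormedAddCommGroup E] [NormedSpace 𝕜 E] (T : V →ₗ[𝕜] E) :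
    ∃ C > 0, ∀ x, ‖T x‖ ≤ C * m x := by
  let S : m.Normed →L[𝕜] E := LinearMap.toContinuousLinearMap (T ∘ₗ (m.toNormed.symm : _ →ₗ[𝕜] V))
  refine ⟨‖S‖ + 1, by positivity, fun x => ?_⟩
  have h := S.le_opNorm (m.toNormed x)
  rw [m.norm_toNormed] at h
  have h2 : ‖S‖ * m x ≤ (‖S‖ + 1) * m x := by
    have := m.nonneg x
    nlinarith
  exact h.trans h2

/-- Any two norms on a finite dimensional space are comparable. -/
theorem exists_norm_le [FiniteDimensional 𝕜 V] (m n : NormOn 𝕜 V) :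
    ∃ C > 0, ∀ x, n x ≤ C * m x :=
  exists_linearMap_le m (n.toNormed : V →ₗ[𝕜] n.Normed)

/-- `m` and `n` differ by a factor at most `c`. -/
def Near (c : ℝ) (m n : NormOn 𝕜 V) : Prop := ∀ x, n x ≤ c * m x ∧ m x ≤ c * n x

theorem Near.symm {c : ℝ} {m n : NormOn 𝕜 V} (h : Near c m n) : Near c n m :=
  fun x => ⟨(h x).2, (h x).1⟩

theorem Near.mono {c d : ℝ} {m n : NormOn 𝕜 V} (h : Near c m n) (hcd : c ≤ d) : Near d m n :=
  fun x => ⟨(h x).1.trans (mul_le_mul_of_nonneg_right hcd (m.nonneg x)),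
    (h x).2.trans (mul_le_mul_of_nonneg_right hcd (n.nonneg x))⟩

theorem Near.comp {c : ℝ} {m n : NormOn 𝕜 W} (h : Near c m n) (e : V ≃ₗ[𝕜] W) :
    Near c (m.comp e) (n.comp e) := fun x => h (e x)

/-- Since `(1 - r)⁻¹ ≤ 1 + 2 * r` for `r ≤ 1 / 2`, an error relative to `m` alone controls both
quotients. -/
theorem near_of_abs_sub_le {r : ℝ} (hr0 : 0 ≤ r) (hr : r ≤ 1 / 2) {m n : NormOn 𝕜 V}
    (h : ∀ x, |n x - m x| ≤ r * m x) : Near (1 + 2 * r) m n := by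
  intro x
  have h1 := abs_le.1 (h x)
  have h2 := m.nonneg x
  have h3 := n.nonneg x
  have h0 : 0 ≤ r * m x := (abs_nonneg _).trans (h x)
  constructor
  · nlinarith
  · have h4 : 0 ≤ r * m x * (1 - 2 * r) := mul_nonneg h0 (by linarith)
    have h5 : (1 + 2 * r) * (m x - r * m x) ≤ (1 + 2 * r) * n x :=
      mul_le_mul_of_nonneg_left (by linarith) (by linarith)
    nlinarith

theorem idNorm_bddAbove [FiniteDimensional 𝕜 V] (m n : NormOn 𝕜 V) :
    BddAbove {r | ∃ x, m x ≤ 1 ∧ r = n x} := by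
  obtain ⟨C, hC, h⟩ := exists_norm_le m n
  refine ⟨C, ?_⟩
  rintro r ⟨x, hx, rfl⟩
  nlinarith [h x]

theorem le_idNorm_mul [FiniteDimensional 𝕜 V] (m n : NormOn 𝕜 V) (x : V) :
    n x ≤ idNorm m n * m x := by
  by_cases hx : m x = 0
  · rw [m.eq_zero_of_eq_zero x hx, n.apply_zero, m.apply_zero, mul_zero]
  · have hpos : 0 < m x := lt_of_le_of_ne (m.nonneg x) (Ne.symm hx)
    have h1 : n (((m x : ℝ) : 𝕜)⁻¹ • x) ≤ idNorm m n := by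
      refine le_csSup (idNorm_bddAbove m n) ⟨_, ?_, rfl⟩
      rw [m.smul_eq, norm_inv, RCLike.norm_ofReal, abs_of_pos hpos, inv_mul_cancel₀ hx]
    rw [n.smul_eq, norm_inv, RCLike.norm_ofReal, abs_of_pos hpos, inv_mul_le_iff₀ hpos] at h1
    linarith

theorem idNorm_le {m n : NormOn 𝕜 V} {C : ℝ} (h : ∀ x, m x ≤ 1 → n x ≤ C) : idNorm m n ≤ C := by
  refine csSup_le ⟨n 0, 0, by simp [m.apply_zero], rfl⟩ ?_
  rintro r ⟨x, hx, rfl⟩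
  exact h x hx

theorem idNorm_nonneg [FiniteDimensional 𝕜 V] (m n : NormOn 𝕜 V) : 0 ≤ idNorm m n :=
  le_csSup (idNorm_bddAbove m n) ⟨0, by simp [m.apply_zero], by simp [n.apply_zero]⟩

section Omega

variable [FiniteDimensional 𝕜 V]

theorem one_le_max_idNorm [Nontrivial V] (m n : NormOn 𝕜 V) :
    1 ≤ max (idNorm m n) (idNorm n m) := by
  obtain ⟨x, hx⟩ := exists_ne (0 : V)
  have hpos : 0 < m x :=
    lt_of_le_of_ne (m.nonneg x) (fun h => hx (m.eq_zero_of_eq_zero x h.symm))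
  by_contra! hlt
  have h1 := le_idNorm_mul m n x
  have h2 := le_idNorm_mul n m x
  have h3 := (le_max_left _ _).trans_lt hlt
  have h4 := (le_max_right _ _).trans_lt hlt
  have := n.nonneg x
  nlinarith

/-- Both suprema vanish, and the default value `Real.log 0 = 0` agrees with the convention for the
zero space. -/
theorem omega_of_subsingleton [Subsingleton V] (m n : NormOn 𝕜 V) : omega m n = 0 := by
  have : ∀ m n : NormOn 𝕜 V, idNorm m n = 0 := fun m n =>
    le_antisymm (idNorm_le fun x _ => by rw [Subsingleton.elim x 0, n.apply_zero])
      (idNorm_nonneg m n)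
  simp [omega, this]

theorem omega_nonneg (m n : NormOn 𝕜 V) : 0 ≤ omega m n := by
  cases subsingleton_or_nontrivial V
  · rw [omega_of_subsingleton]
  · exact Real.log_nonneg (one_le_max_idNorm m n)

theorem near_of_omega_le {m n : NormOn 𝕜 V} {c : ℝ} (h : omega m n ≤ c) :
    Near (Real.exp c) m n := by
  intro x
  cases subsingleton_or_nontrivial V
  · rw [Subsingleton.elim x 0, m.apply_zero, n.apply_zero]; simp
  · have h1 : max (idNorm m n) (idNorm n m) ≤ Real.exp c := by
      rwa [omega, Real.log_le_iff_le_exp (zero_lt_one.trans_le (one_le_max_idNorm m n))] at h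
    have h2 := (le_max_left _ _).trans h1
    have h3 := (le_max_right _ _).trans h1
    exact ⟨(le_idNorm_mul m n x).trans (mul_le_mul_of_nonneg_right h2 (m.nonneg x)),
      (le_idNorm_mul n m x).trans (mul_le_mul_of_nonneg_right h3 (n.nonneg x))⟩

theorem omega_le_of_near {m n : NormOn 𝕜 V} {c : ℝ} (hc : 1 ≤ c) (h : Near c m n) :
    omega m n ≤ Real.log c := by
  cases subsingleton_or_nontrivial V
  · rw [omega_of_subsingleton]; exact Real.log_nonneg hc
  · refine Real.log_le_log (zero_lt_one.trans_le (one_le_max_idNorm m n)) (max_le ?_ ?_)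
    · exact idNorm_le fun x hx => by nlinarith [(h x).1]
    · exact idNorm_le fun x hx => by nlinarith [(h x).2]

end Omega

section Topology

theorem continuous_apply' (x : V) : Continuous fun m : NormOn 𝕜 V => m x :=
  (continuous_apply x).comp continuous_induced_dom

theorem continuous_comp (e : V ≃ₗ[𝕜] W) : Continuous fun m : NormOn 𝕜 W => m.comp e :=
  continuous_induced_rng.2 (continuous_pi fun x => continuous_apply' (e x))

theorem abs_sub_le_of_net {m n : NormOn 𝕜 V} {r N : ℝ} {x y : V} (hN : ∀ x, n x ≤ N * m x)
    (hN0 : 0 ≤ N) (hxy : m (x - y) ≤ r) (hy : |n y - m y| ≤ r) :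
    |n x - m x| ≤ r * (2 + N) := by
  have h1 := n.le_add_sub x y
  have h2 := n.le_add_sub y x
  have h3 := m.le_add_sub x y
  have h4 := m.le_add_sub y x
  rw [n.sub_rev y x] at h2
  rw [m.sub_rev y x] at h4
  have h5 := abs_le.1 hy
  have h6 : n (x - y) ≤ N * r := (hN _).trans (mul_le_mul_of_nonneg_left hxy hN0)
  rw [abs_le]
  constructor <;> nlinarith

/-- In a finite dimensional space, pointwise convergence of norms is uniform. -/
theorem near_mem_nhds [FiniteDimensional 𝕜 V] (m : NormOn 𝕜 V) {c : ℝ} (hc : 1 < c) :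
    {n | Near c m n} ∈ 𝓝 m := by
  -- For `r ≤ 1 / 10` the norm `n` will satisfy `n ≤ 3 * m`, so the net estimate gives the error `r
  -- * (2 + 3)`, at most `1 / 2`.
  obtain ⟨r, hr0, hr1, hr2⟩ : ∃ r : ℝ, 0 < r ∧ r ≤ 1 / 10 ∧ 1 + 2 * (r * 5) ≤ c := by
    refine ⟨min (1 / 10) ((c - 1) / 10), lt_min (by norm_num) (by linarith), min_le_left _ _, ?_⟩
    linarith [min_le_right (1 / 10 : ℝ) ((c - 1) / 10)]
  have : ProperSpace m.Normed := FiniteDimensional.proper_rclike 𝕜 _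
  obtain ⟨t, ht, htf, hcov⟩ :=
    (isCompact_closedBall (0 : m.Normed) 1).finite_cover_balls (e := r) hr0
  have hnhds : {n : NormOn 𝕜 V | ∀ y ∈ t, |n.toFun y - m.toFun y| < r} ∈ 𝓝 m := by
    have : {n : NormOn 𝕜 V | ∀ y ∈ t, |n.toFun y - m.toFun y| < r} =
        ⋂ y ∈ t, {n : NormOn 𝕜 V | |n.toFun y - m.toFun y| < r} := by
      ext n; simp
    rw [this, Filter.biInter_mem htf]
    intro y _
    have h1 : Continuous fun n : NormOn 𝕜 V => |n.toFun y - m.toFun y| :=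
      ((continuous_apply' (𝕜 := 𝕜) (V := V) y).sub continuous_const).abs
    exact (isOpen_lt h1 continuous_const).mem_nhds (by simpa using hr0)
  filter_upwards [hnhds] with n hn
  have key : ∀ x, m x ≤ 1 → ∃ y, m y ≤ 1 ∧ m (x - y) ≤ r ∧ |n y - m y| ≤ r := by
    intro x hx
    have hx' : m.toNormed x ∈ Metric.closedBall (0 : m.Normed) 1 := by
      rw [mem_closedBall_zero_iff]; exact hx
    obtain ⟨y, hy, hxy⟩ := mem_iUnion₂.1 (hcov hx')
    refine ⟨y, ?_, ?_, (hn y hy).le⟩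
    · have := ht hy
      rw [mem_closedBall_zero_iff] at this
      exact this
    · rw [Metric.mem_ball, dist_eq_norm] at hxy
      exact hxy.le
  -- The remainder `x - y` has `m`-norm at most `r`, so the supremum is bounded in terms of itself
  -- with the small factor `r`; being finite, it can be absorbed.
  have hN : idNorm m n ≤ 1 + r + r * idNorm m n := by
    refine idNorm_le fun x hx => ?_
    obtain ⟨y, hy1, hy2, hy3⟩ := key x hx
    have h1 := n.le_add_sub x y
    have h2 := le_idNorm_mul m n (x - y)
    have h3 := idNorm_nonneg m n
    have h4 := (abs_le.1 hy3).2
    nlinarith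
  have hN3 : idNorm m n ≤ 3 := by nlinarith [idNorm_nonneg m n]
  have hb : ∀ x, m x ≤ 1 → |n x - m x| ≤ r * 5 := by
    intro x hx
    obtain ⟨y, hy1, hy2, hy3⟩ := key x hx
    have := abs_sub_le_of_net (le_idNorm_mul m n) (idNorm_nonneg m n) hy2 hy3
    nlinarith
  refine (near_of_abs_sub_le (r := r * 5) (by linarith) (by linarith) fun x => ?_).mono hr2
  by_cases hx : m x = 0
  · rw [m.eq_zero_of_eq_zero x hx, n.apply_zero, m.apply_zero]; simp
  · have hpos : 0 < m x := lt_of_le_of_ne (m.nonneg x) (Ne.symm hx)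
    have hn' : ‖(((m x : ℝ) : 𝕜)⁻¹)‖ = (m x)⁻¹ := by
      rw [norm_inv, RCLike.norm_ofReal, abs_of_pos hpos]
    have h1 := hb (((m x : ℝ) : 𝕜)⁻¹ • x) (by
      rw [m.smul_eq, hn', inv_mul_cancel₀ hx])
    rw [m.smul_eq, n.smul_eq, hn', ← mul_sub, abs_mul, abs_of_pos (inv_pos.2 hpos),
      inv_mul_le_iff₀ hpos] at h1
    linarith

/-- A basic neighbourhood tests finitely many vectors, and at each of them a factor close to `1` is
a small additive error. This is the converse of `near_mem_nhds`. -/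
theorem exists_near_subset (m : NormOn 𝕜 V) {O : Set (NormOn 𝕜 V)} (hO : O ∈ 𝓝 m) :
    ∃ δ > 0, ∀ n, Near (1 + δ) m n → n ∈ O := by
  have hind : 𝓝 m = Filter.comap (fun (m : NormOn 𝕜 V) (x : V) => m x) (𝓝 fun x => m x) :=
    nhds_induced _ _
  rw [hind, nhds_pi] at hO
  obtain ⟨U, hU, hUO⟩ := hO
  obtain ⟨I, hI, t, ht, htU⟩ := Filter.mem_pi.1 hU
  have h1 : ∀ x : V, ∃ ε > 0, ∀ r : ℝ, |r - m x| < ε → r ∈ t x := by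
    intro x
    obtain ⟨ε, hε, h⟩ := Metric.mem_nhds_iff.1 (ht x)
    exact ⟨ε, hε, fun r hr => h (by rwa [Metric.mem_ball, Real.dist_eq])⟩
  choose ε hε hεt using h1
  have h2 : ∀ x : V, ∃ δ > 0, ∀ δ' ≤ δ, 0 < δ' → ∀ n, Near (1 + δ') m n → n x ∈ t x := by
    intro x
    have hm := m.nonneg x
    refine ⟨min 1 (ε x / (2 * (m x + 1))), lt_min one_pos (by have := hε x; positivity), ?_⟩
    intro δ' hδ' hpos n hn
    refine hεt x _ ?_
    obtain ⟨h3, h4⟩ := hn x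
    have h5 := hδ'.trans (min_le_left _ _)
    have h6 := hδ'.trans (min_le_right _ _)
    rw [le_div_iff₀ (by positivity)] at h6
    have h8 : n x ≤ 2 * m x := by nlinarith
    have h9 := mul_le_mul_of_nonneg_left h8 hpos.le
    rw [abs_lt]
    constructor <;> nlinarith [mul_nonneg hpos.le hm]
  choose δ hδ hδt using h2
  obtain ⟨δ₀, hδ₀, hle⟩ : ∃ δ₀ > 0, ∀ x ∈ I, δ₀ ≤ δ x := by
    rcases I.eq_empty_or_nonempty with h | h
    · exact ⟨1, one_pos, by simp [h]⟩
    · obtain ⟨x₀, _, hx₀⟩ := Set.exists_min_image I δ hI h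
      exact ⟨δ x₀, hδ x₀, hx₀⟩
  exact ⟨δ₀, hδ₀, fun n hn => hUO (htU fun x hx => hδt x δ₀ (hle x hx) hδ₀ n hn)⟩

end Topology

end NormBasics

/-! ### Distances between fibres of an almost transitive relation -/

section Abstract

/-- The hypotheses under which the distance of fibres of a relation `R` is a metric that is
isometric to a space of orbit closures. -/
structure AlmostTransitive {M G P : Type*} [TopologicalSpace P] (S : Set M) (d : M → M → ℝ)
    (act : G → M → M) (R : M → P → Prop) (Q : Set P) : Prop where
  nonneg : ∀ p q, 0 ≤ d p q
  self : ∀ p, d p p = 0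
  symm : ∀ p q, d p q = d q p
  triangle : ∀ p q r, d p r ≤ d p q + d q r
  mem_left : ∀ {p a}, R p a → p ∈ S
  mem_right : ∀ {p a}, R p a → a ∈ Q
  exists_right : ∀ p ∈ S, ∃ a, R p a
  exists_left : ∀ a ∈ Q, ∃ p, R p a
  unique : ∀ {p a b}, R p a → R p b → a = b
  act_rel : ∀ g {p a}, R p a → R (act g p) a
  act_dist : ∀ g p q, d (act g p) (act g q) = d p q
  homogeneous : ∀ {p q a}, R p a → R q a → ∀ ε > 0, ∃ g, d (act g p) q < ε
  separated : ∀ {a b}, a ∈ Q → b ∈ Q →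
    (∀ η > 0, ∃ p q, R p a ∧ R q b ∧ d p q < η) → a = b
  nhds_left : ∀ {a}, a ∈ Q → ∀ O ∈ 𝓝 a, ∃ η > 0, ∀ p q b, R p a → R q b → d p q < η → b ∈ O
  nhds_right : ∀ {a}, a ∈ Q → ∀ ε > 0, ∃ O ∈ 𝓝 a, ∀ b ∈ O, b ∈ Q →
    ∃ p q, R p a ∧ R q b ∧ d p q < ε

namespace AlmostTransitive

variable {M G P : Type*} [TopologicalSpace P] {S : Set M} {d : M → M → ℝ} {act : G → M → M}
  {R : M → P → Prop} {Q : Set P} {δ : P → P → ℝ}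

theorem dist_le (h : AlmostTransitive S d act R Q)
    (hδ : ∀ a b, δ a b = sInf {r | ∃ p q, R p a ∧ R q b ∧ r = d p q}) {a b : P} {p q : M}
    (hp : R p a) (hq : R q b) : δ a b ≤ d p q := by
  rw [hδ]
  refine csInf_le ⟨0, ?_⟩ ⟨p, q, hp, hq, rfl⟩
  rintro r ⟨p, q, _, _, rfl⟩
  exact h.nonneg p q

theorem exists_lt (h : AlmostTransitive S d act R Q)
    (hδ : ∀ a b, δ a b = sInf {r | ∃ p q, R p a ∧ R q b ∧ r = d p q}) {a b : P} (ha : a ∈ Q)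
    (hb : b ∈ Q) {c : ℝ} (hc : δ a b < c) : ∃ p q, R p a ∧ R q b ∧ d p q < c := by
  rw [hδ] at hc
  obtain ⟨p, hp⟩ := h.exists_left a ha
  obtain ⟨q, hq⟩ := h.exists_left b hb
  have hne : {r | ∃ p q, R p a ∧ R q b ∧ r = d p q}.Nonempty := ⟨_, p, q, hp, hq, rfl⟩
  obtain ⟨r, ⟨p, q, hp, hq, rfl⟩, hr⟩ := exists_lt_of_csInf_lt hne hc
  exact ⟨p, q, hp, hq, hr⟩

/-- Almost transitivity on fibres gives the triangle inequality, `separated` gives definiteness, and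
`nhds_left`, `nhds_right` are the two inclusions between neighbourhood filters. -/
theorem isCompatibleMetricOn (h : AlmostTransitive S d act R Q)
    (hδ : ∀ a b, δ a b = sInf {r | ∃ p q, R p a ∧ R q b ∧ r = d p q}) :
    IsCompatibleMetricOn Q δ := by
  have hself : ∀ a ∈ Q, δ a a = 0 := by
    intro a ha
    obtain ⟨p, hp⟩ := h.exists_left a ha
    refine le_antisymm ((h.dist_le hδ hp hp).trans_eq (h.self p)) ?_
    rw [hδ]
    refine Real.sInf_nonneg ?_
    rintro r ⟨p, q, _, _, rfl⟩
    exact h.nonneg p q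
  have hsymm : ∀ a b, δ a b = δ b a := by
    intro a b
    rw [hδ, hδ]
    congr 1
    ext r
    constructor
    · rintro ⟨p, q, hp, hq, rfl⟩; exact ⟨q, p, hq, hp, h.symm _ _⟩
    · rintro ⟨p, q, hp, hq, rfl⟩; exact ⟨q, p, hq, hp, h.symm _ _⟩
  have htri : ∀ a ∈ Q, ∀ b ∈ Q, ∀ c ∈ Q, δ a c ≤ δ a b + δ b c := by
    intro a ha b hb c hc
    refine le_of_forall_pos_le_add fun ε hε => ?_
    obtain ⟨p, q, hp, hq, h1⟩ := h.exists_lt hδ ha hb (lt_add_of_pos_right _ (div_pos hε three_pos))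
    obtain ⟨q', r, hq', hr, h2⟩ :=
      h.exists_lt hδ hb hc (lt_add_of_pos_right _ (div_pos hε three_pos))
    -- The two pairs meet the fibre over `b` in different points `q` and `q'`; moving the first pair
    -- by `g` closes this break up to `ε / 3` and preserves its distance.
    obtain ⟨g, hg⟩ := h.homogeneous hq hq' (ε / 3) (div_pos hε three_pos)
    have h3 := h.dist_le hδ (h.act_rel g hp) hr
    have h4 := h.triangle (act g p) (act g q) r
    have h5 := h.triangle (act g q) q' r
    have h6 := h.act_dist g p q
    linarith
  have heq : ∀ a ∈ Q, ∀ b ∈ Q, δ a b = 0 → a = b := fun a ha b hb hab =>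
    h.separated ha hb fun η hη => h.exists_lt hδ ha hb (hab.trans_lt hη)
  let ins : MetricSpace Q :=
    { dist := fun x y => δ x y
      dist_self := fun x => hself x x.2
      dist_comm := fun x y => hsymm x y
      dist_triangle := fun x y z => htri x x.2 y y.2 z z.2
      eq_of_dist_eq_zero := fun {x y} hxy => Subtype.ext (heq x x.2 y y.2 hxy) }
  refine ⟨ins, fun x y => rfl, ?_⟩
  refine TopologicalSpace.ext_nhds fun x => ?_
  have h1 : @nhds Q (ins.toUniformSpace.toTopologicalSpace) x =
      ⨅ ε > 0, Filter.principal (@Metric.ball Q ins.toPseudoMetricSpace x ε) :=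
    @Metric.nhds_basis_ball Q ins.toPseudoMetricSpace x |>.eq_biInf
  rw [nhds_induced]
  apply le_antisymm
  · intro O hO
    obtain ⟨O', hO', hsub⟩ := Filter.mem_comap.1 hO
    obtain ⟨η, hη, hb⟩ := h.nhds_left x.2 O' hO'
    refine (@Metric.mem_nhds_iff Q ins.toPseudoMetricSpace x O).2 ⟨η, hη, fun y hy => hsub ?_⟩
    have hy' : δ x y < η := by
      rw [hsymm]; exact hy
    obtain ⟨p, q, hp, hq, hpq⟩ := h.exists_lt hδ x.2 y.2 hy'
    exact hb p q y hp hq hpq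
  · intro O hO
    obtain ⟨ε, hε, hb⟩ := (@Metric.mem_nhds_iff Q ins.toPseudoMetricSpace x O).1 hO
    obtain ⟨O', hO', h2⟩ := h.nhds_right x.2 ε hε
    refine Filter.mem_comap.2 ⟨O', hO', fun y hy => hb ?_⟩
    obtain ⟨p, q, hp, hq, hpq⟩ := h2 y hy y.2
    change δ y x < ε
    rw [hsymm]
    exact (h.dist_le hδ hp hq).trans_lt hpq

/-- Invariance puts the orbit inside the fibre, separation of fibres keeps its closure there, and
almost transitivity exhausts the fibre. -/
theorem orbitClosure_eq (h : AlmostTransitive S d act R Q) {p : M} {a : P} (hp : R p a) :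
    orbitClosure S d act p = {q | R q a} := by
  ext q
  constructor
  · rintro ⟨hq, hd⟩
    obtain ⟨b, hb⟩ := h.exists_right q hq
    have : a = b := h.separated (h.mem_right hp) (h.mem_right hb) fun η hη => by
      obtain ⟨g, hg⟩ := hd η hη
      exact ⟨_, _, h.act_rel g hp, hb, hg⟩
    subst this
    exact hb
  · intro hq
    exact ⟨h.mem_left hq, fun ε hε => h.homogeneous hp hq ε hε⟩

theorem identifiesOrbitSpace [Nonempty P] (h : AlmostTransitive S d act R Q)
    (hδ : ∀ a b, δ a b = sInf {r | ∃ p q, R p a ∧ R q b ∧ r = d p q}) :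
    IdentifiesOrbitSpace S d act R Q δ := by
  classical
  -- `Φ` recovers the point from its nonempty fibre; the arbitrary values on other sets play no role
  -- on the orbit space.
  let Φ : Set M → P := fun A => Classical.epsilon fun a => A.Nonempty ∧ A = {q | R q a}
  have hΦ : ∀ {p a}, R p a → Φ {q | R q a} = a := by
    intro p a hp
    have h1 : ∃ b, ({q | R q a} : Set M).Nonempty ∧ {q | R q a} = {q | R q b} := ⟨a, ⟨p, hp⟩, rfl⟩
    have h2 := (Classical.epsilon_spec h1).2
    have h3 : R p (Φ {q | R q a}) := by
      have : p ∈ {q | R q (Φ {q | R q a})} := h2 ▸ hp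
      exact this
    exact h.unique h3 hp
  have hΦ' : ∀ {p a}, R p a → Φ (orbitClosure S d act p) = a := fun hp => by
    rw [h.orbitClosure_eq hp, hΦ hp]
  refine ⟨Φ, ⟨?_, ?_, ?_⟩, ?_, ?_⟩
  · rintro _ ⟨p, hp, rfl⟩
    obtain ⟨a, ha⟩ := h.exists_right p hp
    rw [hΦ' ha]
    exact h.mem_right ha
  · rintro _ ⟨p, hp, rfl⟩ _ ⟨q, hq, rfl⟩ hpq
    obtain ⟨a, ha⟩ := h.exists_right p hp
    obtain ⟨b, hb⟩ := h.exists_right q hq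
    rw [hΦ' ha, hΦ' hb] at hpq
    rw [h.orbitClosure_eq ha, h.orbitClosure_eq hb, hpq]
  · intro a ha
    obtain ⟨p, hp⟩ := h.exists_left a ha
    exact ⟨_, ⟨p, h.mem_left hp, rfl⟩, hΦ' hp⟩
  · intro p hp a
    obtain ⟨b, hb⟩ := h.exists_right p hp
    rw [hΦ' hb]
    constructor
    · intro ha
      exact h.unique hb ha
    · rintro rfl
      exact hb
  · rintro _ ⟨p, hp, rfl⟩ _ ⟨q, hq, rfl⟩
    obtain ⟨a, ha⟩ := h.exists_right p hp
    obtain ⟨b, hb⟩ := h.exists_right q hq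
    rw [hΦ' ha, hΦ' hb, h.orbitClosure_eq ha, h.orbitClosure_eq hb, hδ, orbitDist]
    congr 1
    ext r
    constructor
    · rintro ⟨p, q, hp, hq, rfl⟩; exact ⟨p, hp, q, hq, rfl⟩
    · rintro ⟨p, hp, q, hq, rfl⟩; exact ⟨p, q, hp, hq, rfl⟩

end AlmostTransitive

end Abstract

/-! ### Quotients by `GL(V)`: open projections and closed orbits -/

section Quotients

variable {𝕜 : Type*} [RCLike 𝕜] {V : Type*} [AddCommGroup V] [Module 𝕜 V]

theorem mk_norm_eq_iff {m n : NormOn 𝕜 V} :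
    Quotient.mk (normSetoid 𝕜 V) m = Quotient.mk (normSetoid 𝕜 V) n ↔
      ∃ Δ : V ≃ₗ[𝕜] V, m = n.comp Δ := by
  rw [Quotient.eq]
  constructor
  · rintro ⟨Δ, h⟩
    exact ⟨Δ, NormOn.ext_apply fun x => by rw [NormOn.comp_apply, h]; simp⟩
  · rintro ⟨Δ, rfl⟩
    exact ⟨Δ, fun x => by simp⟩

/-- The action of `GL(V)` on pairs of norms. -/
def pairComp (p : NormPair 𝕜 V) (Δ : V ≃ₗ[𝕜] V) : NormPair 𝕜 V :=
  (p.1.comp Δ, p.2.comp Δ.symm.dualMap)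

theorem mk_pair_eq_iff {p q : NormPair 𝕜 V} :
    Quotient.mk (pairSetoid 𝕜 V) p = Quotient.mk (pairSetoid 𝕜 V) q ↔
      ∃ Δ : V ≃ₗ[𝕜] V, p = pairComp q Δ := by
  rw [Quotient.eq]
  constructor
  · rintro ⟨Δ, h, h'⟩
    refine ⟨Δ, Prod.ext (NormOn.ext_apply fun x => ?_) (NormOn.ext_apply fun f => ?_)⟩
    · simp [pairComp, h]
    · simp only [pairComp, NormOn.comp_apply, h']
      congr 1
      ext x
      simp
  · rintro ⟨Δ, rfl⟩
    refine ⟨Δ, fun x => by simp [pairComp], fun f => ?_⟩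
    simp only [pairComp, NormOn.comp_apply]
    congr 1
    ext x
    simp

/-- The saturation of an open set is a union of preimages under the continuous maps `m ↦ m.comp Δ`.
Openness pushes neighbourhoods of a norm to neighbourhoods of its class. -/
theorem isOpenMap_mk_norm : IsOpenMap (Quotient.mk (normSetoid 𝕜 V)) := by
  intro O hO
  refine isQuotientMap_quotient_mk'.isOpen_preimage.1 ?_
  change IsOpen ((Quotient.mk (normSetoid 𝕜 V)) ⁻¹' (Quotient.mk (normSetoid 𝕜 V) '' O))
  have : (Quotient.mk (normSetoid 𝕜 V)) ⁻¹' (Quotient.mk (normSetoid 𝕜 V) '' O) =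
      ⋃ Δ : V ≃ₗ[𝕜] V, (fun m : NormOn 𝕜 V => m.comp Δ) ⁻¹' O := by
    ext m
    simp only [mem_preimage, mem_image, mem_iUnion, mk_norm_eq_iff]
    constructor
    · rintro ⟨n, hn, Δ, rfl⟩; exact ⟨Δ, hn⟩
    · rintro ⟨Δ, h⟩; exact ⟨_, h, Δ, rfl⟩
  rw [this]
  exact isOpen_iUnion fun Δ => hO.preimage (continuous_comp Δ)

theorem isOpenMap_mk_pair : IsOpenMap (Quotient.mk (pairSetoid 𝕜 V)) := by
  intro O hO
  refine isQuotientMap_quotient_mk'.isOpen_preimage.1 ?_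
  change IsOpen ((Quotient.mk (pairSetoid 𝕜 V)) ⁻¹' (Quotient.mk (pairSetoid 𝕜 V) '' O))
  have : (Quotient.mk (pairSetoid 𝕜 V)) ⁻¹' (Quotient.mk (pairSetoid 𝕜 V) '' O) =
      ⋃ Δ : V ≃ₗ[𝕜] V, (fun p : NormPair 𝕜 V => pairComp p Δ) ⁻¹' O := by
    ext m
    simp only [mem_preimage, mem_image, mem_iUnion, mk_pair_eq_iff]
    constructor
    · rintro ⟨n, hn, Δ, rfl⟩; exact ⟨Δ, hn⟩
    · rintro ⟨Δ, h⟩; exact ⟨_, h, Δ, rfl⟩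
  rw [this]
  refine isOpen_iUnion fun Δ => hO.preimage ?_
  exact ((continuous_comp Δ).comp continuous_fst).prodMk
    ((continuous_comp Δ.symm.dualMap).comp continuous_snd)

/-- Compactness of the set of almost isometries between two finite dimensional spaces. -/
theorem exists_tendsto_of_near [FiniteDimensional 𝕜 V] {m n : NormOn 𝕜 V}
    (Δ : ℕ → V ≃ₗ[𝕜] V) (h : ∀ j : ℕ, Near (1 + 1 / ((j : ℝ) + 1)) m (n.comp (Δ j))) :
    ∃ (Γ : V ≃ₗ[𝕜] V) (φ : ℕ → ℕ), StrictMono φ ∧ m = n.comp Γ ∧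
      ∀ x, Filter.Tendsto (fun j => n (Δ (φ j) x - Γ x)) Filter.atTop (𝓝 0) := by
  let D : ℕ → m.Normed →L[𝕜] n.Normed := fun j =>
    LinearMap.toContinuousLinearMap
      ((n.toNormed : V →ₗ[𝕜] _) ∘ₗ (Δ j : V →ₗ[𝕜] V) ∘ₗ (m.toNormed.symm : _ →ₗ[𝕜] V))
  have hD : ∀ j x, D j x = n.toNormed (Δ j (m.toNormed.symm x)) := fun j x => rfl
  have : ProperSpace (m.Normed →L[𝕜] n.Normed) := FiniteDimensional.proper_rclike 𝕜 _
  have hbd : ∀ j, D j ∈ Metric.closedBall (0 : m.Normed →L[𝕜] n.Normed) 2 := by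
    intro j
    rw [mem_closedBall_zero_iff]
    refine ContinuousLinearMap.opNorm_le_bound _ zero_le_two fun x => ?_
    refine ((h j) x).1.trans (mul_le_mul_of_nonneg_right ?_ (m.nonneg x))
    have : 1 / ((j : ℝ) + 1) ≤ 1 := by
      rw [div_le_one (by positivity)]; linarith [Nat.cast_nonneg (α := ℝ) j]
    linarith
  obtain ⟨L, -, φ, hφ, hlim⟩ := (isCompact_closedBall _ _).tendsto_subseq hbd
  have hpt : ∀ x, Filter.Tendsto (fun j => D (φ j) x) Filter.atTop (𝓝 (L x)) := fun x =>
    ((ContinuousLinearMap.apply 𝕜 n.Normed x).continuous.tendsto L).comp hlim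
  -- Factors tending to `1` make the limit an exact isometry from `m` to `n`; it is injective, hence
  -- invertible by dimension.
  have hnorm : ∀ x, ‖L x‖ = ‖x‖ := by
    intro x
    refine tendsto_nhds_unique (hpt x).norm ?_
    have h0 : Filter.Tendsto (fun j => 1 + 1 / (((φ j : ℕ) : ℝ) + 1)) Filter.atTop (𝓝 1) := by
      have := (tendsto_one_div_add_atTop_nhds_zero_nat (𝕜 := ℝ)).comp hφ.tendsto_atTop
      simpa using this.const_add 1
    have hup : Filter.Tendsto (fun j => (1 + 1 / (((φ j : ℕ) : ℝ) + 1)) * ‖x‖) Filter.atTop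
        (𝓝 ‖x‖) := by simpa using h0.mul_const ‖x‖
    have hlo : Filter.Tendsto (fun j => (1 + 1 / (((φ j : ℕ) : ℝ) + 1))⁻¹ * ‖x‖) Filter.atTop
        (𝓝 ‖x‖) := by simpa using (h0.inv₀ one_ne_zero).mul_const ‖x‖
    refine tendsto_of_tendsto_of_tendsto_of_le_of_le hlo hup (fun j => ?_) (fun j => ?_)
    · have hpos : (0 : ℝ) < 1 + 1 / (((φ j : ℕ) : ℝ) + 1) := by positivity
      change _ ≤ _
      rw [inv_mul_le_iff₀ hpos]
      exact ((h (φ j)) x).2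
    · exact ((h (φ j)) x).1
  let Γ₀ : V →ₗ[𝕜] V :=
    (n.toNormed.symm : _ →ₗ[𝕜] V) ∘ₗ (L : m.Normed →ₗ[𝕜] n.Normed) ∘ₗ (m.toNormed : V →ₗ[𝕜] _)
  have hΓ₀ : ∀ x, n (Γ₀ x) = m x := fun x => hnorm (m.toNormed x)
  have hinj : Function.Injective Γ₀ := by
    rw [← LinearMap.ker_eq_bot, LinearMap.ker_eq_bot']
    intro x hx
    refine m.eq_zero_of_eq_zero x ?_
    have := hΓ₀ x
    rw [hx, n.apply_zero] at this
    exact this.symm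
  refine ⟨LinearEquiv.ofInjectiveEndo Γ₀ hinj, φ, hφ, NormOn.ext_apply fun x => (hΓ₀ x).symm, ?_⟩
  intro x
  have := tendsto_iff_norm_sub_tendsto_zero.1 (hpt (m.toNormed x))
  exact this

/-- Orbits are closed: almost isometries subconverge to an isometry. -/
theorem mk_norm_eq_of_near [FiniteDimensional 𝕜 V] {m n : NormOn 𝕜 V}
    (h : ∀ δ > 0, ∃ Δ : V ≃ₗ[𝕜] V, Near (1 + δ) m (n.comp Δ)) :
    Quotient.mk (normSetoid 𝕜 V) m = Quotient.mk (normSetoid 𝕜 V) n := by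
  choose Δ hΔ using fun j : ℕ => h (1 / ((j : ℝ) + 1)) (by positivity)
  obtain ⟨Γ, _, _, hΓ, _⟩ := exists_tendsto_of_near Δ hΔ
  exact mk_norm_eq_iff.2 ⟨Γ, hΓ⟩

/-- One sequence `Δ` serves both norms. Compactness in the first coordinate produces the limit `Γ`,
and the dual norms pass to the limit along the same subsequence. -/
theorem mk_pair_eq_of_near [FiniteDimensional 𝕜 V] {p q : NormPair 𝕜 V}
    (h : ∀ δ > 0, ∃ Δ : V ≃ₗ[𝕜] V, Near (1 + δ) p.1 (pairComp q Δ).1 ∧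
      Near (1 + δ) p.2 (pairComp q Δ).2) :
    Quotient.mk (pairSetoid 𝕜 V) p = Quotient.mk (pairSetoid 𝕜 V) q := by
  choose Δ hΔ hΔ' using fun j : ℕ => h (1 / ((j : ℝ) + 1)) (by positivity)
  obtain ⟨Γ, φ, hφ, hΓ, hlim⟩ := exists_tendsto_of_near Δ hΔ
  refine mk_pair_eq_iff.2 ⟨Γ, Prod.ext hΓ ?_⟩
  have key : ∀ f : Module.Dual 𝕜 V, q.2 f = p.2 (f ∘ₗ (Γ : V →ₗ[𝕜] V)) := by
    intro f
    obtain ⟨C, hC, hCf⟩ := exists_linearMap_le q.1 f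
    let b := Module.finBasis 𝕜 V
    let g : ℕ → Module.Dual 𝕜 V := fun j => f ∘ₗ ((Δ (φ j) : V →ₗ[𝕜] V) - (Γ : V →ₗ[𝕜] V))
    have hg : Filter.Tendsto (fun j => p.2 (g j)) Filter.atTop (𝓝 0) := by
      have hle : ∀ j, p.2 (g j) ≤ ∑ i, C * q.1 (Δ (φ j) (b i) - Γ (b i)) * p.2 (b.coord i) := by
        intro j
        have hsum : g j = ∑ i, g j (b i) • b.coord i := by
          refine b.ext fun i => ?_
          simp
        rw [hsum]
        refine (p.2.sum_le _ _).trans (Finset.sum_le_sum fun i _ => ?_)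
        rw [p.2.smul_eq]
        exact mul_le_mul_of_nonneg_right (hCf _) (p.2.nonneg _)
      refine squeeze_zero (fun j => p.2.nonneg _) hle ?_
      have : (0 : ℝ) = ∑ i : Fin (Module.finrank 𝕜 V), C * 0 * p.2 (b.coord i) := by simp
      rw [this]
      exact tendsto_finsetSum _ fun i _ => ((hlim (b i)).const_mul C).mul_const _
    have heq : ∀ j, (f ∘ₗ (Δ (φ j) : V →ₗ[𝕜] V)) = f ∘ₗ (Γ : V →ₗ[𝕜] V) + g j := by
      intro j
      ext x
      simp [g]
    have hlim1 : Filter.Tendsto (fun j => p.2 (f ∘ₗ (Δ (φ j) : V →ₗ[𝕜] V))) Filter.atTop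
        (𝓝 (p.2 (f ∘ₗ (Γ : V →ₗ[𝕜] V)))) := by
      rw [tendsto_iff_norm_sub_tendsto_zero]
      refine squeeze_zero (fun j => norm_nonneg _) (fun j => ?_) hg
      rw [Real.norm_eq_abs, abs_le, heq]
      have h1 := p.2.add_le (f ∘ₗ (Γ : V →ₗ[𝕜] V)) (g j)
      have h2 := p.2.le_add_sub (f ∘ₗ (Γ : V →ₗ[𝕜] V)) (f ∘ₗ (Γ : V →ₗ[𝕜] V) + g j)
      rw [p.2.sub_rev, add_sub_cancel_left] at h2
      constructor <;> linarith
    refine tendsto_nhds_unique ?_ hlim1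
    -- Testing the dual estimate on `f ∘ Δ` makes `q.2` appear at `f` itself, so no convergence of
    -- the inverses is needed.
    have hback : ∀ j, (pairComp q (Δ (φ j))).2 (f ∘ₗ (Δ (φ j) : V →ₗ[𝕜] V)) = q.2 f := by
      intro j
      simp only [pairComp, NormOn.comp_apply]
      congr 1
      ext x
      simp
    have h0 : Filter.Tendsto (fun j => 1 + 1 / (((φ j : ℕ) : ℝ) + 1)) Filter.atTop (𝓝 1) := by
      have := (tendsto_one_div_add_atTop_nhds_zero_nat (𝕜 := ℝ)).comp hφ.tendsto_atTop
      simpa using this.const_add 1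
    have hup : Filter.Tendsto (fun j => (1 + 1 / (((φ j : ℕ) : ℝ) + 1)) * q.2 f) Filter.atTop
        (𝓝 (q.2 f)) := by simpa using h0.mul_const (q.2 f)
    have hlo : Filter.Tendsto (fun j => (1 + 1 / (((φ j : ℕ) : ℝ) + 1))⁻¹ * q.2 f) Filter.atTop
        (𝓝 (q.2 f)) := by simpa using (h0.inv₀ one_ne_zero).mul_const (q.2 f)
    refine tendsto_of_tendsto_of_tendsto_of_le_of_le hlo hup (fun j => ?_) (fun j => ?_)
    · have hpos : (0 : ℝ) < 1 + 1 / (((φ j : ℕ) : ℝ) + 1) := by positivity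
      change _ ≤ _
      rw [inv_mul_le_iff₀ hpos]
      have := (hΔ' (φ j) (f ∘ₗ (Δ (φ j) : V →ₗ[𝕜] V))).1
      rwa [hback] at this
    · have := (hΔ' (φ j) (f ∘ₗ (Δ (φ j) : V →ₗ[𝕜] V))).2
      rwa [hback] at this
  refine NormOn.ext_apply fun f => ?_
  simp only [pairComp, NormOn.comp_apply]
  rw [key]
  congr 1
  ext x
  simp

end Quotients

/-! ### The gap metric and perturbation of embeddings -/

section Gap

variable {𝕜 : Type*} [RCLike 𝕜] {V : Type*} [AddCommGroup V] [Module 𝕜 V]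
  {A B : Type*} [NormedAddCommGroup A] [NormedSpace 𝕜 A] [NormedAddCommGroup B] [NormedSpace 𝕜 B]

theorem gap_ne_top (U W : Submodule 𝕜 A) :
    Metric.hausdorffEDist ((U : Set A) ∩ Metric.closedBall 0 1)
      ((W : Set A) ∩ Metric.closedBall 0 1) ≠ ⊤ :=
  Metric.hausdorffEDist_ne_top_of_nonempty_of_bounded ⟨0, by simp⟩ ⟨0, by simp⟩
    (Metric.isBounded_closedBall.subset inter_subset_right)
    (Metric.isBounded_closedBall.subset inter_subset_right)

theorem gap_nonneg (U W : Submodule 𝕜 A) : 0 ≤ gap U W := Metric.hausdorffDist_nonneg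

theorem gap_self (U : Submodule 𝕜 A) : gap U U = 0 := Metric.hausdorffDist_self_zero

theorem gap_comm (U W : Submodule 𝕜 A) : gap U W = gap W U := Metric.hausdorffDist_comm

theorem gap_triangle (U W Z : Submodule 𝕜 A) : gap U Z ≤ gap U W + gap W Z :=
  Metric.hausdorffDist_triangle (gap_ne_top U W)

theorem gap_map (g : A ≃ₗᵢ[𝕜] A) (U W : Submodule 𝕜 A) :
    gap (isoActGr g U) (isoActGr g W) = gap U W := by
  have h : ∀ U : Submodule 𝕜 A, ((isoActGr g U : Submodule 𝕜 A) : Set A) ∩ Metric.closedBall 0 1 =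
      g '' ((U : Set A) ∩ Metric.closedBall 0 1) := by
    intro U
    ext y
    simp only [isoActGr, mem_inter_iff, SetLike.mem_coe, Submodule.mem_map, mem_image,
      mem_closedBall_zero_iff]
    constructor
    · rintro ⟨⟨x, hx, rfl⟩, hy⟩
      exact ⟨x, ⟨hx, by simpa using hy⟩, rfl⟩
    · rintro ⟨x, ⟨hx, hy⟩, rfl⟩
      exact ⟨⟨x, hx, rfl⟩, by simpa using hy⟩
  rw [gap, h, h, Metric.hausdorffDist_image g.isometry, gap]

theorem exists_of_gap_lt {U W : Submodule 𝕜 A} {r : ℝ} (h : gap U W < r) {x : A} (hx : x ∈ U)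
    (hx1 : ‖x‖ ≤ 1) : ∃ y ∈ W, ‖y‖ ≤ 1 ∧ ‖x - y‖ < r := by
  obtain ⟨y, hy, hxy⟩ := Metric.exists_dist_lt_of_hausdorffDist_lt
    (s := (U : Set A) ∩ Metric.closedBall 0 1) ⟨hx, by simpa using hx1⟩ h (gap_ne_top U W)
  exact ⟨y, hy.1, by simpa using hy.2, by rwa [dist_eq_norm] at hxy⟩

theorem gap_le {U W : Submodule 𝕜 A} {r : ℝ} (hr : 0 ≤ r)
    (h1 : ∀ x ∈ U, ‖x‖ ≤ 1 → ∃ y ∈ W, ‖y‖ ≤ 1 ∧ ‖x - y‖ ≤ r)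
    (h2 : ∀ y ∈ W, ‖y‖ ≤ 1 → ∃ x ∈ U, ‖x‖ ≤ 1 ∧ ‖y - x‖ ≤ r) : gap U W ≤ r := by
  refine Metric.hausdorffDist_le_of_mem_dist hr ?_ ?_
  · rintro x ⟨hx, hx1⟩
    obtain ⟨y, hy, hy1, hxy⟩ := h1 x hx (by simpa using hx1)
    exact ⟨y, ⟨hy, by simpa using hy1⟩, by rwa [dist_eq_norm]⟩
  · rintro x ⟨hx, hx1⟩
    obtain ⟨y, hy, hy1, hxy⟩ := h2 x hx (by simpa using hx1)
    exact ⟨y, ⟨hy, by simpa using hy1⟩, by rwa [dist_eq_norm]⟩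

/-- The partner of `T x` is `U x` divided by `1 + ε`: this lies in the unit ball, and perturbation
and rescaling cost `ε` each. -/
theorem exists_mem_range_of_close {T U : V →ₗ[𝕜] A} {ε : ℝ} (hε : 0 ≤ ε)
    (h : ∀ x, ‖T x - U x‖ ≤ ε * ‖T x‖) {u : A} (hu : u ∈ LinearMap.range T) (hu1 : ‖u‖ ≤ 1) :
    ∃ y ∈ LinearMap.range U, ‖y‖ ≤ 1 ∧ ‖u - y‖ ≤ 2 * ε := by
  obtain ⟨x, rfl⟩ := hu
  have hpos : 0 < 1 + ε := by linarith
  have hn : ‖(((1 + ε : ℝ) : 𝕜)⁻¹)‖ = (1 + ε)⁻¹ := by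
    rw [norm_inv, RCLike.norm_ofReal, abs_of_pos hpos]
  have hUx : ‖U x‖ ≤ 1 + ε := by
    have h1 := norm_sub_norm_le (U x) (T x)
    rw [norm_sub_rev] at h1
    nlinarith [h x]
  refine ⟨((1 + ε : ℝ) : 𝕜)⁻¹ • U x, Submodule.smul_mem _ _ ⟨x, rfl⟩, ?_, ?_⟩
  · rw [norm_smul, hn, inv_mul_le_iff₀ hpos]; linarith
  · have h2 : ‖U x - ((1 + ε : ℝ) : 𝕜)⁻¹ • U x‖ ≤ ε := by
      have h3 : U x - ((1 + ε : ℝ) : 𝕜)⁻¹ • U x = ((1 + ε : ℝ) : 𝕜)⁻¹ • ((ε : 𝕜) • U x) := by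
        have hne : ((1 + ε : ℝ) : 𝕜) ≠ 0 := by exact_mod_cast hpos.ne'
        rw [← smul_right_injective A hne |>.eq_iff]
        simp only [smul_sub, smul_smul, mul_inv_cancel₀ hne, one_smul]
        rw [mul_inv_cancel_left₀ hne]
        push_cast
        rw [add_smul, one_smul]
        abel
      rw [h3, norm_smul, norm_smul, hn, RCLike.norm_ofReal, abs_of_nonneg hε,
        inv_mul_le_iff₀ hpos]
      nlinarith
    calc ‖T x - ((1 + ε : ℝ) : 𝕜)⁻¹ • U x‖
        ≤ ‖T x - U x‖ + ‖U x - ((1 + ε : ℝ) : 𝕜)⁻¹ • U x‖ := norm_sub_le_norm_sub_add_norm_sub _ _ _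
      _ ≤ 2 * ε := by nlinarith [h x]

/-- The hypothesis is relative to `T`. As `‖T x‖ ≤ 2 * ‖U x‖`, exchanging the roles doubles `ε`, and
`exists_mem_range_of_close` doubles it again. -/
theorem gap_range_le {T U : V →ₗ[𝕜] A} {ε : ℝ} (hε : 0 ≤ ε) (hε' : ε ≤ 1 / 2)
    (h : ∀ x, ‖T x - U x‖ ≤ ε * ‖T x‖) : gap (LinearMap.range T) (LinearMap.range U) ≤ 4 * ε := by
  have h' : ∀ x, ‖U x - T x‖ ≤ (2 * ε) * ‖U x‖ := by
    intro x
    have h1 := norm_sub_norm_le (T x) (U x)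
    have h2 := h x
    have h3 := norm_nonneg (T x)
    rw [norm_sub_rev]
    have h4 : ‖T x‖ ≤ 2 * ‖U x‖ := by nlinarith
    nlinarith [mul_le_mul_of_nonneg_left h4 hε]
  refine gap_le (by linarith) (fun x hx hx1 => ?_) (fun y hy hy1 => ?_)
  · obtain ⟨y, hy, hy1, hxy⟩ := exists_mem_range_of_close hε h hx hx1
    exact ⟨y, hy, hy1, by linarith⟩
  · obtain ⟨x, hx, hx1, hxy⟩ := exists_mem_range_of_close (by linarith) h' hy hy1
    exact ⟨x, hx, hx1, by linarith⟩

theorem exists_coord_bound [FiniteDimensional 𝕜 V] (m : NormOn 𝕜 V) :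
    ∃ M : ℝ, 1 ≤ M ∧ ∀ i, m (Module.finBasis 𝕜 V i) ≤ M ∧
      ∀ x, ‖(Module.finBasis 𝕜 V).coord i x‖ ≤ M * m x := by
  choose C hC hCx using fun i => exists_linearMap_le m ((Module.finBasis 𝕜 V).coord i)
  have h1 : ∀ i, C i ≤ ∑ i, C i := fun i =>
    Finset.single_le_sum (f := C) (fun j _ => (hC j).le) (Finset.mem_univ i)
  have h2 : ∀ i, m (Module.finBasis 𝕜 V i) ≤ ∑ i, m (Module.finBasis 𝕜 V i) := fun i =>
    Finset.single_le_sum (f := fun i => m (Module.finBasis 𝕜 V i)) (fun j _ => m.nonneg _)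
      (Finset.mem_univ i)
  have h3 : 0 ≤ ∑ i, C i := Finset.sum_nonneg fun i _ => (hC i).le
  have h4 : 0 ≤ ∑ i, m (Module.finBasis 𝕜 V i) := Finset.sum_nonneg fun i _ => m.nonneg _
  refine ⟨1 + ∑ i, C i + ∑ i, m (Module.finBasis 𝕜 V i), by linarith, fun i => ⟨?_, fun x => ?_⟩⟩
  · linarith [h2 i]
  · exact (hCx i x).trans (mul_le_mul_of_nonneg_right (by linarith [h1 i]) (m.nonneg x))

theorem norm_sub_le_of_basis [FiniteDimensional 𝕜 V] {m : NormOn 𝕜 V} {M r : ℝ}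
    (hM : ∀ i x, ‖(Module.finBasis 𝕜 V).coord i x‖ ≤ M * m x) {S T : V →ₗ[𝕜] A}
    (h : ∀ i, ‖S (Module.finBasis 𝕜 V i) - T (Module.finBasis 𝕜 V i)‖ ≤ r) (x : V) :
    ‖S x - T x‖ ≤ (Module.finrank 𝕜 V * M * r) * m x := by
  set b := Module.finBasis 𝕜 V
  have hx : S x - T x = ∑ i, b.coord i x • (S (b i) - T (b i)) := by
    simp only [Module.Basis.coord_apply, smul_sub, Finset.sum_sub_distrib, ← map_smul, ← map_sum,
      b.sum_repr]
  rw [hx]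
  refine (norm_sum_le _ _).trans ?_
  have : ∀ i ∈ Finset.univ, ‖b.coord i x • (S (b i) - T (b i))‖ ≤ M * m x * r := fun i _ => by
    rw [norm_smul]
    exact mul_le_mul (hM i x) (h i) (norm_nonneg _) ((norm_nonneg _).trans (hM i x))
  refine (Finset.sum_le_sum this).trans (le_of_eq ?_)
  rw [Finset.sum_const, Finset.card_univ, Fintype.card_fin, nsmul_eq_mul]
  ring

/-- A subspace close to the range of `T` contains a small perturbation of `T`. -/
theorem exists_lift_of_gap_lt [FiniteDimensional 𝕜 V] (m : NormOn 𝕜 V) {δ : ℝ} (hδ : 0 < δ) :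
    ∃ η > 0, ∀ T : V →ₗ[𝕜] A, IsEmb m T → ∀ Z : Submodule 𝕜 A, gap (LinearMap.range T) Z < η →
      ∃ S : V →ₗ[𝕜] A, (∀ x, S x ∈ Z) ∧ ∀ x, ‖S x - T x‖ ≤ δ * m x := by
  obtain ⟨M, hM1, hM⟩ := exists_coord_bound m
  have hM0 : 0 < M := by linarith
  set b := Module.finBasis 𝕜 V with hb
  set k : ℝ := (Module.finrank 𝕜 V : ℝ) with hk
  have hk0 : 0 ≤ k := Nat.cast_nonneg _
  -- Dividing by `M` puts the basis vectors in the unit ball. Undoing this costs `M`, and passing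
  -- from the basis to all vectors costs `k * M`; the `+ 1` keeps the denominator positive when `k =
  -- 0`.
  refine ⟨δ / (k * M * M + 1), by positivity, fun T hT Z hZ => ?_⟩
  have hn : ‖((M : ℝ) : 𝕜)⁻¹‖ = M⁻¹ := by rw [norm_inv, RCLike.norm_ofReal, abs_of_pos hM0]
  have h1 : ∀ i, ∃ z ∈ Z, ‖z‖ ≤ 1 ∧ ‖((M : ℝ) : 𝕜)⁻¹ • T (b i) - z‖ < δ / (k * M * M + 1) := by
    intro i
    refine exists_of_gap_lt hZ (Submodule.smul_mem _ _ ⟨b i, rfl⟩) ?_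
    rw [norm_smul, hn, inv_mul_le_iff₀ hM0, hT, mul_one]
    exact (hM i).1
  choose z hz _ hzT using h1
  have hne : ((M : ℝ) : 𝕜) ≠ 0 := by exact_mod_cast hM0.ne'
  let S : V →ₗ[𝕜] A := b.constr 𝕜 fun i => ((M : ℝ) : 𝕜) • z i
  have hS : ∀ i, S (b i) = ((M : ℝ) : 𝕜) • z i := fun i => b.constr_basis 𝕜 _ i
  refine ⟨S, fun x => ?_, fun x => ?_⟩
  · rw [← b.sum_repr x, map_sum]
    refine Submodule.sum_mem _ fun i _ => ?_
    rw [map_smul, hS]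
    exact Submodule.smul_mem _ _ (Submodule.smul_mem _ _ (hz i))
  · have h2 : ∀ i, ‖S (b i) - T (b i)‖ ≤ M * (δ / (k * M * M + 1)) := by
      intro i
      have h3 : S (b i) - T (b i) = -(((M : ℝ) : 𝕜) • (((M : ℝ) : 𝕜)⁻¹ • T (b i) - z i)) := by
        rw [hS, smul_sub, smul_smul, mul_inv_cancel₀ hne, one_smul]; abel
      rw [h3, norm_neg, norm_smul, RCLike.norm_ofReal, abs_of_pos hM0]
      exact mul_le_mul_of_nonneg_left (hzT i).le hM0.le
    refine (norm_sub_le_of_basis (fun i => (hM i).2) h2 x).trans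
      (mul_le_mul_of_nonneg_right ?_ (m.nonneg x))
    have h4 : k * M * (M * (δ / (k * M * M + 1))) = δ * (k * M * M / (k * M * M + 1)) := by
      field_simp
    rw [← hk, h4]
    refine mul_le_of_le_one_right hδ.le ?_
    rw [div_le_one (by positivity)]
    linarith

theorem near_of_norm_sub_le {m n : NormOn 𝕜 V} {S T : V →ₗ[𝕜] A} (hT : IsEmb m T)
    (hS : IsEmb n S) {r : ℝ} (hr0 : 0 ≤ r) (hr : r ≤ 1 / 2) (h : ∀ x, ‖S x - T x‖ ≤ r * m x) :
    Near (1 + 2 * r) m n := by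
  refine near_of_abs_sub_le hr0 hr fun x => ?_
  rw [← hT x, ← hS x] at *
  refine (abs_norm_sub_norm_le _ _).trans ((h x).trans ?_)
  rw [← hT x]

theorem injective_of_norm_sub_le {m : NormOn 𝕜 V} {S T : V →ₗ[𝕜] A} (hT : IsEmb m T)
    {r : ℝ} (hr : r ≤ 1 / 2) (h : ∀ x, ‖S x - T x‖ ≤ r * m x) : Function.Injective S := by
  rw [← LinearMap.ker_eq_bot, LinearMap.ker_eq_bot']
  intro x hx
  refine m.eq_zero_of_eq_zero x (le_antisymm ?_ (m.nonneg x))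
  have h1 := h x
  rw [hx, zero_sub, norm_neg, hT] at h1
  nlinarith [m.nonneg x]

end Gap

/-! ### The Fraïssé property and transfer between `E` and its limit -/

section Fraisse

variable {𝕜 : Type*} [RCLike 𝕜] {V : Type*} [AddCommGroup V] [Module 𝕜 V] [FiniteDimensional 𝕜 V]
  {E F : Type*} [NormedAddCommGroup E] [NormedSpace 𝕜 E] [NormedAddCommGroup F] [NormedSpace 𝕜 F]

variable (V) in
-- The Fraïssé property is applied to the range of `T` with its inclusion and `U ∘ T⁻¹`, which is a
-- `δ`-embedding because the norms are near. One `δ` serves all norms on `V`.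
theorem IsFraisse.exists_iso (hF : IsFraisse 𝕜 F) {ε : ℝ} (hε : 0 < ε) :
    ∃ δ > 0, ∀ m n : NormOn 𝕜 V, Near (1 + δ) m n → ∀ T U : V →ₗ[𝕜] F, IsEmb m T → IsEmb n U →
      ∃ g : F ≃ₗᵢ[𝕜] F, ∀ x, ‖g (T x) - U x‖ ≤ ε * m x := by
  obtain ⟨δ, hδ, h⟩ := hF ε hε (Module.finrank 𝕜 V)
  refine ⟨δ, hδ, fun m n hmn T U hT hU => ?_⟩
  let e := LinearEquiv.ofInjective T hT.injective
  let γ : LinearMap.range T →L[𝕜] F :=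
    LinearMap.toContinuousLinearMap (U ∘ₗ (e.symm : LinearMap.range T →ₗ[𝕜] V))
  let η : LinearMap.range T →L[𝕜] F := (LinearMap.range T).subtypeL
  have hpos : 0 < 1 + δ := by linarith
  have hγ : ∀ x, γ (e x) = U x := fun x => by simp [γ]
  have hη : ∀ x, η (e x) = T x := fun x => rfl
  have hnorm : ∀ x, ‖e x‖ = m x := fun x => hT x
  obtain ⟨g, hg⟩ := h ⟨LinearMap.range T, inferInstance⟩
    (LinearEquiv.finrank_eq e.symm) γ η
    (fun y => by
      obtain ⟨x, rfl⟩ := e.surjective y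
      rw [inv_mul_le_iff₀ hpos, hγ, hU, hnorm]
      exact (hmn x).symm)
    (fun y => by
      obtain ⟨x, rfl⟩ := e.surjective y
      rw [inv_mul_le_iff₀ hpos, hη, hT, hnorm]
      have := m.nonneg x
      constructor <;> nlinarith)
  refine ⟨g, fun x => ?_⟩
  have h1 := ((g.toContinuousLinearEquiv : F →L[𝕜] F) ∘L η - γ).le_of_opNorm_le hg (e x)
  rw [hnorm] at h1
  have h2 : ((g.toContinuousLinearEquiv : F →L[𝕜] F) ∘L η - γ) (e x) = g (T x) - U x := by
    rw [← hγ, ← hη]; rfl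
  rwa [h2] at h1

/-- Isometric copies of subspaces of `A` can almost be transferred to `B` together with their
relative position. -/
def Transfers (𝕜 : Type*) [RCLike 𝕜] (V A B : Type*) [AddCommGroup V] [Module 𝕜 V]
    [NormedAddCommGroup A] [NormedSpace 𝕜 A] [NormedAddCommGroup B] [NormedSpace 𝕜 B] : Prop :=
  ∀ m ∈ normsIn 𝕜 V B, ∀ n ∈ normsIn 𝕜 V B, ∀ T U : V →ₗ[𝕜] A, IsEmb m T → IsEmb n U →
    ∀ ε > (0 : ℝ), ∃ (W : Submodule 𝕜 A) (θ : W →ₗ[𝕜] B) (T₀ U₀ : V →ₗ[𝕜] W) (T' U' : V →ₗ[𝕜] B),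
      (∀ x, (T₀ x : A) = T x) ∧ (∀ x, (U₀ x : A) = U x) ∧ (∀ w, ‖θ w‖ ≤ (1 + ε) * ‖w‖) ∧
      IsEmb m T' ∧ IsEmb n U' ∧ (∀ x, ‖T' x - θ (T₀ x)‖ ≤ ε * m x) ∧
      ∀ x, ‖U' x - θ (U₀ x)‖ ≤ ε * n x

/-- The sum of the two ranges belongs to `Age(E)`, so it embeds isometrically into the limit and
there is no error. -/
theorem IsFraisseLimit.transfers_left
    (hF : IsFraisseLimit 𝕜 (fun W : Age 𝕜 E => W.1) F) : Transfers 𝕜 V E F := by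
  intro m _ n _ T U hT hU ε hε
  let W : Submodule 𝕜 E := LinearMap.range T ⊔ LinearMap.range U
  obtain ⟨ι⟩ := hF.contains ⟨W, inferInstance⟩
  let T₀ : V →ₗ[𝕜] W := T.codRestrict W fun x => Submodule.mem_sup_left ⟨x, rfl⟩
  let U₀ : V →ₗ[𝕜] W := U.codRestrict W fun x => Submodule.mem_sup_right ⟨x, rfl⟩
  refine ⟨W, ι.toLinearMap, T₀, U₀, ι.toLinearMap ∘ₗ T₀, ι.toLinearMap ∘ₗ U₀, fun x => rfl,
    fun x => rfl, fun w => ?_, fun x => ?_, fun x => ?_, fun x => ?_, fun x => ?_⟩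
  · have : ‖ι.toLinearMap w‖ = ‖w‖ := ι.norm_map w
    rw [this]
    nlinarith [norm_nonneg w]
  · exact (ι.norm_map _).trans (hT x)
  · exact (ι.norm_map _).trans (hU x)
  · have := m.nonneg x
    simp only [LinearMap.comp_apply, sub_self, norm_zero]
    positivity
  · have := n.nonneg x
    simp only [LinearMap.comp_apply, sub_self, norm_zero]
    positivity

/-- Finite dimensional subspaces of the Fraïssé limit almost embed into `E`. -/
theorem IsFraisseLimit.exists_near_emb (hF : IsFraisseLimit 𝕜 (fun W : Age 𝕜 E => W.1) F)
    (W : Submodule 𝕜 F) [FiniteDimensional 𝕜 W] {δ : ℝ} (hδ : 0 < δ) :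
    ∃ (Y : Age 𝕜 E) (θ : W →ₗ[𝕜] Y.1),
      ∀ w, ‖θ w‖ ≤ (1 + δ) * ‖w‖ ∧ ‖w‖ ≤ (1 + δ) * ‖θ w‖ := by
  obtain ⟨r, hr0, hr1, hr2⟩ : ∃ r : ℝ, 0 < r ∧ r ≤ 1 / 2 ∧ 2 * r ≤ δ :=
    ⟨min (1 / 2) (δ / 2), lt_min (by norm_num) (by linarith), min_le_left _ _, by
      linarith [min_le_right (1 / 2) (δ / 2)]⟩
  obtain ⟨η, hη, h⟩ := exists_lift_of_gap_lt (A := F) (NormOn.std 𝕜 W) hr0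
  -- The inclusion of `W` is perturbed to a map into `Z`, which lies in an isometric copy `Z'` of a
  -- member of `Age(E)`.
  obtain ⟨Z, Z', hZZ', ⟨Y, ⟨φ⟩⟩, hgap⟩ := hF.dense ⟨W, inferInstance⟩ η hη
  have hemb : IsEmb (NormOn.std 𝕜 W) W.subtype := fun x => rfl
  obtain ⟨S, hSZ, hS⟩ := h W.subtype hemb Z (by simpa using hgap)
  have hinj := injective_of_norm_sub_le hemb hr1 hS
  have hnear := near_of_norm_sub_le (n := NormOn.ofInjective S hinj) hemb (fun x => rfl) hr0.le hr1 hS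
  refine ⟨Y, φ.symm.toLinearEquiv.toLinearMap ∘ₗ S.codRestrict Z' fun x => hZZ' (hSZ x),
    fun w => ?_⟩
  have hn : ‖(φ.symm.toLinearEquiv.toLinearMap ∘ₗ S.codRestrict Z' fun x => hZZ' (hSZ x)) w‖ =
      NormOn.ofInjective S hinj w := φ.symm.norm_map _
  rw [hn]
  exact hnear.mono (by linarith) w

variable (V) in
-- Amalgamating `U ∘ T⁻¹` with the identity of the range of an embedding `T` corrects the almost
-- embedding `U` to an exact one, at the price of enlarging `Y`.
theorem IsAmalgamationClass.exists_amalgam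
    (hE : IsAmalgamationClass 𝕜 (fun W : Age 𝕜 E => W.1)) {ε : ℝ} (hε : 0 < ε) :
    ∃ δ > 0, ∀ m ∈ normsIn 𝕜 V E, ∀ (Y : Age 𝕜 E) (U : V →ₗ[𝕜] Y.1),
      (∀ x, ‖U x‖ ≤ (1 + δ) * m x ∧ m x ≤ (1 + δ) * ‖U x‖) →
      ∃ (Y' : Age 𝕜 E) (i : Y.1 →ₗᵢ[𝕜] Y'.1) (T : V →ₗ[𝕜] Y'.1),
        IsEmb m T ∧ ∀ x, ‖T x - i (U x)‖ ≤ ε * m x := by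
  obtain ⟨δ, hδ, h⟩ := hE.amalgamation ε hε (Module.finrank 𝕜 V)
  refine ⟨δ, hδ, fun m hm Y U hU => ?_⟩
  obtain ⟨T, hT⟩ := hm
  let e := LinearEquiv.ofInjective T hT.injective
  let γ : LinearMap.range T →L[𝕜] Y.1 :=
    LinearMap.toContinuousLinearMap (U ∘ₗ (e.symm : LinearMap.range T →ₗ[𝕜] V))
  have hpos : 0 < 1 + δ := by linarith
  have hγ : ∀ x, γ (e x) = U x := fun x => by simp [γ]
  have hnorm : ∀ x, ‖e x‖ = m x := fun x => hT x
  obtain ⟨Y', i, j, hij⟩ := h ⟨LinearMap.range T, inferInstance⟩ Y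
    ⟨LinearMap.range T, inferInstance⟩ (LinearEquiv.finrank_eq e.symm) γ
    (ContinuousLinearMap.id 𝕜 (LinearMap.range T))
    (fun y => by
      obtain ⟨x, rfl⟩ := e.surjective y
      rw [inv_mul_le_iff₀ hpos, hγ, hnorm]
      exact (hU x).symm)
    (fun y => by
      rw [inv_mul_le_iff₀ hpos, ContinuousLinearMap.id_apply]
      have := norm_nonneg y
      constructor <;> nlinarith)
  refine ⟨Y', i, j.toLinearMap ∘ₗ e.toLinearMap, fun x => (j.norm_map _).trans (hT x), fun x => ?_⟩
  have h1 := ContinuousLinearMap.le_of_opNorm_le _ hij (e x)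
  rw [hnorm] at h1
  refine le_trans (le_of_eq ?_) h1
  rw [norm_sub_rev, ← hγ]
  rfl

/-- After an almost embedding of the joint span into a member of `Age(E)`, one amalgamation corrects
`T` and a second one `U`. The second enlargement is isometric, so the first correction survives. -/
theorem IsFraisseLimit.transfers_right (hE : IsAmalgamationClass 𝕜 (fun W : Age 𝕜 E => W.1))
    (hF : IsFraisseLimit 𝕜 (fun W : Age 𝕜 E => W.1) F) : Transfers 𝕜 V F E := by
  intro m hm n hn T U hT hU ε hε
  obtain ⟨δ, hδ, h⟩ := hE.exists_amalgam V hε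
  let W : Submodule 𝕜 F := LinearMap.range T ⊔ LinearMap.range U
  let T₀ : V →ₗ[𝕜] W := T.codRestrict W fun x => Submodule.mem_sup_left ⟨x, rfl⟩
  let U₀ : V →ₗ[𝕜] W := U.codRestrict W fun x => Submodule.mem_sup_right ⟨x, rfl⟩
  have hT₀ : ∀ x, ‖T₀ x‖ = m x := hT
  have hU₀ : ∀ x, ‖U₀ x‖ = n x := hU
  obtain ⟨Y, θ, hθ⟩ := hF.exists_near_emb W (lt_min hδ hε)
  have hθδ : ∀ w, ‖θ w‖ ≤ (1 + δ) * ‖w‖ ∧ ‖w‖ ≤ (1 + δ) * ‖θ w‖ := fun w =>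
    ⟨(hθ w).1.trans (mul_le_mul_of_nonneg_right (by linarith [min_le_left δ ε]) (norm_nonneg _)),
      (hθ w).2.trans (mul_le_mul_of_nonneg_right (by linarith [min_le_left δ ε]) (norm_nonneg _))⟩
  obtain ⟨Y₁, i₁, T₁, hT₁, hT₁'⟩ := h m hm Y (θ ∘ₗ T₀) fun x => by
    rw [← hT₀]; exact hθδ (T₀ x)
  obtain ⟨Y₂, i₂, U₂, hU₂, hU₂'⟩ := h n hn Y₁ (i₁.toLinearMap ∘ₗ θ ∘ₗ U₀) fun x => by
    have : ‖(i₁.toLinearMap ∘ₗ θ ∘ₗ U₀) x‖ = ‖θ (U₀ x)‖ := i₁.norm_map _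
    rw [this, ← hU₀]
    exact hθδ (U₀ x)
  refine ⟨W, Y₂.1.subtype ∘ₗ i₂.toLinearMap ∘ₗ i₁.toLinearMap ∘ₗ θ, T₀, U₀,
    Y₂.1.subtype ∘ₗ i₂.toLinearMap ∘ₗ T₁, Y₂.1.subtype ∘ₗ U₂, fun x => rfl, fun x => rfl,
    fun w => ?_, fun x => ?_, fun x => ?_, fun x => ?_, fun x => ?_⟩
  · have : ‖(Y₂.1.subtype ∘ₗ i₂.toLinearMap ∘ₗ i₁.toLinearMap ∘ₗ θ) w‖ = ‖θ w‖ :=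
      (i₂.norm_map _).trans (i₁.norm_map _)
    rw [this]
    exact (hθ w).1.trans (mul_le_mul_of_nonneg_right (by linarith [min_le_right δ ε])
      (norm_nonneg _))
  · exact (i₂.norm_map _).trans (hT₁ x)
  · exact hU₂ x
  · refine le_trans (le_of_eq ?_) (hT₁' x)
    rw [← i₂.norm_map, map_sub]
    rfl
  · exact hU₂' x

theorem IsFraisseLimit.normsIn_subset (hF : IsFraisseLimit 𝕜 (fun W : Age 𝕜 E => W.1) F) :
    normsIn 𝕜 V E ⊆ normsIn 𝕜 V F := by
  rintro m ⟨T, hT⟩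
  obtain ⟨ι⟩ := hF.contains ⟨LinearMap.range T, inferInstance⟩
  exact ⟨ι.toLinearMap ∘ₗ T.rangeRestrict, fun x => (ι.norm_map _).trans (hT x)⟩

theorem IsFraisseLimit.subset_closure_normsIn
    (hF : IsFraisseLimit 𝕜 (fun W : Age 𝕜 E => W.1) F) :
    normsIn 𝕜 V F ⊆ closure (normsIn 𝕜 V E) := by
  rintro m ⟨T, hT⟩
  rw [mem_closure_iff_nhds]
  intro O hO
  obtain ⟨δ, hδ, h⟩ := exists_near_subset m hO
  obtain ⟨Y, θ, hθ⟩ := hF.exists_near_emb (LinearMap.range T) hδ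
  have hθi : Function.Injective θ := by
    rw [← LinearMap.ker_eq_bot, LinearMap.ker_eq_bot']
    intro x hx
    have := (hθ x).2
    rw [hx, norm_zero, mul_zero] at this
    exact norm_le_zero_iff.1 this
  let S : V →ₗ[𝕜] E := Y.1.subtype ∘ₗ θ ∘ₗ T.rangeRestrict
  have hS : Function.Injective S := Y.1.injective_subtype.comp
    (hθi.comp ((LinearMap.injective_rangeRestrict_iff _).2 hT.injective))
  refine ⟨NormOn.ofInjective S hS, h _ fun x => ?_, ⟨S, fun x => rfl⟩⟩
  have := hθ (T.rangeRestrict x)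
  rw [← hT]
  exact this

end Fraisse

theorem le_of_forall_le_add_mul {a b C : ℝ} (h : ∀ ε > 0, ε ≤ 1 → a ≤ b + ε * C) : a ≤ b := by
  refine le_of_forall_pos_le_add fun r hr => ?_
  have hpos : 0 < r / (|C| + 1) := by positivity
  refine (h (min 1 (r / (|C| + 1))) (lt_min one_pos hpos) (min_le_left _ _)).trans ?_
  have h1 : min 1 (r / (|C| + 1)) * C ≤ r / (|C| + 1) * |C| :=
    (mul_le_mul_of_nonneg_left (le_abs_self C) (lt_min one_pos hpos).le).trans
      (mul_le_mul_of_nonneg_right (min_le_right _ _) (abs_nonneg C))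
  have h2 : r / (|C| + 1) * |C| ≤ r := by
    rw [div_mul_eq_mul_div, div_le_iff₀ (by positivity)]
    nlinarith [abs_nonneg C]
  linarith

/-! ### Relative position after a transfer -/

section TransferEstimate

variable {𝕜 : Type*} [RCLike 𝕜] {V : Type*} [AddCommGroup V] [Module 𝕜 V]
  {A B : Type*} [NormedAddCommGroup A] [NormedSpace 𝕜 A] [NormedAddCommGroup B] [NormedSpace 𝕜 B]

/-- Independent points `x` and `y` are kept because the gap matches different vectors; the operator
norm needs only `x = y`. -/
theorem Transfers.norm_sub_le {m n : NormOn 𝕜 V} (h : Transfers 𝕜 V A B) (hm : m ∈ normsIn 𝕜 V B)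
    (hn : n ∈ normsIn 𝕜 V B) {T U : V →ₗ[𝕜] A} (hT : IsEmb m T) (hU : IsEmb n U) {ε : ℝ}
    (hε : 0 < ε) : ∃ T' U' : V →ₗ[𝕜] B, IsEmb m T' ∧ IsEmb n U' ∧
      ∀ x y, ‖T' x - U' y‖ ≤ (1 + ε) * ‖T x - U y‖ + ε * m x + ε * n y := by
  obtain ⟨W, θ, T₀, U₀, T', U', hT₀, hU₀, hθ, hT', hU', hTθ, hUθ⟩ := h m hm n hn T U hT hU ε hε
  refine ⟨T', U', hT', hU', fun x y => ?_⟩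
  have h1 : ‖θ (T₀ x) - θ (U₀ y)‖ ≤ (1 + ε) * ‖T x - U y‖ := by
    rw [← map_sub, ← hT₀, ← hU₀]
    exact hθ _
  have h8 : ‖T' x - U' y‖ ≤ ‖T' x - θ (T₀ x)‖ + ‖θ (T₀ x) - θ (U₀ y)‖ + ‖U' y - θ (U₀ y)‖ := by
    rw [norm_sub_rev (U' y)]
    exact (norm_sub_le_norm_sub_add_norm_sub _ (θ (U₀ y)) _).trans
      (add_le_add_left (norm_sub_le_norm_sub_add_norm_sub _ _ _) _)
  linarith [hTθ x, hUθ y]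

end TransferEstimate

/-! ### Full rank operators and `∂` -/

section FullRankOperators

variable {𝕜 : Type*} [RCLike 𝕜] {X : Type*} [NormedAddCommGroup X] [NormedSpace 𝕜 X]
  {A B F : Type*} [NormedAddCommGroup A] [NormedSpace 𝕜 A]
  [NormedAddCommGroup B] [NormedSpace 𝕜 B] [NormedAddCommGroup F] [NormedSpace 𝕜 F]

theorem near_self {V : Type*} [AddCommGroup V] [Module 𝕜 V] (m : NormOn 𝕜 V) {δ : ℝ}
    (hδ : 0 ≤ δ) : Near (1 + δ) m m := fun x => by
  have := m.nonneg x
  constructor <;> nlinarith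

/-- The constant `η` depends on the norms only through `K`, which is what uniform equivalence with
`ω` on bounded sets requires. -/
theorem near_of_norm_sub_lt {K δ : ℝ} (hK : 0 < K) (hδ : 0 < δ) :
    ∃ η > 0, ∀ (m n : NormOn 𝕜 X) (T U : X →L[𝕜] F), (∀ x, ‖x‖ ≤ K * m x) → HasNu T m →
      HasNu U n → ‖T - U‖ < η → Near (1 + δ) m n := by
  obtain ⟨r, hr0, hr1, hr2⟩ : ∃ r : ℝ, 0 < r ∧ r ≤ 1 / 2 ∧ 2 * r ≤ δ :=
    ⟨min (1 / 2) (δ / 2), lt_min (by norm_num) (by linarith), min_le_left _ _, by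
      linarith [min_le_right (1 / 2) (δ / 2)]⟩
  refine ⟨r / K, by positivity, fun m n T U hm hT hU hTU => ?_⟩
  refine (near_of_norm_sub_le (T := (T : X →ₗ[𝕜] F)) (S := (U : X →ₗ[𝕜] F)) hT hU hr0.le hr1
    fun x => ?_).mono (by linarith)
  rw [norm_sub_rev]
  have h1 := (T - U).le_of_opNorm_le hTU.le x
  refine h1.trans ?_
  rw [div_mul_eq_mul_div, div_le_iff₀ hK]
  nlinarith [hm x]

variable [FiniteDimensional 𝕜 X]

theorem hasNu_toContinuousLinearMap {m : NormOn 𝕜 X} {T : X →ₗ[𝕜] A} (hT : IsEmb m T) :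
    HasNu (LinearMap.toContinuousLinearMap T) m := fun x => hT x

theorem norm_toContinuousLinearMap_sub_le {T U : X →ₗ[𝕜] A} {r : ℝ} (hr : 0 ≤ r)
    (h : ∀ x, ‖T x - U x‖ ≤ r * ‖x‖) :
    ‖LinearMap.toContinuousLinearMap T - LinearMap.toContinuousLinearMap U‖ ≤ r :=
  ContinuousLinearMap.opNorm_le_bound _ hr h

variable (X) in
theorem IsFraisse.exists_norm_sub_lt (hF : IsFraisse 𝕜 F) (K : ℝ) {ε : ℝ} (hε : 0 < ε) :
    ∃ δ > 0, ∀ m ∈ normsIn 𝕜 X F, ∀ n ∈ normsIn 𝕜 X F, (∀ x, m x ≤ K * ‖x‖) → Near (1 + δ) m n →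
      ∃ T U : X →L[𝕜] F, HasNu T m ∧ HasNu U n ∧ ‖T - U‖ < ε := by
  have hK : 0 < |K| + 1 := by positivity
  obtain ⟨δ, hδ, h⟩ := hF.exists_iso X (ε := ε / 2 / (|K| + 1)) (by positivity)
  refine ⟨δ, hδ, ?_⟩
  rintro m ⟨T, hT⟩ n ⟨U, hU⟩ hm hmn
  obtain ⟨g, hg⟩ := h m n hmn T U hT hU
  refine ⟨LinearMap.toContinuousLinearMap (g.toLinearEquiv.toLinearMap ∘ₗ T),
    LinearMap.toContinuousLinearMap U, hasNu_toContinuousLinearMap fun x =>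
      (g.norm_map _).trans (hT x), hasNu_toContinuousLinearMap hU, ?_⟩
  refine (norm_toContinuousLinearMap_sub_le (r := ε / 2) (by linarith) fun x => ?_).trans_lt
    (by linarith)
  refine (hg x).trans ?_
  rw [div_mul_eq_mul_div, div_le_iff₀ hK]
  have h1 : m x ≤ (|K| + 1) * ‖x‖ := (hm x).trans (mul_le_mul_of_nonneg_right
    (by linarith [le_abs_self K]) (norm_nonneg x))
  nlinarith

variable (X) in
theorem IsFraisse.almostTransitive_fullRankOps (hF : IsFraisse 𝕜 F) :
    AlmostTransitive (fullRankOps 𝕜 X F) (fun T U => ‖T - U‖) isoActOps HasNu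
      (normsIn 𝕜 X F) where
  nonneg _ _ := norm_nonneg _
  self _ := by simp
  symm _ _ := norm_sub_rev _ _
  triangle _ _ _ := norm_sub_le_norm_sub_add_norm_sub _ _ _
  mem_left h := IsEmb.injective h
  mem_right h := ⟨_, h⟩
  exists_right T hT := ⟨NormOn.ofInjective (T : X →ₗ[𝕜] F) hT, fun _ => rfl⟩
  exists_left := by
    rintro m ⟨T, hT⟩
    exact ⟨_, hasNu_toContinuousLinearMap hT⟩
  unique h h' := NormOn.ext_apply fun x => (h x).symm.trans (h' x)
  act_rel g _ _ h := fun x => (g.norm_map _).trans (h x)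
  act_dist g T U := by
    have : isoActOps g T - isoActOps g U =
        g.toLinearIsometry.toContinuousLinearMap.comp (T - U) := by
      ext x
      simp [isoActOps]
    rw [this, LinearIsometry.norm_toContinuousLinearMap_comp]
  homogeneous := by
    intro T U m hT hU ε hε
    obtain ⟨C, hC, h⟩ := exists_norm_le (NormOn.std 𝕜 X) m
    obtain ⟨δ, hδ, h'⟩ := hF.exists_iso X (ε := ε / 2 / C) (by positivity)
    obtain ⟨g, hg⟩ := h' m m (near_self m hδ.le) _ _ hT hU
    refine ⟨g, lt_of_le_of_lt (b := ε / 2) ?_ (by linarith)⟩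
    refine ContinuousLinearMap.opNorm_le_bound _ (by linarith) fun x => (hg x).trans ?_
    rw [div_mul_eq_mul_div, div_le_iff₀ hC]
    have h1 : m x ≤ C * ‖x‖ := h x
    nlinarith
  separated := by
    intro m n _ _ h
    refine NormOn.ext_apply fun x => ?_
    have h1 : |m x - n x| ≤ 0 := by
      refine le_of_forall_le_add_mul (C := ‖x‖) fun ε hε _ => ?_
      obtain ⟨T, U, hT, hU, hTU⟩ := h ε hε
      have h2 := (T - U).le_of_opNorm_le hTU.le x
      rw [← show ‖T x‖ = m x from hT x, ← show ‖U x‖ = n x from hU x, zero_add]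
      exact (abs_norm_sub_norm_le _ _).trans h2
    exact sub_eq_zero.1 (abs_eq_zero.1 (le_antisymm h1 (abs_nonneg _)))
  nhds_left := by
    intro m _ O hO
    obtain ⟨δ, hδ, h⟩ := exists_near_subset m hO
    obtain ⟨C, hC, hm⟩ := exists_norm_le m (NormOn.std 𝕜 X)
    obtain ⟨η, hη, h'⟩ := near_of_norm_sub_lt (𝕜 := 𝕜) (X := X) (F := F) hC hδ
    exact ⟨η, hη, fun T U n hT hU hTU => h n (h' m n T U hm hT hU hTU)⟩
  nhds_right := by
    intro m hm ε hε
    obtain ⟨C, hC, hmC⟩ := exists_norm_le (NormOn.std 𝕜 X) m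
    obtain ⟨δ, hδ, h⟩ := hF.exists_norm_sub_lt X C hε
    exact ⟨_, near_mem_nhds m (c := 1 + δ) (by linarith), fun n hn hn' => h m hm n hn' hmC hn⟩

/-- All norms in an `ω`-bounded set are within the factor `exp C` of a fixed one, so they share
their comparison constants with the norm of `X`. -/
theorem IsFraisse.uniformlyEquivalentOn_omega (hF : IsFraisse 𝕜 F) {A : Set (NormOn 𝕜 X)}
    (hA : A ⊆ normsIn 𝕜 X F) (hb : IsBoundedFor omega A) :
    UniformlyEquivalentOn A (partialDist F) omega := by
  intro ε hε
  rcases A.eq_empty_or_nonempty with rfl | ⟨m₀, hm₀⟩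
  · exact ⟨1, one_pos, by simp⟩
  obtain ⟨C, hC⟩ := hb
  obtain ⟨K, hK, hK'⟩ := exists_norm_le (NormOn.std 𝕜 X) m₀
  obtain ⟨K₁, hK₁, hK₁'⟩ := exists_norm_le m₀ (NormOn.std 𝕜 X)
  have hup : ∀ m ∈ A, ∀ x, m x ≤ (Real.exp C * K) * ‖x‖ := fun m hm x => by
    have h1 := (near_of_omega_le (hC m₀ hm₀ m hm) x).1
    rw [mul_assoc]
    exact h1.trans (mul_le_mul_of_nonneg_left (hK' x) (Real.exp_pos C).le)
  have hlo : ∀ m ∈ A, ∀ x, ‖x‖ ≤ (K₁ * Real.exp C) * m x := fun m hm x => by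
    have h1 := (near_of_omega_le (hC m₀ hm₀ m hm) x).2
    rw [mul_assoc]
    exact (hK₁' x).trans (mul_le_mul_of_nonneg_left h1 hK₁.le)
  obtain ⟨δ, hδ, h⟩ := hF.exists_norm_sub_lt X (Real.exp C * K) hε
  -- This increment makes the comparison factor exactly `exp (ε / 2)`, hence `ω ≤ ε / 2`.
  have hexp : 0 < Real.exp (ε / 2) - 1 := by
    have := Real.add_one_lt_exp (x := ε / 2) (by linarith)
    linarith
  obtain ⟨η, hη, h'⟩ := near_of_norm_sub_lt (𝕜 := 𝕜) (X := X) (F := F)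
    (K := K₁ * Real.exp C) (by positivity) hexp
  have hat := hF.almostTransitive_fullRankOps X
  have hlog : 0 < Real.log (1 + δ) := Real.log_pos (by linarith)
  refine ⟨min η (Real.log (1 + δ)), lt_min hη hlog, fun m hm n hn => ⟨fun hd => ?_, fun hd => ?_⟩⟩
  · obtain ⟨T, U, hT, hU, hTU⟩ := hat.exists_lt (δ := partialDist F) (fun _ _ => rfl) (hA hm)
      (hA hn) (hd.trans_le (min_le_left _ _))
    have h1 := h' m n T U (hlo m hm) hT hU hTU
    have h2 := omega_le_of_near (by linarith) h1
    rw [add_sub_cancel, Real.log_exp] at h2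
    linarith
  · have h1 := near_of_omega_le (hd.trans_le (min_le_right _ _)).le
    rw [Real.exp_log (by linarith)] at h1
    obtain ⟨T, U, hT, hU, hTU⟩ := h m (hA hm) n (hA hn) (hup m hm) h1
    exact (hat.dist_le (δ := partialDist F) (fun _ _ => rfl) hT hU).trans_lt hTU

theorem Transfers.partialDist_le (h : Transfers 𝕜 X A B) {m n : NormOn 𝕜 X}
    (hmA : m ∈ normsIn 𝕜 X A) (hnA : n ∈ normsIn 𝕜 X A) (hmB : m ∈ normsIn 𝕜 X B)
    (hnB : n ∈ normsIn 𝕜 X B) : partialDist B m n ≤ partialDist A m n := by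
  obtain ⟨T, hT⟩ := hmA
  obtain ⟨U, hU⟩ := hnA
  -- Membership in `normsIn 𝕜 X A` matters here: the infimum over an empty set would be the default
  -- value `0`.
  refine le_csInf ⟨_, _, _, hasNu_toContinuousLinearMap hT, hasNu_toContinuousLinearMap hU, rfl⟩ ?_
  rintro r ⟨T, U, hT, hU, rfl⟩
  obtain ⟨C, hC, hm⟩ := exists_norm_le (NormOn.std 𝕜 X) m
  obtain ⟨C', hC', hn⟩ := exists_norm_le (NormOn.std 𝕜 X) n
  refine le_of_forall_le_add_mul (C := ‖T - U‖ + C + C') fun ε hε _ => ?_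
  obtain ⟨T', U', hT', hU', hTU⟩ := h.norm_sub_le hmB hnB hT hU hε
  have hle : partialDist B m n ≤
      ‖LinearMap.toContinuousLinearMap T' - LinearMap.toContinuousLinearMap U'‖ := by
    refine csInf_le ⟨0, ?_⟩ ⟨_, _, hasNu_toContinuousLinearMap hT',
      hasNu_toContinuousLinearMap hU', rfl⟩
    rintro r ⟨T, U, _, _, rfl⟩
    exact norm_nonneg _
  refine hle.trans (norm_toContinuousLinearMap_sub_le (by positivity) fun x => ?_)
  have h1 : ‖T x - U x‖ ≤ ‖T - U‖ * ‖x‖ := (T - U).le_opNorm x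
  have h2 : ‖T' x - U' x‖ ≤ (1 + ε) * ‖T x - U x‖ + ε * m x + ε * n x := hTU x x
  have h4 : m x ≤ C * ‖x‖ := hm x
  have h5 : n x ≤ C' * ‖x‖ := hn x
  have h6 := mul_le_mul_of_nonneg_left h4 hε.le
  have h7 := mul_le_mul_of_nonneg_left h5 hε.le
  nlinarith

end FullRankOperators

/-! ### Grassmannians and the Kadets function -/

section Grassmannians

variable {𝕜 : Type*} [RCLike 𝕜] {V : Type*} [AddCommGroup V] [Module 𝕜 V]
  {A B F : Type*} [NormedAddCommGroup A] [NormedSpace 𝕜 A] [NormedAddCommGroup B]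
  [NormedSpace 𝕜 B] [NormedAddCommGroup F] [NormedSpace 𝕜 F]

theorem comp_mem_normsIn {V' : Type*} [AddCommGroup V'] [Module 𝕜 V'] {m : NormOn 𝕜 V}
    (hm : m ∈ normsIn 𝕜 V A) (e : V' ≃ₗ[𝕜] V) : m.comp e ∈ normsIn 𝕜 V' A := by
  obtain ⟨T, hT⟩ := hm
  exact ⟨T ∘ₗ e.toLinearMap, fun x => hT (e x)⟩

theorem mk_mem_bmIn {m : NormOn 𝕜 V} :
    Quotient.mk (normSetoid 𝕜 V) m ∈ bmIn 𝕜 V A ↔ m ∈ normsIn 𝕜 V A := by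
  constructor
  · rintro ⟨n, hn, h⟩
    obtain ⟨Δ, rfl⟩ := mk_norm_eq_iff.1 h.symm
    exact comp_mem_normsIn hn Δ
  · intro h
    exact ⟨m, h, rfl⟩

/-- Composition with an element of `GL(V)` adapts the embedding to any chosen representative without
changing its range. -/
theorem hasTau_mk_iff {m : NormOn 𝕜 V} {W : Submodule 𝕜 A} :
    HasTau W (Quotient.mk (normSetoid 𝕜 V) m) ↔
      ∃ T : V →ₗ[𝕜] A, IsEmb m T ∧ LinearMap.range T = W := by
  constructor
  · rintro ⟨n, T, hT, hW, h⟩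
    obtain ⟨Δ, rfl⟩ := mk_norm_eq_iff.1 h.symm
    refine ⟨T ∘ₗ Δ.toLinearMap, fun x => hT (Δ x), ?_⟩
    rw [LinearMap.range_comp_of_range_eq_top _ Δ.range, hW]
  · rintro ⟨T, hT, hW⟩
    exact ⟨m, T, hT, hW, rfl⟩

theorem exists_equiv_of_range_eq {T S : V →ₗ[𝕜] A} (hT : Function.Injective T)
    (hS : Function.Injective S) (h : LinearMap.range T = LinearMap.range S) :
    ∃ Δ : V ≃ₗ[𝕜] V, ∀ x, S (Δ x) = T x := by
  refine ⟨(LinearEquiv.ofInjective T hT).trans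
    ((LinearEquiv.ofEq _ _ h).trans (LinearEquiv.ofInjective S hS).symm), fun x => ?_⟩
  exact congrArg Subtype.val ((LinearEquiv.ofInjective S hS).apply_symm_apply
    (LinearEquiv.ofEq _ _ h (LinearEquiv.ofInjective T hT x)))

theorem HasTau.unique {W : Submodule 𝕜 A} {b c : BMSpace 𝕜 V} (hb : HasTau W b)
    (hc : HasTau W c) : b = c := by
  obtain ⟨m, T, hT, hW, rfl⟩ := hb
  obtain ⟨n, S, hS, rfl, rfl⟩ := hc
  obtain ⟨Δ, hΔ⟩ := exists_equiv_of_range_eq hT.injective hS.injective hW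
  refine mk_norm_eq_iff.2 ⟨Δ, NormOn.ext_apply fun x => ?_⟩
  rw [NormOn.comp_apply, ← hS, hΔ, hT]

/-- Since `U` and `U'` induce the same norm `n`, a partner `U y` in the unit ball is carried to `U'
y` in the unit ball. -/
theorem exists_mem_range_of_transfer {m n : NormOn 𝕜 V} {T U : V →ₗ[𝕜] A} {T' U' : V →ₗ[𝕜] B}
    {ε r : ℝ} (hT : IsEmb m T) (hU : IsEmb n U) (hT' : IsEmb m T') (hU' : IsEmb n U')
    (hr : gap (LinearMap.range T) (LinearMap.range U) < r) (hε : 0 ≤ ε)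
    (h : ∀ x y, ‖T' x - U' y‖ ≤ (1 + ε) * ‖T x - U y‖ + ε * m x + ε * n y) {u : B}
    (hu : u ∈ LinearMap.range T') (hu1 : ‖u‖ ≤ 1) :
    ∃ w ∈ LinearMap.range U', ‖w‖ ≤ 1 ∧ ‖u - w‖ ≤ (1 + ε) * r + 2 * ε := by
  obtain ⟨x, rfl⟩ := hu
  rw [hT'] at hu1
  obtain ⟨_, ⟨y, rfl⟩, hy1, hxy⟩ := exists_of_gap_lt hr ⟨x, rfl⟩ ((hT x).trans_le hu1)
  rw [hU] at hy1
  refine ⟨U' y, ⟨y, rfl⟩, (hU' y).trans_le hy1, (h x y).trans ?_⟩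
  nlinarith

theorem Transfers.kadetsDist_le (h : Transfers 𝕜 V A B) {b c : BMSpace 𝕜 V}
    (hbA : b ∈ bmIn 𝕜 V A) (hcA : c ∈ bmIn 𝕜 V A) (hbB : b ∈ bmIn 𝕜 V B) (hcB : c ∈ bmIn 𝕜 V B) :
    kadetsDist B b c ≤ kadetsDist A b c := by
  induction b using Quotient.inductionOn with | h m => ?_
  induction c using Quotient.inductionOn with | h n => ?_
  rw [mk_mem_bmIn] at *
  obtain ⟨T, hT⟩ := hbA
  obtain ⟨U, hU⟩ := hcA
  refine le_csInf ⟨_, _, _, ⟨m, T, hT, rfl, rfl⟩, ⟨n, U, hU, rfl, rfl⟩, rfl⟩ ?_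
  rintro r ⟨U₁, W₁, hU₁, hW₁, rfl⟩
  obtain ⟨T, hT, rfl⟩ := hasTau_mk_iff.1 hU₁
  obtain ⟨U, hU, rfl⟩ := hasTau_mk_iff.1 hW₁
  set d := gap (LinearMap.range T) (LinearMap.range U) with hd
  have hd0 : 0 ≤ d := gap_nonneg _ _
  -- For `ε ≤ 1` the transferred gap `(1 + ε) * (d + ε) + 2 * ε` is at most `d + ε * (d + 4)`.
  refine le_of_forall_le_add_mul (C := d + 4) fun ε hε hε1 => ?_
  obtain ⟨T', U', hT', hU', hTU⟩ := h.norm_sub_le hbB hcB hT hU hε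
  have hle : kadetsDist B (Quotient.mk (normSetoid 𝕜 V) m) (Quotient.mk (normSetoid 𝕜 V) n) ≤
      gap (LinearMap.range T') (LinearMap.range U') := by
    refine csInf_le ⟨0, ?_⟩ ⟨_, _, ⟨m, T', hT', rfl, rfl⟩, ⟨n, U', hU', rfl, rfl⟩, rfl⟩
    rintro r ⟨T, U, _, _, rfl⟩
    exact gap_nonneg _ _
  have hbound : (1 + ε) * (d + ε) + 2 * ε ≤ d + ε * (d + 4) := by nlinarith
  refine (hle.trans (gap_le (by positivity) (fun x hx hx1 => ?_) (fun x hx hx1 => ?_))).trans hbound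
  · exact exists_mem_range_of_transfer hT hU hT' hU' (lt_add_of_pos_right d hε) hε.le hTU hx hx1
  · refine exists_mem_range_of_transfer hU hT hU' hT'
      (by rw [gap_comm]; exact lt_add_of_pos_right d hε) hε.le (fun y x => ?_) hx hx1
    rw [norm_sub_rev, norm_sub_rev (U y)]
    linarith [hTU x y]

variable [FiniteDimensional 𝕜 V]

/-- A subspace close to the range of `T` contains the range of a perturbation `S` of `T`, and
equality of dimensions makes `S` onto. The norm induced by `S` is the representative sought. -/
theorem exists_near_of_gap_lt (m : NormOn 𝕜 V) {δ : ℝ} (hδ : 0 < δ) :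
    ∃ η > 0, ∀ (U W : Submodule 𝕜 A) (c : BMSpace 𝕜 V),
      HasTau U (Quotient.mk (normSetoid 𝕜 V) m) → HasTau W c → gap U W < η →
      ∃ n, c = Quotient.mk (normSetoid 𝕜 V) n ∧ Near (1 + δ) m n := by
  obtain ⟨r, hr0, hr1, hr2⟩ : ∃ r : ℝ, 0 < r ∧ r ≤ 1 / 2 ∧ 2 * r ≤ δ :=
    ⟨min (1 / 2) (δ / 2), lt_min (by norm_num) (by linarith), min_le_left _ _, by
      linarith [min_le_right (1 / 2) (δ / 2)]⟩
  obtain ⟨η, hη, h⟩ := exists_lift_of_gap_lt (A := A) m hr0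
  refine ⟨η, hη, fun U W c hU hW hUW => ?_⟩
  obtain ⟨T, hT, rfl⟩ := hasTau_mk_iff.1 hU
  obtain ⟨S, hSW, hS⟩ := h T hT W hUW
  have hinj := injective_of_norm_sub_le hT hr1 hS
  have hemb : IsEmb (NormOn.ofInjective S hinj) S := fun x => rfl
  refine ⟨NormOn.ofInjective S hinj, ?_,
    (near_of_norm_sub_le hT hemb hr0.le hr1 hS).mono (by linarith)⟩
  refine hW.unique (hasTau_mk_iff.2 ⟨S, hemb, ?_⟩)
  obtain ⟨n, U', hU', rfl, _⟩ := hW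
  refine Submodule.eq_of_le_of_finrank_eq ?_ ?_
  · rintro _ ⟨x, rfl⟩
    exact hSW x
  · rw [LinearMap.finrank_range_of_inj hinj, LinearMap.finrank_range_of_inj hU'.injective]

variable (V) in
theorem IsFraisse.almostTransitive_grassmannian (hF : IsFraisse 𝕜 F) {k : ℕ}
    (hk : Module.finrank 𝕜 V = k) :
    AlmostTransitive (grassmannian 𝕜 F k) gap isoActGr HasTau (bmIn 𝕜 V F) where
  nonneg := gap_nonneg
  self := gap_self
  symm := gap_comm
  triangle := gap_triangle
  mem_left := by
    rintro W b ⟨m, T, hT, rfl, rfl⟩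
    exact ⟨inferInstance, (LinearMap.finrank_range_of_inj hT.injective).trans hk⟩
  mem_right := by
    rintro W b ⟨m, T, hT, rfl, rfl⟩
    exact ⟨m, ⟨T, hT⟩, rfl⟩
  exists_right := by
    rintro W ⟨hW, hWk⟩
    let e : V ≃ₗ[𝕜] W := LinearEquiv.ofFinrankEq V W (hk.trans hWk.symm)
    have hinj : Function.Injective (W.subtype ∘ₗ e.toLinearMap) :=
      W.injective_subtype.comp e.injective
    refine ⟨_, NormOn.ofInjective _ hinj, W.subtype ∘ₗ e.toLinearMap, fun x => rfl, ?_, rfl⟩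
    rw [LinearMap.range_comp_of_range_eq_top _ e.range, Submodule.range_subtype]
  exists_left := by
    rintro _ ⟨m, ⟨T, hT⟩, rfl⟩
    exact ⟨_, m, T, hT, rfl, rfl⟩
  unique := HasTau.unique
  act_rel := by
    rintro g _ _ ⟨m, T, hT, rfl, rfl⟩
    exact ⟨m, g.toLinearEquiv.toLinearMap ∘ₗ T, fun x => (g.norm_map _).trans (hT x),
      LinearMap.range_comp _ _, rfl⟩
  act_dist := gap_map
  homogeneous := by
    intro U W b hU hW ε hε
    induction b using Quotient.inductionOn with | h m => ?_
    obtain ⟨T, hT, rfl⟩ := hasTau_mk_iff.1 hU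
    obtain ⟨S, hS, rfl⟩ := hasTau_mk_iff.1 hW
    obtain ⟨r, hr0, hr1, hr2⟩ : ∃ r : ℝ, 0 < r ∧ r ≤ 1 / 2 ∧ 4 * r < ε :=
      ⟨min (1 / 2) (ε / 5), lt_min (by norm_num) (by linarith), min_le_left _ _, by
        linarith [min_le_right (1 / 2) (ε / 5)]⟩
    obtain ⟨δ, hδ, h'⟩ := hF.exists_iso V hr0
    obtain ⟨g, hg⟩ := h' m m (near_self m hδ.le) T S hT hS
    refine ⟨g, lt_of_le_of_lt ?_ hr2⟩
    have := gap_range_le (T := g.toLinearEquiv.toLinearMap ∘ₗ T) (U := S) hr0.le hr1 fun x => by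
      have h1 : ‖(g.toLinearEquiv.toLinearMap ∘ₗ T) x‖ = m x := (g.norm_map _).trans (hT x)
      rw [h1]
      exact hg x
    rwa [LinearMap.range_comp] at this
  separated := by
    intro b c hb hc h
    induction b using Quotient.inductionOn with | h m => ?_
    induction c using Quotient.inductionOn with | h n => ?_
    refine mk_norm_eq_of_near fun δ hδ => ?_
    obtain ⟨η, hη, h'⟩ := exists_near_of_gap_lt (A := F) m hδ
    obtain ⟨U, W, hU, hW, hUW⟩ := h η hη
    obtain ⟨n', hn', hnear⟩ := h' U W _ hU hW hUW
    obtain ⟨Δ, rfl⟩ := mk_norm_eq_iff.1 hn'.symm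
    exact ⟨Δ, hnear⟩
  nhds_left := by
    intro b hb O hO
    induction b using Quotient.inductionOn with | h m => ?_
    obtain ⟨δ, hδ, h⟩ := exists_near_subset m (continuous_quotient_mk'.continuousAt hO)
    obtain ⟨η, hη, h'⟩ := exists_near_of_gap_lt (A := F) m hδ
    refine ⟨η, hη, fun U W c hU hW hUW => ?_⟩
    obtain ⟨n, rfl, hn⟩ := h' U W c hU hW hUW
    exact h n hn
  nhds_right := by
    intro b hb ε hε
    induction b using Quotient.inductionOn with | h m => ?_
    obtain ⟨r, hr0, hr1, hr2⟩ : ∃ r : ℝ, 0 < r ∧ r ≤ 1 / 2 ∧ 4 * r < ε :=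
      ⟨min (1 / 2) (ε / 5), lt_min (by norm_num) (by linarith), min_le_left _ _, by
        linarith [min_le_right (1 / 2) (ε / 5)]⟩
    obtain ⟨δ, hδ, h'⟩ := hF.exists_iso V hr0
    refine ⟨_, isOpenMap_mk_norm.image_mem_nhds (near_mem_nhds m (c := 1 + δ) (by linarith)), ?_⟩
    rintro _ ⟨n, hn, rfl⟩ hc
    obtain ⟨T, hT⟩ := mk_mem_bmIn.1 hb
    obtain ⟨S, hS⟩ := mk_mem_bmIn.1 hc
    obtain ⟨g, hg⟩ := h' m n hn T S hT hS
    have hgT : IsEmb m (g.toLinearEquiv.toLinearMap ∘ₗ T) := fun x => (g.norm_map _).trans (hT x)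
    refine ⟨_, _, ⟨m, _, hgT, rfl, rfl⟩, ⟨n, S, hS, rfl, rfl⟩, lt_of_le_of_lt ?_ hr2⟩
    exact gap_range_le hr0.le hr1 fun x => by
      rw [hgT x]
      exact hg x

end Grassmannians

/-! ### Operators `T₀ ∘ T₁*` from the dual and their decompositions -/

section SquareOperators

variable {𝕜 : Type*} [RCLike 𝕜] {V : Type*} [AddCommGroup V] [Module 𝕜 V]
  {A B F : Type*} [NormedAddCommGroup A] [NormedSpace 𝕜 A] [NormedAddCommGroup B]
  [NormedSpace 𝕜 B] [NormedAddCommGroup F] [NormedSpace 𝕜 F]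

theorem mk_mem_pairsIn {p : NormPair 𝕜 V} :
    Quotient.mk (pairSetoid 𝕜 V) p ∈ pairsIn 𝕜 V A ↔
      p.1 ∈ normsIn 𝕜 V A ∧ p.2 ∈ normsIn 𝕜 (Module.Dual 𝕜 V) A := by
  constructor
  · rintro ⟨q, hq, h⟩
    obtain ⟨Δ, rfl⟩ := mk_pair_eq_iff.1 h.symm
    exact ⟨comp_mem_normsIn hq.1 _, comp_mem_normsIn hq.2 _⟩
  · intro h
    exact ⟨p, h, rfl⟩

variable [FiniteDimensional 𝕜 V]

/-- The dual operator `T₁* : A* → V** = V` of `T₁ : V* → A`. -/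
noncomputable def adj (T₁ : Module.Dual 𝕜 V →ₗ[𝕜] A) (g : StrongDual 𝕜 A) : V :=
  (Module.evalEquiv 𝕜 V).symm ((g : A →ₗ[𝕜] 𝕜) ∘ₗ T₁)

@[simp]
theorem apply_adj (T₁ : Module.Dual 𝕜 V →ₗ[𝕜] A) (g : StrongDual 𝕜 A) (f : Module.Dual 𝕜 V) :
    f (adj T₁ g) = g (T₁ f) := by
  simp [adj]

theorem eq_adj_iff {T₁ : Module.Dual 𝕜 V →ₗ[𝕜] A} {g : StrongDual 𝕜 A} {x : V} :
    x = adj T₁ g ↔ ∀ f : Module.Dual 𝕜 V, f x = g (T₁ f) := by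
  rw [adj, LinearEquiv.eq_symm_apply, LinearMap.ext_iff]
  rfl

theorem adj_eq_sum (T₁ : Module.Dual 𝕜 V →ₗ[𝕜] A) (g : StrongDual 𝕜 A) :
    adj T₁ g = ∑ i, g (T₁ ((Module.finBasis 𝕜 V).coord i)) • Module.finBasis 𝕜 V i := by
  conv_lhs => rw [← (Module.finBasis 𝕜 V).sum_repr (adj T₁ g)]
  refine Finset.sum_congr rfl fun i _ => ?_
  rw [← apply_adj]
  rfl

/-- The operator `T₀ ∘ T₁*`. -/
noncomputable def square (T₀ : V →ₗ[𝕜] A) (T₁ : Module.Dual 𝕜 V →ₗ[𝕜] A) :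
    StrongDual 𝕜 A →L[𝕜] A :=
  ∑ i, (ContinuousLinearMap.apply 𝕜 𝕜 (T₁ ((Module.finBasis 𝕜 V).coord i))).smulRight
    (T₀ (Module.finBasis 𝕜 V i))

theorem square_apply (T₀ : V →ₗ[𝕜] A) (T₁ : Module.Dual 𝕜 V →ₗ[𝕜] A) (g : StrongDual 𝕜 A) :
    square T₀ T₁ g =
      ∑ i, g (T₁ ((Module.finBasis 𝕜 V).coord i)) • T₀ (Module.finBasis 𝕜 V i) := by
  simp [square]

theorem isDecomposition_iff {T : StrongDual 𝕜 A →L[𝕜] A} {T₀ : V →ₗ[𝕜] A}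
    {T₁ : Module.Dual 𝕜 V →ₗ[𝕜] A} : IsDecomposition T T₀ T₁ ↔ T = square T₀ T₁ := by
  have h : ∀ g, T₀ (adj T₁ g) = square T₀ T₁ g := fun g => by
    rw [adj_eq_sum, square_apply]
    simp
  constructor
  · intro hT
    ext g
    rw [← h]
    exact hT g
  · rintro rfl g
    exact (h g).symm

theorem isDecomposition_square (T₀ : V →ₗ[𝕜] A) (T₁ : Module.Dual 𝕜 V →ₗ[𝕜] A) :
    IsDecomposition (square T₀ T₁) T₀ T₁ := isDecomposition_iff.2 rfl

/-- The factor `Δ` cancels against the inverse produced by dualizing the second map, so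
decompositions are determined only up to `GL(V)`. -/
theorem IsDecomposition.comp {T : StrongDual 𝕜 A →L[𝕜] A} {T₀ : V →ₗ[𝕜] A}
    {T₁ : Module.Dual 𝕜 V →ₗ[𝕜] A} (h : IsDecomposition T T₀ T₁) (Δ : V ≃ₗ[𝕜] V) :
    IsDecomposition T (T₀ ∘ₗ Δ.toLinearMap) (T₁ ∘ₗ Δ.symm.dualMap.toLinearMap) := by
  intro g
  rw [h g]
  change T₀ (adj T₁ g) = T₀ (Δ (adj _ g))
  congr 1
  refine (eq_adj_iff.2 fun f => ?_).symm
  have h1 : f (Δ (adj (T₁ ∘ₗ Δ.symm.dualMap.toLinearMap) g)) =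
      (f ∘ₗ Δ.toLinearMap) (adj (T₁ ∘ₗ Δ.symm.dualMap.toLinearMap) g) := rfl
  have h2 : Δ.symm.dualMap (f ∘ₗ Δ.toLinearMap) = f := by
    ext x
    simp
  rw [h1, apply_adj, LinearMap.comp_apply, LinearEquiv.coe_coe, h2]

/-- Functionals on `V*` extend along an injective map `T₁ : V* → A`. -/
theorem exists_extension {T₁ : Module.Dual 𝕜 V →ₗ[𝕜] A} (hT₁ : Function.Injective T₁) (x : V)
    {M : ℝ} (hM0 : 0 ≤ M) (hM : ∀ f : Module.Dual 𝕜 V, ‖f x‖ ≤ M * ‖T₁ f‖) :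
    ∃ g : StrongDual 𝕜 A, ‖g‖ ≤ M ∧ adj T₁ g = x := by
  let e := LinearEquiv.ofInjective T₁ hT₁
  let φ : StrongDual 𝕜 (LinearMap.range T₁) :=
    (Module.Dual.eval 𝕜 V x ∘ₗ e.symm.toLinearMap).mkContinuous M fun y => by
      obtain ⟨f, rfl⟩ := e.surjective y
      have : ‖f x‖ ≤ M * ‖e f‖ := hM f
      simpa using this
  obtain ⟨g, hg, hgn⟩ := exists_extension_norm_eq (LinearMap.range T₁) φ
  refine ⟨g, hgn.trans_le (LinearMap.mkContinuous_norm_le _ hM0 _), (eq_adj_iff.2 fun f => ?_).symm⟩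
  have := hg (e f)
  rw [show ((e f : LinearMap.range T₁) : A) = T₁ f from rfl] at this
  rw [this]
  simp [φ]

/-- Injectivity of `T₁` makes `T₁*` surjective, by Hahn–Banach. Hence the range of `T₀ ∘ T₁*` is
that of `T₀`. -/
theorem exists_adj_eq {T₁ : Module.Dual 𝕜 V →ₗ[𝕜] A} (hT₁ : Function.Injective T₁) (x : V) :
    ∃ g : StrongDual 𝕜 A, adj T₁ g = x := by
  obtain ⟨C, hC, h⟩ := exists_linearMap_le (NormOn.ofInjective T₁ hT₁) (Module.Dual.eval 𝕜 V x)
  obtain ⟨g, -, hg⟩ := exists_extension hT₁ x hC.le h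
  exact ⟨g, hg⟩

theorem IsDecomposition.range_le {T : StrongDual 𝕜 A →L[𝕜] A} {T₀ S₀ : V →ₗ[𝕜] A}
    {T₁ S₁ : Module.Dual 𝕜 V →ₗ[𝕜] A} (hT : IsDecomposition T T₀ T₁) (hS : IsDecomposition T S₀ S₁)
    (hT₁ : Function.Injective T₁) : LinearMap.range T₀ ≤ LinearMap.range S₀ := by
  rintro _ ⟨x, rfl⟩
  obtain ⟨g, rfl⟩ := exists_adj_eq hT₁ x
  exact ⟨adj S₁ g, (hS g).symm.trans (hT g)⟩

theorem hasNu₂_mk_iff {T : StrongDual 𝕜 A →L[𝕜] A} {p : NormPair 𝕜 V} :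
    HasNu₂ T (Quotient.mk (pairSetoid 𝕜 V) p) ↔
      ∃ (T₀ : V →ₗ[𝕜] A) (T₁ : Module.Dual 𝕜 V →ₗ[𝕜] A),
        IsEmb p.1 T₀ ∧ IsEmb p.2 T₁ ∧ T = square T₀ T₁ := by
  constructor
  · rintro ⟨q, T₀, T₁, hT₀, hT₁, hT, h⟩
    obtain ⟨Δ, rfl⟩ := mk_pair_eq_iff.1 h.symm
    exact ⟨T₀ ∘ₗ Δ.toLinearMap, T₁ ∘ₗ Δ.symm.dualMap.toLinearMap, fun x => hT₀ (Δ x),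
      fun f => hT₁ (Δ.symm.dualMap f), isDecomposition_iff.1 (hT.comp Δ)⟩
  · rintro ⟨T₀, T₁, hT₀, hT₁, rfl⟩
    exact ⟨p, T₀, T₁, hT₀, hT₁, isDecomposition_square T₀ T₁, rfl⟩

/-- The range of `T` determines `T₀` up to some `Δ`; cancelling the injective `S₀` relates the
adjoints by the same `Δ`. As functionals separate the points of `A`, this determines `S₁` from `T₁`,
so `ν²` is well defined. -/
theorem HasNu₂.unique {T : StrongDual 𝕜 A →L[𝕜] A} {D D' : PairSpace 𝕜 V} (h : HasNu₂ T D)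
    (h' : HasNu₂ T D') : D = D' := by
  obtain ⟨p, T₀, T₁, hT₀, hT₁, hT, rfl⟩ := h
  obtain ⟨q, S₀, S₁, hS₀, hS₁, hS, rfl⟩ := h'
  obtain ⟨Δ, hΔ⟩ := exists_equiv_of_range_eq hT₀.injective hS₀.injective
    (le_antisymm (hT.range_le hS hT₁.injective) (hS.range_le hT hS₁.injective))
  have hadj : ∀ g, adj S₁ g = Δ (adj T₁ g) := fun g => hS₀.injective <| by
    rw [hΔ]
    exact (hS g).symm.trans (hT g)
  have hS₁T₁ : ∀ f, S₁ f = T₁ (f ∘ₗ Δ.toLinearMap) := fun f => by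
    refine (SeparatingDual.eq_iff_forall_dual_eq (R := 𝕜)).2 fun g => ?_
    rw [← apply_adj, hadj, ← apply_adj]
    rfl
  refine mk_pair_eq_iff.2 ⟨Δ, Prod.ext (NormOn.ext_apply fun x => ?_)
    (NormOn.ext_apply fun f => ?_)⟩
  · rw [← hT₀, ← hΔ, hS₀]
    rfl
  · have h1 : (pairComp q Δ).2 f = ‖S₁ (Δ.symm.dualMap f)‖ := (hS₁ _).symm
    rw [h1, hS₁T₁, ← hT₁]
    congr 2
    ext x
    simp

theorem norm_isoActSquare_le (gh : (A ≃ₗᵢ[𝕜] A) × (A ≃ₗᵢ[𝕜] A)) (T : StrongDual 𝕜 A →L[𝕜] A) :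
    ‖isoActSquare gh T‖ ≤ ‖T‖ := by
  refine ContinuousLinearMap.opNorm_le_bound _ (norm_nonneg T) fun f => ?_
  have h1 : ‖isoActSquare gh T f‖ = ‖T (f ∘L (gh.2.toContinuousLinearEquiv : A →L[𝕜] A))‖ :=
    gh.1.norm_map _
  rw [h1]
  refine (T.le_opNorm _).trans (mul_le_mul_of_nonneg_left ?_ (norm_nonneg _))
  refine ContinuousLinearMap.opNorm_le_bound _ (norm_nonneg f) fun x => ?_
  refine (f.le_opNorm _).trans (le_of_eq ?_)
  congr 1
  exact gh.2.norm_map x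

theorem isoActSquare_symm (gh : (A ≃ₗᵢ[𝕜] A) × (A ≃ₗᵢ[𝕜] A)) (T : StrongDual 𝕜 A →L[𝕜] A) :
    isoActSquare (gh.1.symm, gh.2.symm) (isoActSquare gh T) = T := by
  ext f
  have h1 : isoActSquare (gh.1.symm, gh.2.symm) (isoActSquare gh T) f =
      gh.1.symm (gh.1 (T ((f ∘L (gh.2.symm.toContinuousLinearEquiv : A →L[𝕜] A)) ∘L
        (gh.2.toContinuousLinearEquiv : A →L[𝕜] A)))) := rfl
  rw [h1, LinearIsometryEquiv.symm_apply_apply]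
  congr 1
  ext x
  simp

/-- The action is contractive and so is its inverse. -/
theorem norm_isoActSquare_sub (gh : (A ≃ₗᵢ[𝕜] A) × (A ≃ₗᵢ[𝕜] A))
    (T U : StrongDual 𝕜 A →L[𝕜] A) : ‖isoActSquare gh T - isoActSquare gh U‖ = ‖T - U‖ := by
  have h : isoActSquare gh T - isoActSquare gh U = isoActSquare gh (T - U) := by
    ext f
    simp [isoActSquare]
  rw [h]
  refine le_antisymm (norm_isoActSquare_le _ _) ?_
  conv_lhs => rw [← isoActSquare_symm gh (T - U)]
  exact norm_isoActSquare_le _ _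

theorem IsDecomposition.isoActSquare {T : StrongDual 𝕜 A →L[𝕜] A} {T₀ : V →ₗ[𝕜] A}
    {T₁ : Module.Dual 𝕜 V →ₗ[𝕜] A} (h : IsDecomposition T T₀ T₁)
    (gh : (A ≃ₗᵢ[𝕜] A) × (A ≃ₗᵢ[𝕜] A)) :
    IsDecomposition (isoActSquare gh T) (gh.1.toLinearEquiv.toLinearMap ∘ₗ T₀)
      (gh.2.toLinearEquiv.toLinearMap ∘ₗ T₁) := fun f =>
  congrArg gh.1 (h (f ∘L (gh.2.toContinuousLinearEquiv : A →L[𝕜] A)))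

theorem norm_square_sub_le {T₀ U₀ : V →ₗ[𝕜] A} {T₁ U₁ : Module.Dual 𝕜 V →ₗ[𝕜] A} {M ε : ℝ}
    (hM : 0 ≤ M) (hε : 0 ≤ ε) (hε1 : ε ≤ 1)
    (h : ∀ i, ‖T₀ (Module.finBasis 𝕜 V i)‖ ≤ M ∧ ‖T₁ ((Module.finBasis 𝕜 V).coord i)‖ ≤ M ∧
      ‖T₀ (Module.finBasis 𝕜 V i) - U₀ (Module.finBasis 𝕜 V i)‖ ≤ ε * M ∧
      ‖T₁ ((Module.finBasis 𝕜 V).coord i) - U₁ ((Module.finBasis 𝕜 V).coord i)‖ ≤ ε * M) :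
    ‖square T₀ T₁ - square U₀ U₁‖ ≤ ε * (3 * Module.finrank 𝕜 V * (M * M)) := by
  refine ContinuousLinearMap.opNorm_le_bound _ (by positivity) fun g => ?_
  rw [sub_apply, square_apply, square_apply, ← Finset.sum_sub_distrib]
  refine (norm_sum_le _ _).trans ?_
  have key : ∀ i ∈ Finset.univ, ‖g (T₁ ((Module.finBasis 𝕜 V).coord i)) •
      T₀ (Module.finBasis 𝕜 V i) - g (U₁ ((Module.finBasis 𝕜 V).coord i)) •
      U₀ (Module.finBasis 𝕜 V i)‖ ≤ ε * (3 * (M * M)) * ‖g‖ := by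
    intro i _
    obtain ⟨h1, h2, h3, h4⟩ := h i
    set x := T₀ (Module.finBasis 𝕜 V i)
    set x' := U₀ (Module.finBasis 𝕜 V i)
    set y := T₁ ((Module.finBasis 𝕜 V).coord i)
    set y' := U₁ ((Module.finBasis 𝕜 V).coord i)
    -- Product rule: the first term costs `ε * M * M` and the second twice that, since `‖x'‖ ≤ 2 *
    -- M`; hence the factor `3`.
    have h5 : g y • x - g y' • x' = g y • (x - x') + g (y - y') • x' := by
      rw [map_sub, smul_sub, sub_smul]
      abel
    have hx' : ‖x'‖ ≤ 2 * M := by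
      have := norm_sub_norm_le x' x
      rw [norm_sub_rev] at this
      nlinarith
    have h6 : ‖g y • (x - x')‖ ≤ (‖g‖ * M) * (ε * M) := by
      rw [norm_smul]
      exact mul_le_mul (g.le_opNorm_of_le h2) h3 (norm_nonneg _) (by positivity)
    have h7 : ‖g (y - y') • x'‖ ≤ (‖g‖ * (ε * M)) * (2 * M) := by
      rw [norm_smul]
      exact mul_le_mul (g.le_opNorm_of_le h4) hx' (norm_nonneg _) (by positivity)
    rw [h5]
    refine (norm_add_le _ _).trans ((add_le_add h6 h7).trans (le_of_eq ?_))
    ring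
  refine (Finset.sum_le_sum key).trans (le_of_eq ?_)
  rw [Finset.sum_const, Finset.card_univ, Fintype.card_fin, nsmul_eq_mul]
  ring

/-- The map `θ₁` lives only on `W₁`, so `g ∘ θ₁` is extended to a functional `f` on `A` by
Hahn–Banach. The new operator at `g` is `θ₀` of the old one at `f`, and `θ₀`, `θ₁` contribute one
factor `c` each. -/
theorem norm_square_comp_sub_le {W₀ W₁ : Submodule 𝕜 A} {θ₀ : W₀ →ₗ[𝕜] B} {θ₁ : W₁ →ₗ[𝕜] B}
    {c : ℝ} (hc : 0 ≤ c) (hθ₀ : ∀ w, ‖θ₀ w‖ ≤ c * ‖w‖) (hθ₁ : ∀ w, ‖θ₁ w‖ ≤ c * ‖w‖)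
    (T₀ U₀ : V →ₗ[𝕜] W₀) (T₁ U₁ : Module.Dual 𝕜 V →ₗ[𝕜] W₁) :
    ‖square (θ₀ ∘ₗ T₀) (θ₁ ∘ₗ T₁) - square (θ₀ ∘ₗ U₀) (θ₁ ∘ₗ U₁)‖ ≤
      c * c * ‖square (W₀.subtype ∘ₗ T₀) (W₁.subtype ∘ₗ T₁) -
        square (W₀.subtype ∘ₗ U₀) (W₁.subtype ∘ₗ U₁)‖ := by
  refine ContinuousLinearMap.opNorm_le_bound _ (by positivity) fun g => ?_
  let φ : StrongDual 𝕜 W₁ := ((g : B →ₗ[𝕜] 𝕜) ∘ₗ θ₁).mkContinuous (‖g‖ * c) fun w => by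
    rw [mul_assoc]
    exact g.le_opNorm_of_le (hθ₁ w)
  obtain ⟨f, hf, hfn⟩ := exists_extension_norm_eq W₁ φ
  have hfn' : ‖f‖ ≤ ‖g‖ * c := hfn.trans_le (LinearMap.mkContinuous_norm_le _ (by positivity) _)
  have hfg : ∀ w : W₁, f w = g (θ₁ w) := hf
  set z : W₀ := ∑ i, (g (θ₁ (T₁ ((Module.finBasis 𝕜 V).coord i))) • T₀ (Module.finBasis 𝕜 V i) -
    g (θ₁ (U₁ ((Module.finBasis 𝕜 V).coord i))) • U₀ (Module.finBasis 𝕜 V i)) with hz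
  have h1 : (square (θ₀ ∘ₗ T₀) (θ₁ ∘ₗ T₁) - square (θ₀ ∘ₗ U₀) (θ₁ ∘ₗ U₁)) g = θ₀ z := by
    rw [sub_apply, square_apply, square_apply, hz, map_sum,
      ← Finset.sum_sub_distrib]
    simp
  have h2 : (square (W₀.subtype ∘ₗ T₀) (W₁.subtype ∘ₗ T₁) -
      square (W₀.subtype ∘ₗ U₀) (W₁.subtype ∘ₗ U₁)) f = z := by
    rw [sub_apply, square_apply, square_apply, hz,
      ← Finset.sum_sub_distrib]
    simp [hfg]
  rw [h1]
  refine (hθ₀ z).trans ?_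
  rw [show ‖z‖ = ‖(z : A)‖ from rfl, ← h2]
  calc _ ≤ c * (_ * (‖g‖ * c)) := mul_le_mul_of_nonneg_left
        (ContinuousLinearMap.le_opNorm_of_le _ hfn') hc
    _ = _ := by ring

/-- The constant `M` controls the two norms of the pair `p` in terms of a fixed basis. -/
def IsReg (M : ℝ) (p : NormPair 𝕜 V) : Prop :=
  ∀ i, p.1 (Module.finBasis 𝕜 V i) ≤ M ∧ p.2 ((Module.finBasis 𝕜 V).coord i) ≤ M ∧
    (∀ x, ‖(Module.finBasis 𝕜 V).coord i x‖ ≤ M * p.1 x) ∧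
    ∀ f : Module.Dual 𝕜 V, ‖f (Module.finBasis 𝕜 V i)‖ ≤ M * p.2 f

theorem IsReg.mono {M M' : ℝ} {p : NormPair 𝕜 V} (h : IsReg M p) (hM : M ≤ M') : IsReg M' p :=
  fun i => ⟨(h i).1.trans hM, (h i).2.1.trans hM,
    fun x => ((h i).2.2.1 x).trans (mul_le_mul_of_nonneg_right hM (p.1.nonneg x)),
    fun f => ((h i).2.2.2 f).trans (mul_le_mul_of_nonneg_right hM (p.2.nonneg f))⟩

theorem IsReg.of_near {M K : ℝ} {p q : NormPair 𝕜 V} (h : IsReg M p) (hM : 0 ≤ M) (hK : 0 ≤ K)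
    (h1 : Near K p.1 q.1) (h2 : Near K p.2 q.2) : IsReg (M * K) q := by
  refine fun i => ⟨?_, ?_, fun x => ?_, fun f => ?_⟩
  · exact ((h1 _).1.trans (mul_le_mul_of_nonneg_left (h i).1 hK)).trans_eq (mul_comm _ _)
  · exact ((h2 _).1.trans (mul_le_mul_of_nonneg_left (h i).2.1 hK)).trans_eq (mul_comm _ _)
  · rw [mul_assoc]
    exact ((h i).2.2.1 x).trans (mul_le_mul_of_nonneg_left (h1 x).2 hM)
  · rw [mul_assoc]
    exact ((h i).2.2.2 f).trans (mul_le_mul_of_nonneg_left (h2 f).2 hM)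

theorem exists_isReg (p : NormPair 𝕜 V) : ∃ M : ℝ, 0 ≤ M ∧ IsReg M p := by
  obtain ⟨M₁, hM₁, h₁⟩ := exists_coord_bound p.1
  choose C hC hCx using fun i =>
    exists_linearMap_le p.2 (Module.Dual.eval 𝕜 V (Module.finBasis 𝕜 V i))
  have h1 : ∀ i, C i ≤ ∑ i, C i := fun i =>
    Finset.single_le_sum (f := C) (fun j _ => (hC j).le) (Finset.mem_univ i)
  have h2 : ∀ i, p.2 ((Module.finBasis 𝕜 V).coord i) ≤ ∑ i, p.2 ((Module.finBasis 𝕜 V).coord i) :=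
    fun i => Finset.single_le_sum (f := fun i => p.2 ((Module.finBasis 𝕜 V).coord i))
      (fun j _ => p.2.nonneg _) (Finset.mem_univ i)
  have h3 : 0 ≤ ∑ i, C i := Finset.sum_nonneg fun i _ => (hC i).le
  have h4 : 0 ≤ ∑ i, p.2 ((Module.finBasis 𝕜 V).coord i) :=
    Finset.sum_nonneg fun i _ => p.2.nonneg _
  refine ⟨M₁ + ∑ i, C i + ∑ i, p.2 ((Module.finBasis 𝕜 V).coord i), by linarith, fun i =>
    ⟨?_, ?_, fun x => ?_, fun f => ?_⟩⟩
  · linarith [(h₁ i).1]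
  · linarith [h2 i]
  · exact ((h₁ i).2 x).trans (mul_le_mul_of_nonneg_right (by linarith) (p.1.nonneg x))
  · exact (hCx i f).trans (mul_le_mul_of_nonneg_right (by linarith [h1 i]) (p.2.nonneg f))

theorem IsReg.norm_square_sub_le {M ε : ℝ} {p : NormPair 𝕜 V} (h : IsReg M p) (hM : 0 ≤ M)
    (hε : 0 ≤ ε) (hε1 : ε ≤ 1) {T₀ U₀ : V →ₗ[𝕜] A} {T₁ U₁ : Module.Dual 𝕜 V →ₗ[𝕜] A}
    (hT₀ : IsEmb p.1 T₀) (hT₁ : IsEmb p.2 T₁) (h₀ : ∀ x, ‖T₀ x - U₀ x‖ ≤ ε * p.1 x)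
    (h₁ : ∀ f, ‖T₁ f - U₁ f‖ ≤ ε * p.2 f) :
    ‖square T₀ T₁ - square U₀ U₁‖ ≤ ε * (3 * Module.finrank 𝕜 V * (M * M)) :=
  OrbitMetrics.norm_square_sub_le hM hε hε1 fun i =>
    ⟨(hT₀ _).trans_le (h i).1, (hT₁ _).trans_le (h i).2.1,
      (h₀ _).trans (mul_le_mul_of_nonneg_left (h i).1 hε),
      (h₁ _).trans (mul_le_mul_of_nonneg_left (h i).2.1 hε)⟩

theorem IsReg.norm_apply_le {M : ℝ} {p : NormPair 𝕜 V} (h : IsReg M p) (hM : 0 ≤ M) (x : V)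
    (f : Module.Dual 𝕜 V) : ‖f x‖ ≤ Module.finrank 𝕜 V * (M * M) * (p.1 x * p.2 f) := by
  have hx : f x = ∑ i, (Module.finBasis 𝕜 V).coord i x • f (Module.finBasis 𝕜 V i) := by
    simp only [Module.Basis.coord_apply, ← map_smul, ← map_sum, (Module.finBasis 𝕜 V).sum_repr]
  rw [hx]
  refine (norm_sum_le _ _).trans ?_
  have key : ∀ i ∈ Finset.univ, ‖(Module.finBasis 𝕜 V).coord i x • f (Module.finBasis 𝕜 V i)‖ ≤
      (M * p.1 x) * (M * p.2 f) := fun i _ => by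
    rw [norm_smul]
    exact mul_le_mul ((h i).2.2.1 x) ((h i).2.2.2 f) (norm_nonneg _)
      (mul_nonneg hM (p.1.nonneg x))
  refine (Finset.sum_le_sum key).trans (le_of_eq ?_)
  rw [Finset.sum_const, Finset.card_univ, Fintype.card_fin, nsmul_eq_mul]
  ring

theorem IsReg.adj_le {M : ℝ} {p : NormPair 𝕜 V} (h : IsReg M p) (hM : 0 ≤ M)
    {T₁ : Module.Dual 𝕜 V →ₗ[𝕜] A} (hT₁ : IsEmb p.2 T₁) (g : StrongDual 𝕜 A) :
    p.1 (adj T₁ g) ≤ Module.finrank 𝕜 V * (M * M) * ‖g‖ := by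
  rw [adj_eq_sum]
  refine (p.1.sum_le _ _).trans ?_
  have key : ∀ i ∈ Finset.univ, p.1 (g (T₁ ((Module.finBasis 𝕜 V).coord i)) •
      Module.finBasis 𝕜 V i) ≤ (‖g‖ * M) * M := fun i _ => by
    rw [p.1.smul_eq]
    exact mul_le_mul (g.le_opNorm_of_le ((hT₁ _).trans_le (h i).2.1)) (h i).1 (p.1.nonneg _)
      (by positivity)
  refine (Finset.sum_le_sum key).trans (le_of_eq ?_)
  rw [Finset.sum_const, Finset.card_univ, Fintype.card_fin, nsmul_eq_mul]
  ring

/-- Classes of operators close to an operator of class `[p]` have representatives close to `p`. -/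
theorem exists_near_of_norm_square_sub_lt {M δ : ℝ} (hM : 0 ≤ M) (hδ : 0 < δ) :
    ∃ η > 0, ∀ (p : NormPair 𝕜 V) (D : PairSpace 𝕜 V) (T U : StrongDual 𝕜 A →L[𝕜] A), IsReg M p →
      HasNu₂ T (Quotient.mk (pairSetoid 𝕜 V) p) → HasNu₂ U D → ‖T - U‖ < η →
      ∃ q, D = Quotient.mk (pairSetoid 𝕜 V) q ∧ Near (1 + δ) p.1 q.1 ∧ Near (1 + δ) p.2 q.2 := by
  set N : ℝ := Module.finrank 𝕜 V * (M * M) with hN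
  have hN0 : 0 ≤ N := by positivity
  obtain ⟨c, hc0, hc1, hc2⟩ : ∃ c : ℝ, 0 < c ∧ c ≤ 1 / 2 ∧ 2 * c ≤ δ :=
    ⟨min (1 / 2) (δ / 2), lt_min (by norm_num) (by linarith), min_le_left _ _, by
      linarith [min_le_right (1 / 2) (δ / 2)]⟩
  -- This bound is the final estimate for the second maps; it also forces `N * η ≤ c`, which is
  -- needed for the first maps.
  obtain ⟨η, hη, hη2⟩ : ∃ η : ℝ, 0 < η ∧ 2 * N * (η + N * η * N) ≤ c := by
    have hpos : 0 < 2 * N * (1 + N * N) + 1 := by positivity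
    refine ⟨c / (2 * N * (1 + N * N) + 1), by positivity, ?_⟩
    have : 2 * N * (c / (2 * N * (1 + N * N) + 1) + N * (c / (2 * N * (1 + N * N) + 1)) * N) =
        c * (2 * N * (1 + N * N)) / (2 * N * (1 + N * N) + 1) := by ring
    rw [this, div_le_iff₀ hpos]
    nlinarith
  have hη1 : N * η ≤ c := by
    have : 0 ≤ N * η := by positivity
    nlinarith [mul_nonneg this (mul_nonneg hN0 hN0)]
  refine ⟨η, hη, fun p D T U hp hT hU hTU => ?_⟩
  obtain ⟨T₀, T₁, hT₀, hT₁, rfl⟩ := hasNu₂_mk_iff.1 hT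
  have hTdec := isDecomposition_square T₀ T₁
  obtain ⟨q, U₀, U₁, hU₀, hU₁, hUdec, rfl⟩ := hU
  have hTU' : ∀ g, ‖square T₀ T₁ g - U g‖ ≤ η * ‖g‖ := fun g =>
    (square T₀ T₁ - U).le_of_opNorm_le hTU.le g
  -- Each basis vector is lifted through `T₁*` to a functional of norm at most `M`. Sending it to
  -- the value of `U₁*` at that functional defines `Δ₀`, for which `U₀ ∘ Δ₀` and `T₀` are values of
  -- the two close operators.
  choose g hgM hg using fun i => exists_extension hT₁.injective (Module.finBasis 𝕜 V i) hM
    fun f => ((hp i).2.2.2 f).trans_eq (by rw [hT₁ f])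
  let Δ₀ : V →ₗ[𝕜] V := (Module.finBasis 𝕜 V).constr 𝕜 fun i => adj U₁ (g i)
  have hS : ∀ i, ‖(U₀ ∘ₗ Δ₀) (Module.finBasis 𝕜 V i) - T₀ (Module.finBasis 𝕜 V i)‖ ≤ η * M := by
    intro i
    have h1 : (U₀ ∘ₗ Δ₀) (Module.finBasis 𝕜 V i) = U (g i) := by
      rw [LinearMap.comp_apply, show Δ₀ (Module.finBasis 𝕜 V i) = adj U₁ (g i) from
        (Module.finBasis 𝕜 V).constr_basis 𝕜 _ i]
      exact (hUdec (g i)).symm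
    have h2 : T₀ (Module.finBasis 𝕜 V i) = square T₀ T₁ (g i) := by
      conv_lhs => rw [← hg i]
      exact (hTdec (g i)).symm
    rw [h1, h2, norm_sub_rev]
    exact (hTU' _).trans (mul_le_mul_of_nonneg_left (hgM i) hη.le)
  have hS' : ∀ x, ‖(U₀ ∘ₗ Δ₀) x - T₀ x‖ ≤ (N * η) * p.1 x := fun x => by
    refine (norm_sub_le_of_basis (fun i => (hp i).2.2.1) hS x).trans_eq ?_
    rw [hN]
    ring
  have hinj : Function.Injective Δ₀ := by
    have := injective_of_norm_sub_le hT₀ (hη1.trans hc1) hS'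
    rw [LinearMap.coe_comp] at this
    exact this.of_comp
  let Δ : V ≃ₗ[𝕜] V := LinearEquiv.ofInjectiveEndo Δ₀ hinj
  have hV₀ : IsEmb (pairComp q Δ).1 (U₀ ∘ₗ Δ₀) := fun x => hU₀ (Δ x)
  have hV₁ : IsEmb (pairComp q Δ).2 (U₁ ∘ₗ Δ.symm.dualMap.toLinearMap) :=
    fun f => hU₁ (Δ.symm.dualMap f)
  have hVdec : IsDecomposition U (U₀ ∘ₗ Δ₀) (U₁ ∘ₗ Δ.symm.dualMap.toLinearMap) := hUdec.comp Δ
  refine ⟨pairComp q Δ, mk_pair_eq_iff.2 ⟨Δ.symm, ?_⟩, ?_, ?_⟩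
  · refine Prod.ext (NormOn.ext_apply fun x => ?_) (NormOn.ext_apply fun f => ?_)
    · simp [pairComp]
    · simp only [pairComp, NormOn.comp_apply]
      congr 1
      ext x
      simp
  · exact (near_of_norm_sub_le hT₀ hV₀ (by positivity) (hη1.trans hc1) hS').mono (by linarith)
  · refine (near_of_norm_sub_le hT₁ hV₁ hc0.le hc1 fun f => ?_).mono (by linarith)
    have hp2 := p.2.nonneg f
    -- Testing on `h` turns the difference of the second maps into `f (y - x)`, with `x` and `y` the
    -- two adjoints at `h`. Now `T₀ x` and `V₀ y` are close as values of the operators at `h`, and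
    -- `V₀ y` is close to `T₀ y`, so `y - x` is small once the term `p.1 (y - x)` hidden in `p.1 y`
    -- is absorbed.
    refine NormedSpace.norm_le_dual_bound 𝕜 _ (mul_nonneg hc0.le hp2) fun h => ?_
    set V₀ := U₀ ∘ₗ Δ₀
    set V₁ := U₁ ∘ₗ Δ.symm.dualMap.toLinearMap
    set x := adj T₁ h
    set y := adj V₁ h
    have h1 : h (V₁ f - T₁ f) = f (y - x) := by
      rw [map_sub, map_sub, apply_adj, apply_adj]
    have h2 : p.1 (y - x) ≤ η * ‖h‖ + (N * η) * p.1 y := by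
      have h3 : ‖T₀ (y - x)‖ ≤ ‖V₀ y - T₀ y‖ + ‖square T₀ T₁ h - U h‖ := by
        have h4 : T₀ (y - x) = -(V₀ y - T₀ y) - (square T₀ T₁ h - U h) := by
          rw [show square T₀ T₁ h = T₀ x from hTdec h, show U h = V₀ y from hVdec h, map_sub]
          abel
        rw [h4]
        refine (norm_sub_le _ _).trans ?_
        rw [norm_neg]
      rw [hT₀] at h3
      linarith [hS' y, hTU' h]
    have h5 : p.1 x ≤ N * ‖h‖ := hp.adj_le hM hT₁ h
    have h6 := p.1.le_add_sub y x
    have h7 := p.1.nonneg (y - x)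
    have h8 : 0 ≤ N * η := by positivity
    have h9 : p.1 (y - x) ≤ 2 * (η + N * η * N) * ‖h‖ := by
      have h10 := mul_le_mul_of_nonneg_left h6 h8
      have h11 := mul_le_mul_of_nonneg_left h5 h8
      have h12 := mul_le_mul_of_nonneg_right (hη1.trans hc1) h7
      nlinarith
    rw [h1]
    refine (hp.norm_apply_le hM _ _).trans ?_
    rw [← hN]
    have h13 := mul_le_mul_of_nonneg_right h9 hp2
    have h14 := mul_le_mul_of_nonneg_left h13 hN0
    have h15 := mul_le_mul_of_nonneg_right hη2 (mul_nonneg hp2 (norm_nonneg h))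
    linarith

end SquareOperators

/-! ### The function `𝔡` and the quotient metric of `ω₂` -/

section SquareDistance

variable {𝕜 : Type*} [RCLike 𝕜] {V : Type*} [AddCommGroup V] [Module 𝕜 V] [FiniteDimensional 𝕜 V]
  {A B F : Type*} [NormedAddCommGroup A] [NormedSpace 𝕜 A] [NormedAddCommGroup B]
  [NormedSpace 𝕜 B] [NormedAddCommGroup F] [NormedSpace 𝕜 F]

variable (V) in
-- The two isometries act independently, so the Fraïssé property is used once for `V` and once for
-- its dual.
theorem IsFraisse.exists_norm_square_sub_lt (hF : IsFraisse 𝕜 F) {M ε : ℝ} (hM : 0 ≤ M)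
    (hε : 0 < ε) :
    ∃ δ > 0, ∀ p q : NormPair 𝕜 V, IsReg M p → Near (1 + δ) p.1 q.1 → Near (1 + δ) p.2 q.2 →
      ∀ (T₀ U₀ : V →ₗ[𝕜] F) (T₁ U₁ : Module.Dual 𝕜 V →ₗ[𝕜] F), IsEmb p.1 T₀ → IsEmb q.1 U₀ →
      IsEmb p.2 T₁ → IsEmb q.2 U₁ → ∃ gh : (F ≃ₗᵢ[𝕜] F) × (F ≃ₗᵢ[𝕜] F),
        ‖isoActSquare gh (square T₀ T₁) - square U₀ U₁‖ < ε := by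
  set N : ℝ := 3 * Module.finrank 𝕜 V * (M * M) with hN
  have hN0 : 0 ≤ N := by positivity
  obtain ⟨r, hr0, hr1, hr2⟩ : ∃ r : ℝ, 0 < r ∧ r ≤ 1 ∧ r * (N + 1) ≤ ε := by
    refine ⟨min 1 (ε / (N + 1)), lt_min one_pos (by positivity), min_le_left _ _, ?_⟩
    rw [← le_div_iff₀ (by linarith)]
    exact min_le_right _ _
  obtain ⟨δ, hδ, h⟩ := hF.exists_iso V hr0
  obtain ⟨δ', hδ', h'⟩ := hF.exists_iso (Module.Dual 𝕜 V) hr0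
  refine ⟨min δ δ', lt_min hδ hδ', fun p q hp h1 h2 T₀ U₀ T₁ U₁ hT₀ hU₀ hT₁ hU₁ => ?_⟩
  obtain ⟨g, hg⟩ := h p.1 q.1 (h1.mono (by linarith [min_le_left δ δ'])) T₀ U₀ hT₀ hU₀
  obtain ⟨g', hg'⟩ := h' p.2 q.2 (h2.mono (by linarith [min_le_right δ δ'])) T₁ U₁ hT₁ hU₁
  refine ⟨(g, g'), ?_⟩
  rw [isDecomposition_iff.1 ((isDecomposition_square T₀ T₁).isoActSquare (g, g'))]
  refine (hp.norm_square_sub_le hM hr0.le hr1 (fun x => (g.norm_map _).trans (hT₀ x))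
    (fun f => (g'.norm_map _).trans (hT₁ f)) hg hg').trans_lt ?_
  rw [← hN]
  linarith

theorem HasNu₂.isoActSquare {T : StrongDual 𝕜 A →L[𝕜] A} {D : PairSpace 𝕜 V} (h : HasNu₂ T D)
    (gh : (A ≃ₗᵢ[𝕜] A) × (A ≃ₗᵢ[𝕜] A)) : HasNu₂ (isoActSquare gh T) D := by
  obtain ⟨p, T₀, T₁, hT₀, hT₁, hT, rfl⟩ := h
  exact ⟨p, _, _, fun x => (gh.1.norm_map _).trans (hT₀ x),
    fun f => (gh.2.norm_map _).trans (hT₁ f), hT.isoActSquare gh, rfl⟩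

theorem hasNu₂_square {p : NormPair 𝕜 V} {T₀ : V →ₗ[𝕜] A} {T₁ : Module.Dual 𝕜 V →ₗ[𝕜] A}
    (hT₀ : IsEmb p.1 T₀) (hT₁ : IsEmb p.2 T₁) :
    HasNu₂ (square T₀ T₁) (Quotient.mk (pairSetoid 𝕜 V) p) :=
  hasNu₂_mk_iff.2 ⟨T₀, T₁, hT₀, hT₁, rfl⟩

variable (V) in
theorem IsFraisse.exists_hasNu₂_norm_sub_lt (hF : IsFraisse 𝕜 F) {M ε : ℝ} (hM : 0 ≤ M)
    (hε : 0 < ε) :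
    ∃ δ > 0, ∀ p q : NormPair 𝕜 V, Quotient.mk (pairSetoid 𝕜 V) p ∈ pairsIn 𝕜 V F →
      Quotient.mk (pairSetoid 𝕜 V) q ∈ pairsIn 𝕜 V F → IsReg M p → Near (1 + δ) p.1 q.1 →
      Near (1 + δ) p.2 q.2 → ∃ T U : StrongDual 𝕜 F →L[𝕜] F,
        HasNu₂ T (Quotient.mk (pairSetoid 𝕜 V) p) ∧ HasNu₂ U (Quotient.mk (pairSetoid 𝕜 V) q) ∧
        ‖T - U‖ < ε := by
  obtain ⟨δ, hδ, h⟩ := hF.exists_norm_square_sub_lt V hM hε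
  refine ⟨δ, hδ, fun p q hp hq hreg h1 h2 => ?_⟩
  obtain ⟨⟨T₀, hT₀⟩, ⟨T₁, hT₁⟩⟩ := mk_mem_pairsIn.1 hp
  obtain ⟨⟨U₀, hU₀⟩, ⟨U₁, hU₁⟩⟩ := mk_mem_pairsIn.1 hq
  obtain ⟨gh, hgh⟩ := h p q hreg h1 h2 T₀ U₀ T₁ U₁ hT₀ hU₀ hT₁ hU₁
  exact ⟨_, _, (hasNu₂_square hT₀ hT₁).isoActSquare gh, hasNu₂_square hU₀ hU₁, hgh⟩

variable (V) in
theorem IsFraisse.almostTransitive_weakStarOps (hF : IsFraisse 𝕜 F) :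
    AlmostTransitive (weakStarOps 𝕜 V F) (fun T U => ‖T - U‖) isoActSquare HasNu₂
      (pairsIn 𝕜 V F) where
  nonneg T U := norm_nonneg (T - U)
  self T := by
    rw [sub_self T]
    exact norm_zero (E := StrongDual 𝕜 F →L[𝕜] F)
  symm T U := norm_sub_rev T U
  triangle T U S := norm_sub_le_norm_sub_add_norm_sub T U S
  mem_left := by
    rintro T _ ⟨p, T₀, T₁, hT₀, hT₁, hT, rfl⟩
    exact ⟨T₀, T₁, hT₀.injective, hT₁.injective, hT⟩
  mem_right := by
    rintro T _ ⟨p, T₀, T₁, hT₀, hT₁, hT, rfl⟩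
    exact ⟨p, ⟨⟨T₀, hT₀⟩, ⟨T₁, hT₁⟩⟩, rfl⟩
  exists_right := by
    rintro T ⟨T₀, T₁, hT₀, hT₁, hT⟩
    exact ⟨_, (NormOn.ofInjective T₀ hT₀, NormOn.ofInjective T₁ hT₁), T₀, T₁, fun _ => rfl,
      fun _ => rfl, hT, rfl⟩
  exists_left := by
    rintro _ ⟨p, ⟨⟨T₀, hT₀⟩, ⟨T₁, hT₁⟩⟩, rfl⟩
    exact ⟨_, hasNu₂_square hT₀ hT₁⟩
  unique := HasNu₂.unique
  act_rel gh _ _ h := h.isoActSquare gh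
  act_dist := norm_isoActSquare_sub
  homogeneous := by
    intro T U D hT hU ε hε
    induction D using Quotient.inductionOn with | h p => ?_
    obtain ⟨T₀, T₁, hT₀, hT₁, rfl⟩ := hasNu₂_mk_iff.1 hT
    obtain ⟨U₀, U₁, hU₀, hU₁, rfl⟩ := hasNu₂_mk_iff.1 hU
    obtain ⟨M, hM, hp⟩ := exists_isReg p
    obtain ⟨δ, hδ, h⟩ := hF.exists_norm_square_sub_lt V hM hε
    exact h p p hp (near_self _ hδ.le) (near_self _ hδ.le) T₀ U₀ T₁ U₁ hT₀ hU₀ hT₁ hU₁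
  separated := by
    intro D D' _ _ h
    induction D using Quotient.inductionOn with | h p => ?_
    induction D' using Quotient.inductionOn with | h q => ?_
    obtain ⟨M, hM, hp⟩ := exists_isReg p
    refine mk_pair_eq_of_near fun δ hδ => ?_
    obtain ⟨η, hη, h'⟩ := exists_near_of_norm_square_sub_lt (𝕜 := 𝕜) (V := V) (A := F) hM hδ
    obtain ⟨T, U, hT, hU, hTU⟩ := h η hη
    obtain ⟨q', hq', h1, h2⟩ := h' p _ T U hp hT hU hTU
    obtain ⟨Δ, rfl⟩ := mk_pair_eq_iff.1 hq'.symm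
    exact ⟨Δ, h1, h2⟩
  nhds_left := by
    intro D _ O hO
    induction D using Quotient.inductionOn with | h p => ?_
    obtain ⟨O₁, hO₁, O₂, hO₂, hsub⟩ := mem_nhds_prod_iff.1
      (continuous_quotient_mk'.continuousAt hO : _ ∈ 𝓝 p)
    obtain ⟨δ₁, hδ₁, h₁⟩ := exists_near_subset p.1 hO₁
    obtain ⟨δ₂, hδ₂, h₂⟩ := exists_near_subset p.2 hO₂
    obtain ⟨M, hM, hp⟩ := exists_isReg p
    obtain ⟨η, hη, h'⟩ := exists_near_of_norm_square_sub_lt (𝕜 := 𝕜) (V := V) (A := F) hM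
      (lt_min hδ₁ hδ₂)
    refine ⟨η, hη, fun T U D' hT hU hTU => ?_⟩
    obtain ⟨q, rfl, hq₁, hq₂⟩ := h' p D' T U hp hT hU hTU
    have : q ∈ O₁ ×ˢ O₂ := ⟨h₁ _ (hq₁.mono (by linarith [min_le_left δ₁ δ₂])),
      h₂ _ (hq₂.mono (by linarith [min_le_right δ₁ δ₂]))⟩
    exact hsub this
  nhds_right := by
    intro D hD ε hε
    induction D using Quotient.inductionOn with | h p => ?_
    obtain ⟨M, hM, hp⟩ := exists_isReg p
    obtain ⟨δ, hδ, h⟩ := hF.exists_hasNu₂_norm_sub_lt V hM hε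
    refine ⟨_, isOpenMap_mk_pair.image_mem_nhds (prod_mem_nhds
      (near_mem_nhds p.1 (c := 1 + δ) (by linarith))
      (near_mem_nhds p.2 (c := 1 + δ) (by linarith))), ?_⟩
    rintro _ ⟨q, ⟨hq₁, hq₂⟩, rfl⟩ hq
    exact h p q hD hq hp hq₁ hq₂

theorem omegaTilde₂_le (p q : NormPair 𝕜 V) :
    omegaTilde₂ (Quotient.mk (pairSetoid 𝕜 V) p) (Quotient.mk (pairSetoid 𝕜 V) q) ≤
      omega₂ p q := by
  refine csInf_le ⟨0, ?_⟩ ⟨p, q, rfl, rfl, rfl⟩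
  rintro r ⟨p, q, _, _, rfl⟩
  exact add_nonneg (omega_nonneg _ _) (omega_nonneg _ _)

/-- The infimum varies both representatives; translating an almost optimal pair by one `Δ` restores
`p` and preserves the comparison factors. -/
theorem exists_near_of_omegaTilde₂_lt {p : NormPair 𝕜 V} {D : PairSpace 𝕜 V} {c : ℝ}
    (h : omegaTilde₂ (Quotient.mk (pairSetoid 𝕜 V) p) D < c) :
    ∃ q, D = Quotient.mk (pairSetoid 𝕜 V) q ∧ Near (Real.exp c) p.1 q.1 ∧
      Near (Real.exp c) p.2 q.2 := by
  induction D using Quotient.inductionOn with | h q₀ => ?_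
  have hne : {r | ∃ p' q : NormPair 𝕜 V, Quotient.mk (pairSetoid 𝕜 V) p' =
    Quotient.mk (pairSetoid 𝕜 V) p ∧ Quotient.mk (pairSetoid 𝕜 V) q =
    Quotient.mk (pairSetoid 𝕜 V) q₀ ∧ r = omega₂ p' q}.Nonempty := ⟨_, p, q₀, rfl, rfl, rfl⟩
  obtain ⟨_, ⟨p', q, hp, hq, rfl⟩, hlt⟩ := exists_lt_of_csInf_lt hne h
  obtain ⟨Δ, rfl⟩ := mk_pair_eq_iff.1 hp.symm
  have h1 := omega_nonneg p'.1 q.1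
  have h2 := omega_nonneg p'.2 q.2
  rw [omega₂] at hlt
  refine ⟨pairComp q Δ, ?_, (near_of_omega_le (by linarith)).comp Δ,
    (near_of_omega_le (by linarith)).comp Δ.symm.dualMap⟩
  rw [← hq]
  exact (mk_pair_eq_iff.2 ⟨Δ, rfl⟩ :
    Quotient.mk (pairSetoid 𝕜 V) (pairComp q Δ) = Quotient.mk (pairSetoid 𝕜 V) q).symm

theorem IsFraisse.uniformlyEquivalentOn_omegaTilde₂ (hF : IsFraisse 𝕜 F)
    {S : Set (PairSpace 𝕜 V)} (hS : S ⊆ pairsIn 𝕜 V F) (hb : IsBoundedFor omegaTilde₂ S) :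
    UniformlyEquivalentOn S (squareDist F) omegaTilde₂ := by
  intro ε hε
  rcases S.eq_empty_or_nonempty with rfl | ⟨D₀, hD₀⟩
  · exact ⟨1, one_pos, by simp⟩
  obtain ⟨C, hC⟩ := hb
  induction D₀ using Quotient.inductionOn with | h p₀ => ?_
  obtain ⟨M₀, hM₀, hp₀⟩ := exists_isReg p₀
  set M := M₀ * Real.exp (C + 1) with hMdef
  have hM : 0 ≤ M := mul_nonneg hM₀ (Real.exp_pos _).le
  -- Every class in `S` has a representative near `p₀`, so one `M` controls them all. The bound uses
  -- `C + 1` because the infimum need not be attained.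
  have hrep : ∀ D ∈ S, ∃ p, D = Quotient.mk (pairSetoid 𝕜 V) p ∧ IsReg M p := by
    intro D hD
    obtain ⟨p, rfl, h1, h2⟩ := exists_near_of_omegaTilde₂_lt
      ((hC _ hD₀ D hD).trans_lt (lt_add_one C))
    exact ⟨p, rfl, hp₀.of_near hM₀ (Real.exp_pos _).le h1 h2⟩
  obtain ⟨δ, hδ, h⟩ := hF.exists_hasNu₂_norm_sub_lt V hM hε
  -- Each of the two summands of `ω₂` will be at most `ε / 3`.
  have hexp : 0 < Real.exp (ε / 3) - 1 := by
    have := Real.add_one_lt_exp (x := ε / 3) (by linarith)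
    linarith
  obtain ⟨η, hη, h'⟩ := exists_near_of_norm_square_sub_lt (𝕜 := 𝕜) (V := V) (A := F) hM hexp
  have hat := hF.almostTransitive_weakStarOps V
  have hlog : 0 < Real.log (1 + δ) := Real.log_pos (by linarith)
  refine ⟨min η (Real.log (1 + δ)), lt_min hη hlog, fun D hD D' hD' =>
    ⟨fun hd => ?_, fun hd => ?_⟩⟩
  · obtain ⟨p, rfl, hp⟩ := hrep D hD
    obtain ⟨T, U, hT, hU, hTU⟩ := hat.exists_lt (δ := squareDist F) (fun _ _ => rfl) (hS hD)
      (hS hD') (hd.trans_le (min_le_left _ _))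
    obtain ⟨q, rfl, h1, h2⟩ := h' p D' T U hp hT hU hTU
    have h3 := omega_le_of_near (by linarith) h1
    have h4 := omega_le_of_near (by linarith) h2
    rw [add_sub_cancel, Real.log_exp] at h3 h4
    refine (omegaTilde₂_le p q).trans_lt ?_
    rw [omega₂]
    linarith
  · obtain ⟨p, rfl, hp⟩ := hrep D hD
    obtain ⟨q, rfl, h1, h2⟩ := exists_near_of_omegaTilde₂_lt (hd.trans_le (min_le_right _ _))
    rw [Real.exp_log (by linarith)] at h1 h2
    obtain ⟨T, U, hT, hU, hTU⟩ := h p q (hS hD) (hS hD') hp h1 h2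
    exact (hat.dist_le (δ := squareDist F) (fun _ _ => rfl) hT hU).trans_lt hTU

theorem Transfers.squareDist_le (h : Transfers 𝕜 V A B) (h' : Transfers 𝕜 (Module.Dual 𝕜 V) A B)
    {D D' : PairSpace 𝕜 V} (hDA : D ∈ pairsIn 𝕜 V A) (hDA' : D' ∈ pairsIn 𝕜 V A)
    (hDB : D ∈ pairsIn 𝕜 V B) (hDB' : D' ∈ pairsIn 𝕜 V B) :
    squareDist B D D' ≤ squareDist A D D' := by
  induction D using Quotient.inductionOn with | h p => ?_
  induction D' using Quotient.inductionOn with | h q => ?_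
  rw [mk_mem_pairsIn] at *
  obtain ⟨⟨T₀, hT₀⟩, ⟨T₁, hT₁⟩⟩ := hDA
  obtain ⟨⟨U₀, hU₀⟩, ⟨U₁, hU₁⟩⟩ := hDA'
  refine le_csInf ⟨_, _, _, hasNu₂_square hT₀ hT₁, hasNu₂_square hU₀ hU₁, rfl⟩ ?_
  clear! T₀ T₁ U₀ U₁
  rintro r ⟨T, U, hT, hU, rfl⟩
  obtain ⟨T₀, T₁, hT₀, hT₁, rfl⟩ := hasNu₂_mk_iff.1 hT
  obtain ⟨U₀, U₁, hU₀, hU₁, rfl⟩ := hasNu₂_mk_iff.1 hU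
  obtain ⟨M₁, hM₁, hp₁⟩ := exists_isReg p
  obtain ⟨M₂, hM₂, hq₂⟩ := exists_isReg q
  have hM : 0 ≤ M₁ + M₂ := add_nonneg hM₁ hM₂
  have hp := hp₁.mono (le_add_of_nonneg_right hM₂)
  have hq := hq₂.mono (le_add_of_nonneg_left hM₁)
  set M := M₁ + M₂
  set N : ℝ := 3 * Module.finrank 𝕜 V * (M * M) with hN
  set d := ‖square T₀ T₁ - square U₀ U₁‖ with hd
  have hd0 : 0 ≤ d := norm_nonneg (square T₀ T₁ - square U₀ U₁)
  -- Correcting `T` and `U` costs `ε * N` each, and the two transfer maps multiply `d` by `(1 + ε) *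
  -- (1 + ε) ≤ 1 + 3 * ε`.
  refine le_of_forall_le_add_mul (C := 2 * N + 3 * d) fun ε hε hε1 => ?_
  obtain ⟨W₀, θ₀, t₀, u₀, T₀', U₀', ht₀, hu₀, hθ₀, hT₀', hU₀', hTθ₀, hUθ₀⟩ :=
    h p.1 hDB.1 q.1 hDB'.1 T₀ U₀ hT₀ hU₀ ε hε
  obtain ⟨W₁, θ₁, t₁, u₁, T₁', U₁', ht₁, hu₁, hθ₁, hT₁', hU₁', hTθ₁, hUθ₁⟩ :=
    h' p.2 hDB.2 q.2 hDB'.2 T₁ U₁ hT₁ hU₁ ε hε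
  have hle : squareDist B (Quotient.mk (pairSetoid 𝕜 V) p) (Quotient.mk (pairSetoid 𝕜 V) q) ≤
      ‖square T₀' T₁' - square U₀' U₁'‖ := by
    refine csInf_le ⟨0, ?_⟩ ⟨_, _, hasNu₂_square hT₀' hT₁', hasNu₂_square hU₀' hU₁', rfl⟩
    rintro r ⟨T, U, _, _, rfl⟩
    exact norm_nonneg (T - U)
  have h1 := hp.norm_square_sub_le (U₀ := θ₀ ∘ₗ t₀) (U₁ := θ₁ ∘ₗ t₁) hM hε.le hε1 hT₀' hT₁'
    hTθ₀ hTθ₁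
  have h2 := hq.norm_square_sub_le (U₀ := θ₀ ∘ₗ u₀) (U₁ := θ₁ ∘ₗ u₁) hM hε.le hε1 hU₀' hU₁'
    hUθ₀ hUθ₁
  have h3 := norm_square_comp_sub_le (by linarith : (0 : ℝ) ≤ 1 + ε) hθ₀ hθ₁ t₀ u₀ t₁ u₁
  rw [show W₀.subtype ∘ₗ t₀ = T₀ from LinearMap.ext ht₀,
    show W₀.subtype ∘ₗ u₀ = U₀ from LinearMap.ext hu₀,
    show W₁.subtype ∘ₗ t₁ = T₁ from LinearMap.ext ht₁,
    show W₁.subtype ∘ₗ u₁ = U₁ from LinearMap.ext hu₁, ← hd] at h3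
  have h4 : ‖square T₀' T₁' - square U₀' U₁'‖ ≤
      ‖square T₀' T₁' - square (θ₀ ∘ₗ t₀) (θ₁ ∘ₗ t₁)‖ +
      ‖square (θ₀ ∘ₗ t₀) (θ₁ ∘ₗ t₁) - square (θ₀ ∘ₗ u₀) (θ₁ ∘ₗ u₁)‖ +
      ‖square U₀' U₁' - square (θ₀ ∘ₗ u₀) (θ₁ ∘ₗ u₁)‖ := by
    rw [norm_sub_rev (square U₀' U₁')]
    exact (norm_sub_le_norm_sub_add_norm_sub _ (square (θ₀ ∘ₗ u₀) (θ₁ ∘ₗ u₁)) _).trans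
      (add_le_add_left (norm_sub_le_norm_sub_add_norm_sub _ _ _) _)
  have h5 : (1 + ε) * (1 + ε) * d ≤ (1 + 3 * ε) * d :=
    mul_le_mul_of_nonneg_right (by nlinarith) hd0
  linarith

end SquareDistance

/-! ### Inclusion and density for classes and pairs -/

section FraisseLimit

variable {𝕜 : Type*} [RCLike 𝕜] {V : Type*} [AddCommGroup V] [Module 𝕜 V] [FiniteDimensional 𝕜 V]
  {E F : Type*} [NormedAddCommGroup E] [NormedSpace 𝕜 E] [NormedAddCommGroup F] [NormedSpace 𝕜 F]

theorem IsFraisseLimit.bmIn_subset (hF : IsFraisseLimit 𝕜 (fun W : Age 𝕜 E => W.1) F) :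
    bmIn 𝕜 V E ⊆ bmIn 𝕜 V F := image_mono hF.normsIn_subset

theorem IsFraisseLimit.subset_closure_bmIn
    (hF : IsFraisseLimit 𝕜 (fun W : Age 𝕜 E => W.1) F) :
    bmIn 𝕜 V F ⊆ closure (bmIn 𝕜 V E) :=
  (image_mono hF.subset_closure_normsIn).trans
    (image_closure_subset_closure_image continuous_quotient_mk')

theorem IsFraisseLimit.pairsIn_subset (hF : IsFraisseLimit 𝕜 (fun W : Age 𝕜 E => W.1) F) :
    pairsIn 𝕜 V E ⊆ pairsIn 𝕜 V F :=
  image_mono (prod_mono hF.normsIn_subset hF.normsIn_subset)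

theorem IsFraisseLimit.subset_closure_pairsIn
    (hF : IsFraisseLimit 𝕜 (fun W : Age 𝕜 E => W.1) F) :
    pairsIn 𝕜 V F ⊆ closure (pairsIn 𝕜 V E) := by
  refine (image_mono ?_).trans (image_closure_subset_closure_image continuous_quotient_mk')
  rw [closure_prod_eq]
  exact prod_mono hF.subset_closure_normsIn hF.subset_closure_normsIn

end FraisseLimit

/-! ### Assembly of the three parts -/

theorem nonempty_normOn (𝕜 : Type*) [RCLike 𝕜] (V : Type*) [AddCommGroup V] [Module 𝕜 V]
    [FiniteDimensional 𝕜 V] : Nonempty (NormOn 𝕜 V) := by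
  let e : V ≃ₗ[𝕜] (Fin (Module.finrank 𝕜 V) → 𝕜) := (Module.finBasis 𝕜 V).equivFun
  exact ⟨NormOn.ofInjective e.toLinearMap e.injective⟩

end OrbitMetrics

theorem mainTheorem8 {𝕜 : Type*} [RCLike 𝕜]
    -- `E` is a norm on the space of finitely supported sequences, with unit basis `b`
    {E : Type*} [NormedAddCommGroup E] [NormedSpace 𝕜 E] (b : Module.Basis ℕ 𝕜 E)
    (hE : IsAmalgamationClass 𝕜 (fun W : Age 𝕜 E => W.1))
    -- the Fraïssé limit of `Age(E)`
    {F : Type*} [NormedAddCommGroup F] [NormedSpace 𝕜 F]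
    (hF : IsFraisseLimit 𝕜 (fun W : Age 𝕜 E => W.1) F) :
    -- full rank operators
    (∀ (X : Type*) [NormedAddCommGroup X] [NormedSpace 𝕜 X] [FiniteDimensional 𝕜 X],
      IsCompatibleMetricOn (normsIn 𝕜 X F) (partialDist F) ∧
      (∀ A ⊆ normsIn 𝕜 X F, IsBoundedFor omega A →
        UniformlyEquivalentOn A (partialDist F) omega) ∧
      (∀ m ∈ normsIn 𝕜 X E, ∀ n ∈ normsIn 𝕜 X E, partialDist E m n = partialDist F m n) ∧
      normsIn 𝕜 X E ⊆ normsIn 𝕜 X F ∧ normsIn 𝕜 X F ⊆ closure (normsIn 𝕜 X E) ∧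
      IdentifiesOrbitSpace (fullRankOps 𝕜 X F) (fun T U => ‖T - U‖) isoActOps
        HasNu (normsIn 𝕜 X F) (partialDist F)) ∧
    -- Grassmannians
    (∀ k : ℕ,
      IsCompatibleMetricOn (bmIn 𝕜 (Fin k → 𝕜) F) (kadetsDist F) ∧
      (∀ b ∈ bmIn 𝕜 (Fin k → 𝕜) E, ∀ c ∈ bmIn 𝕜 (Fin k → 𝕜) E,
        kadetsDist F b c = kadetsDist E b c) ∧
      bmIn 𝕜 (Fin k → 𝕜) E ⊆ bmIn 𝕜 (Fin k → 𝕜) F ∧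
      bmIn 𝕜 (Fin k → 𝕜) F ⊆ closure (bmIn 𝕜 (Fin k → 𝕜) E) ∧
      IdentifiesOrbitSpace (grassmannian 𝕜 F k) gap isoActGr
        HasTau (bmIn 𝕜 (Fin k → 𝕜) F) (kadetsDist F)) ∧
    -- operators of rank `k` from the dual
    (∀ k : ℕ,
      IsCompatibleMetricOn (pairsIn 𝕜 (Fin k → 𝕜) F) (squareDist F) ∧
      (∀ A ⊆ pairsIn 𝕜 (Fin k → 𝕜) F, IsBoundedFor omegaTilde₂ A →
        UniformlyEquivalentOn A (squareDist F) omegaTilde₂) ∧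
      (∀ D ∈ pairsIn 𝕜 (Fin k → 𝕜) E, ∀ D' ∈ pairsIn 𝕜 (Fin k → 𝕜) E,
        squareDist E D D' = squareDist F D D') ∧
      pairsIn 𝕜 (Fin k → 𝕜) E ⊆ pairsIn 𝕜 (Fin k → 𝕜) F ∧
      pairsIn 𝕜 (Fin k → 𝕜) F ⊆ closure (pairsIn 𝕜 (Fin k → 𝕜) E) ∧
      IdentifiesOrbitSpace (weakStarOps 𝕜 (Fin k → 𝕜) F) (fun T U => ‖T - U‖) isoActSquare
        HasNu₂ (pairsIn 𝕜 (Fin k → 𝕜) F) (squareDist F)) := by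
  refine ⟨fun X _ _ _ => ?_, fun k => ?_, fun k => ?_⟩
  · have hat := hF.fraisse.almostTransitive_fullRankOps X
    have : Nonempty (NormOn 𝕜 X) := nonempty_normOn 𝕜 X
    refine ⟨hat.isCompatibleMetricOn fun _ _ => rfl,
      fun A hA hb => hF.fraisse.uniformlyEquivalentOn_omega hA hb, fun m hm n hn => ?_,
      hF.normsIn_subset, hF.subset_closure_normsIn, hat.identifiesOrbitSpace fun _ _ => rfl⟩
    have hm' := hF.normsIn_subset hm
    have hn' := hF.normsIn_subset hn
    exact le_antisymm ((hF.transfers_right hE).partialDist_le hm' hn' hm hn)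
      (hF.transfers_left.partialDist_le hm hn hm' hn')
  · have hat := hF.fraisse.almostTransitive_grassmannian (Fin k → 𝕜) (Module.finrank_fin_fun 𝕜)
    have : Nonempty (BMSpace 𝕜 (Fin k → 𝕜)) := (nonempty_normOn 𝕜 _).map (Quotient.mk _)
    refine ⟨hat.isCompatibleMetricOn fun _ _ => rfl, fun b hb c hc => ?_,
      hF.bmIn_subset, hF.subset_closure_bmIn, hat.identifiesOrbitSpace fun _ _ => rfl⟩
    have hb' := hF.bmIn_subset hb
    have hc' := hF.bmIn_subset hc
    exact le_antisymm (hF.transfers_left.kadetsDist_le hb hc hb' hc')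
      ((hF.transfers_right hE).kadetsDist_le hb' hc' hb hc)
  · have hat := hF.fraisse.almostTransitive_weakStarOps (Fin k → 𝕜)
    obtain ⟨m⟩ := nonempty_normOn 𝕜 (Fin k → 𝕜)
    obtain ⟨n⟩ := nonempty_normOn 𝕜 (Module.Dual 𝕜 (Fin k → 𝕜))
    have : Nonempty (PairSpace 𝕜 (Fin k → 𝕜)) := ⟨Quotient.mk _ (m, n)⟩
    refine ⟨hat.isCompatibleMetricOn fun _ _ => rfl,
      fun A hA hb => hF.fraisse.uniformlyEquivalentOn_omegaTilde₂ hA hb, fun D hD D' hD' => ?_,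
      hF.pairsIn_subset, hF.subset_closure_pairsIn, hat.identifiesOrbitSpace fun _ _ => rfl⟩
    have hD₁ := hF.pairsIn_subset hD
    have hD₁' := hF.pairsIn_subset hD'
    exact le_antisymm
      ((hF.transfers_right hE).squareDist_le (hF.transfers_right hE) hD₁ hD₁' hD hD')
      (hF.transfers_left.squareDist_le hF.transfers_left hD hD' hD₁ hD₁')
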